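/- Let $G$ be a finite group and let $(g_1,\dots,g_r)$ be spherical generators of $G$, i.e. the $g_i$ generate $G$ and $g_1\cdots g_r=1$. Say that $(g_1,\dots,g_r)$ *extends a good presentation* if there is a finite presentation $G\cong\langle a_1,\dots,a_s\mid R\rangle$ such that: 1. under the isomorphism, $\{a_1,\dots,a_s\}\subset\{g_1,\dots,g_r\}$; 2. for each $i$ there are an index $j$, an integer $\ell$ and $h\in G$ with $g_i=h\,a_j^{\ell}\,h^{-1}$; 3. each $w\in R$ is conjugate, in the free group on $a_1,\dots,a_s$, to a word of one of the following two forms: (a) $a_i^{e_1}\,h\,a_j^{e_2}\,h^{-1}$, where $h$ is any word in the $a_k$ and $e_1,e_2$ are integers; (b) $\prod_{i=1}^r \tilde h_i\,a_{j(i)}^{\ell_i}\,\tilde h_i^{-1}$ (ordered product), where $j(i)\in\{1,\dots,s\}$, $\ell_i\in\mathbb Z$ and the $\tilde h_i$ are words such that, for each $i$, $\tilde h_i\,a_{j(i)}^{\ell_i}\,\tilde h_i^{-1}$ evaluates to $g_i$ in $G$. Let $m_i$ be the order of $g_i$, let $$T=T(m_1,\dots,m_r)=\langle c_1,\dots,c_r\mid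 c_1^{m_1}=\dots=c_r^{m_r}=1,\ c_1\cdots c_r=1\rangle,$$ let $\varphi:T\to G$ be the homomorphism $c_i\mapsto g_i$, and let $E=\{(w_1,w_2)\in T\times T\mid \varphi(w_1)=\varphi(w_2)\}$. **Proposition.** Suppose that the spherical generators $(g_1,\dots,g_r)$ of $G$ extend a good presentation. Then: * $E$ is normally generated by torsion: $E$ is the normal closure of its set of elements of finite order. * Let $C_1,C_2$ be smooth projective complex curves (compact connected Riemann surfaces) with faithful holomorphic $G$-actions, each of which is a $G$-cover of $\mathbb P^1=C_k/G$ with monodromy $(g_1,\dots,g_r)$: that is, for some distinct points $p_1,\dots,p_r\in\mathbb P^1$ (which may depend on $k$) outside of which $C_k\to\mathbb P^1$ is étale, some base point of $\mathbb P^1\setminus\{p_1,\dots,p_r\}$, and some simple loops $\gamma_i$ around the $p_i$ that generate $\pi_1(\mathbb P^1\setminus\{p_1,\dots,p_r\})$ and satisfy $\gamma_1\cdots\gamma_r=1$, the lift of $\gamma_i$ starting at a fixed point $c_0$ over the base point ends at $g_i\cdot c_0$ for every $i$. (For instance $C_1=C_2$.) Let $X$ be the minimal resolution of the quotient $Y=(C_1\times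 C_2)/G$ by the diagonal action. Then $X$ is simply connected. -/

import Mathlib

open scoped Manifold ContDiff Topology

/-! ### Group theory: spherical generators, good presentations, the orbifold group -/

section GroupTheory

variable {G : Type*} [Group G] {r : ℕ}

/-- A list `g₁, …, g_r` that generates `G` and satisfies `g₁ ⋯ g_r = 1`. -/
structure IsSphericalGenerators (g : Fin r → G) : Prop where
  closure_eq_top : Subgroup.closure (Set.range g) = ⊤
  prod_eq_one : (List.ofFn g).prod = 1

/-- Words `a_i ^ e₁ * h * a_j ^ e₂ * h⁻¹`, for any word `h` and integers `e₁`, `e₂`. -/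
def IsConjugationWord {s : ℕ} (w : FreeGroup (Fin s)) : Prop :=
  ∃ (i j : Fin s) (e₁ e₂ : ℤ) (h : FreeGroup (Fin s)),
    w = FreeGroup.of i ^ e₁ * h * FreeGroup.of j ^ e₂ * h⁻¹

/-- Words `∏ i, h i * a_{j i} ^ ℓ i * (h i)⁻¹` (ordered product over `i = 1, …, r`), where the
`i`-th factor is a word in `a₁, …, a_s` that evaluates to `g i` in `G`. -/
def IsProductWord {s : ℕ} (g : Fin r → G) (a : Fin s → G) (w : FreeGroup (Fin s)) : Prop :=
  ∃ (j : Fin r → Fin s) (l : Fin r → ℤ) (h : Fin r → FreeGroup (Fin s)),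
    (∀ i, g i = FreeGroup.lift a (h i) * a (j i) ^ l i * (FreeGroup.lift a (h i))⁻¹) ∧
    w = (List.ofFn fun i => h i * FreeGroup.of (j i) ^ l i * (h i)⁻¹).prod

/-- The list `g` extends a good presentation: there is a finite presentation
`e : ⟨a₁, …, a_s ∣ R⟩ ≃* G` whose generators are among the `g i`, such that each `g i` is conjugate
to a power of some generator and each relator is conjugate (in the free group) to a conjugation
word or a product word. -/
def ExtendsGoodPresentation (g : Fin r → G) : Prop :=
  ∃ (s : ℕ) (R : Finset (FreeGroup (Fin s)))
    (e : PresentedGroup (R : Set (FreeGroup (Fin s))) ≃* G) (a : Fin s → G),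
    (∀ k, a k = e (PresentedGroup.of k)) ∧
    (∀ k, a k ∈ Set.range g) ∧
    (∀ i, ∃ (j : Fin s) (l : ℤ) (h : G), g i = h * a j ^ l * h⁻¹) ∧
    (∀ w ∈ R, ∃ v, IsConj v w ∧ (IsConjugationWord v ∨ IsProductWord g a v))

/-- The relators `c₁ ^ m₁, …, c_r ^ m_r, c₁ ⋯ c_r`. -/
def orbifoldRelators (m : Fin r → ℕ) : Set (FreeGroup (Fin r)) :=
  Set.range (fun i => FreeGroup.of i ^ m i) ∪ {(List.ofFn fun i => FreeGroup.of i).prod}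

/-- The group `T(m₁, …, m_r) = ⟨c₁, …, c_r ∣ c₁ ^ m₁, …, c_r ^ m_r, c₁ ⋯ c_r⟩`. -/
abbrev OrbifoldT (m : Fin r → ℕ) : Type := PresentedGroup (orbifoldRelators m)

theorem lift_orbifoldRelators_eq_one (g : Fin r → G) (hg : (List.ofFn g).prod = 1) :
    ∀ w ∈ orbifoldRelators (fun i => orderOf (g i)), FreeGroup.lift g w = 1 := by
  rintro w (⟨i, rfl⟩ | rfl)
  · simp [pow_orderOf_eq_one]
  · rw [map_list_prod, List.map_ofFn, ← hg]
    congr 2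
    funext i
    simp

/-- The classifying map `φ : T(m₁, …, m_r) → G`, `c_i ↦ g_i`, where `m_i` is the order of `g_i`. -/
def classifyingMap (g : Fin r → G) (hg : IsSphericalGenerators g) :
    OrbifoldT (fun i => orderOf (g i)) →* G :=
  PresentedGroup.toGroup (lift_orbifoldRelators_eq_one g hg.prod_eq_one)

/-- The orbifold group `E = {(w₁, w₂) ∣ φ w₁ = φ w₂} ⊆ T(m₁, …, m_r)²`, the fibre product of two
copies of `φ` over `G`. -/
def orbifoldGroup (g : Fin r → G) (hg : IsSphericalGenerators g) :
    Subgroup (OrbifoldT (fun i => orderOf (g i)) × OrbifoldT (fun i => orderOf (g i))) :=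
  ((classifyingMap g hg).comp (MonoidHom.fst _ _)).eqLocus
    ((classifyingMap g hg).comp (MonoidHom.snd _ _))

/-- A group is normally generated by torsion if it is the normal closure of its set of elements of
finite order. -/
def NormallyGeneratedByTorsion (H : Type*) [Group H] : Prop :=
  Subgroup.normalClosure {x : H | IsOfFinOrder x} = ⊤

end GroupTheory

/-! ### The Riemann sphere as a complex manifold -/

namespace RiemannSphere

/-- The standard coordinate `z` on the complement of `∞`. -/
noncomputable def finiteChart : OpenPartialHomeomorph (OnePoint ℂ) ℂ :=
  (OnePoint.isOpenEmbedding_coe (X := ℂ)).toOpenPartialHomeomorph.symm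

open Classical in
/-- The inversion `z ↦ 1 / z`, exchanging `0` and `∞`. -/
noncomputable def inversion (x : OnePoint ℂ) : OnePoint ℂ :=
  x.elim ((0 : ℂ) : OnePoint ℂ)
    (fun z : ℂ => if z = 0 then OnePoint.infty else ((z⁻¹ : ℂ) : OnePoint ℂ))

theorem inversion_infty : inversion OnePoint.infty = ((0 : ℂ) : OnePoint ℂ) := rfl

theorem inversion_zero : inversion ((0 : ℂ) : OnePoint ℂ) = OnePoint.infty := by
  simp [inversion]

theorem inversion_coe {z : ℂ} (hz : z ≠ 0) :
    inversion (z : OnePoint ℂ) = ((z⁻¹ : ℂ) : OnePoint ℂ) := by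
  simp [inversion, hz]

theorem inversion_inversion (x : OnePoint ℂ) : inversion (inversion x) = x := by
  induction x using OnePoint.rec with
  | infty => rw [inversion_infty, inversion_zero]
  | coe z =>
    by_cases hz : z = 0
    · subst hz; rw [inversion_zero, inversion_infty]
    · rw [inversion_coe hz, inversion_coe (inv_ne_zero hz), inv_inv]

theorem continuous_inversion : Continuous inversion := by
  have key : Filter.Tendsto (fun z : ℂ => inversion (z : OnePoint ℂ))
      (Filter.coclosedCompact ℂ) (𝓝 ((0 : ℂ) : OnePoint ℂ)) := by
    rw [Filter.coclosedCompact_eq_cocompact, ← Metric.cobounded_eq_cocompact]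
    have h : Filter.Tendsto (fun z : ℂ => ((z⁻¹ : ℂ) : OnePoint ℂ)) (Bornology.cobounded ℂ)
        (𝓝 ((0 : ℂ) : OnePoint ℂ)) :=
      (OnePoint.continuous_coe.tendsto (0 : ℂ)).comp Filter.tendsto_inv₀_cobounded
    refine h.congr' ?_
    filter_upwards [Bornology.eventually_ne_cobounded (0 : ℂ)] with z hz
    rw [inversion_coe hz]
  rw [OnePoint.continuous_iff]
  refine ⟨key, ?_⟩
  rw [continuous_iff_continuousAt]
  intro z
  by_cases hz : z = 0
  · subst hz
    rw [continuousAt_iff_punctured_nhds, inversion_zero]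
    have h : Filter.Tendsto (fun z : ℂ => ((z⁻¹ : ℂ) : OnePoint ℂ)) (𝓝[≠] 0)
        (𝓝 (OnePoint.infty : OnePoint ℂ)) := by
      refine OnePoint.tendsto_coe_infty.comp ?_
      rw [Filter.coclosedCompact_eq_cocompact, ← Metric.cobounded_eq_cocompact]
      exact Filter.tendsto_inv₀_nhdsNE_zero
    refine h.congr' ?_
    filter_upwards [self_mem_nhdsWithin] with z hz
    rw [inversion_coe hz]
  · have h : ContinuousAt (fun z : ℂ => ((z⁻¹ : ℂ) : OnePoint ℂ)) z :=
      OnePoint.continuous_coe.continuousAt.comp (continuousAt_inv₀ hz)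
    refine h.congr ?_
    filter_upwards [isOpen_ne.mem_nhds hz] with w hw
    rw [inversion_coe hw]

/-- The inversion as a homeomorphism. -/
noncomputable def inversionHomeomorph : OnePoint ℂ ≃ₜ OnePoint ℂ where
  toFun := inversion
  invFun := inversion
  left_inv := inversion_inversion
  right_inv := inversion_inversion
  continuous_toFun := continuous_inversion
  continuous_invFun := continuous_inversion

/-- The coordinate `1 / z` on the complement of `0`. -/
noncomputable def infinityChart : OpenPartialHomeomorph (OnePoint ℂ) ℂ :=
  inversionHomeomorph.toOpenPartialHomeomorph.trans finiteChart

theorem finiteChart_source : finiteChart.source = {OnePoint.infty}ᶜ := by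
  simp [finiteChart, OnePoint.compl_infty]

theorem infinityChart_source : infinityChart.source = {((0 : ℂ) : OnePoint ℂ)}ᶜ := by
  ext x
  simp only [infinityChart, OpenPartialHomeomorph.trans_source, finiteChart_source,
    Homeomorph.toOpenPartialHomeomorph_source, Set.univ_inter, Set.mem_preimage,
    Set.mem_compl_iff, Set.mem_singleton_iff, Homeomorph.toOpenPartialHomeomorph_apply]
  refine not_congr ⟨fun h => ?_, fun h => ?_⟩
  · have h' : inversion x = OnePoint.infty := h
    rw [← inversion_inversion x, h', inversion_infty]
  · rw [h]; exact inversion_zero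

theorem finiteChart_coe (z : ℂ) : finiteChart (z : OnePoint ℂ) = z :=
  (OnePoint.isOpenEmbedding_coe (X := ℂ)).toOpenPartialHomeomorph_left_inv _

open Classical in
/-- The Riemann sphere `ℂ ∪ {∞}` with its two standard charts `z` and `1 / z`. -/
noncomputable instance instChartedSpace : ChartedSpace ℂ (OnePoint ℂ) where
  atlas := {finiteChart, infinityChart}
  chartAt x := if x = OnePoint.infty then infinityChart else finiteChart
  mem_chart_source x := by
    by_cases hx : x = OnePoint.infty
    · simp only [hx, if_true, infinityChart_source, Set.mem_compl_iff, Set.mem_singleton_iff]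
      exact OnePoint.infty_ne_coe _
    · simp only [hx, if_false, finiteChart_source, Set.mem_compl_iff, Set.mem_singleton_iff,
        not_false_iff]
  chart_mem_atlas x := by
    by_cases hx : x = OnePoint.infty <;> simp [hx]

theorem finite_infinity_transition (z : ℂ) (hz : z ∈ (finiteChart.symm.trans infinityChart).source) :
    z ≠ 0 ∧ (finiteChart.symm.trans infinityChart) z = z⁻¹ := by
  rw [OpenPartialHomeomorph.trans_source, infinityChart_source] at hz
  have hz0 : z ≠ 0 := fun h => hz.2 (by rw [h]; rfl)
  refine ⟨hz0, ?_⟩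
  change finiteChart (inversion (z : OnePoint ℂ)) = z⁻¹
  rw [inversion_coe hz0, finiteChart_coe]

theorem infinity_finite_transition (z : ℂ) (hz : z ∈ (infinityChart.symm.trans finiteChart).source) :
    z ≠ 0 ∧ (infinityChart.symm.trans finiteChart) z = z⁻¹ := by
  rw [OpenPartialHomeomorph.trans_source, finiteChart_source] at hz
  have hz0 : z ≠ 0 := fun h => hz.2 (by rw [h]; exact inversion_zero)
  refine ⟨hz0, ?_⟩
  change finiteChart (inversion (z : OnePoint ℂ)) = z⁻¹
  rw [inversion_coe hz0, finiteChart_coe]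

instance instIsManifold : IsManifold 𝓘(ℂ) ω (OnePoint ℂ) := by
  have hself : ∀ e : OpenPartialHomeomorph (OnePoint ℂ) ℂ,
      ContDiffOn ℂ ω (e.symm.trans e) (e.symm.trans e).source := fun e =>
    contDiffOn_id.congr fun z hz => e.right_inv (by simp at hz; exact hz.1)
  refine isManifold_of_contDiffOn _ _ _ fun e e' he he' => ?_
  simp only [modelWithCornersSelf_coe, modelWithCornersSelf_coe_symm, Function.id_comp,
    Function.comp_id, Set.preimage_id, Set.range_id, Set.inter_univ]
  rcases he with rfl | rfl <;> rcases he' with rfl | rfl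
  · exact hself _
  · exact ContDiffOn.congr (f := fun z : ℂ => z⁻¹)
      (fun z hz => (contDiffAt_inv ℂ (finite_infinity_transition z hz).1).contDiffWithinAt)
      (fun z hz => (finite_infinity_transition z hz).2)
  · exact ContDiffOn.congr (f := fun z : ℂ => z⁻¹)
      (fun z hz => (contDiffAt_inv ℂ (infinity_finite_transition z hz).1).contDiffWithinAt)
      (fun z hz => (infinity_finite_transition z hz).2)
  · exact hself _

end RiemannSphere

/-! ### Monodromy of a branched Galois cover of the Riemann sphere -/

section Monodromy

/-- The sphere minus the points `p₁, …, p_r`. -/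
abbrev PuncturedSphere {r : ℕ} (p : Fin r → OnePoint ℂ) : Type :=
  {z : OnePoint ℂ // z ∉ Set.range p}

/-- `γ` is a simple loop around `p i` in the punctured sphere: up to homotopy it runs along a path
`α`, then once counterclockwise around a closed holomorphic disc `ψ` centred at `p i` that contains
no other `p j`, and then back along `α`. -/
def IsSimpleLoopAround {r : ℕ} (p : Fin r → OnePoint ℂ) (i : Fin r) {x₀ : PuncturedSphere p}
    (γ : Path x₀ x₀) : Prop :=
  ∃ (ψ : ℂ → OnePoint ℂ) (y : PuncturedSphere p) (α : Path x₀ y) (δ : Path y y),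
    ContMDiffOn 𝓘(ℂ) 𝓘(ℂ) ω ψ (Metric.ball 0 2) ∧
    Set.InjOn ψ (Metric.ball 0 2) ∧
    ψ 0 = p i ∧
    (∀ z ∈ Metric.closedBall (0 : ℂ) 1, z ≠ 0 → ψ z ∉ Set.range p) ∧
    (∀ t : unitInterval, (δ t : OnePoint ℂ) = ψ (Complex.exp (2 * Real.pi * Complex.I * (t : ℝ)))) ∧
    γ.Homotopic ((α.trans δ).trans α.symm)

/-- The concatenation `γ₁ γ₂ ⋯ γ_r` (first `γ₁`, then `γ₂`, and so on). -/
noncomputable def concatLoops {X : Type*} [TopologicalSpace X] {x : X} {r : ℕ} (γ : Fin r → Path x x) :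
    Path x x :=
  (List.ofFn γ).foldr Path.trans (Path.refl x)

/-- A standard system of loops `γ₁, …, γ_r` in the punctured sphere: `γ i` is a simple loop around
`p i`, the `γ i` generate the fundamental group, and `γ₁ ⋯ γ_r` is null-homotopic. -/
structure IsStandardLoopSystem {r : ℕ} (p : Fin r → OnePoint ℂ) (x₀ : PuncturedSphere p)
    (γ : Fin r → Path x₀ x₀) : Prop where
  simple : ∀ i, IsSimpleLoopAround p i (γ i)
  generates : Subgroup.closure (Set.range fun i =>
    FundamentalGroup.fromPath (Path.Homotopic.Quotient.mk (γ i))) = ⊤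
  prod_eq_one : (concatLoops γ).Homotopic (Path.refl x₀)

/-- The Riemann surface `C` with its `G`-action is a `G`-cover of the sphere with monodromy
`g₁, …, g_r`: there is a holomorphic surjection `f : C → ℂ ∪ {∞}` whose fibres are the `G`-orbits
(so that it identifies `C / G` with the sphere), étale away from distinct points `p₁, …, p_r`, such
that for a standard system of loops `γ i` around the `p i` the lift of `γ i` starting at a point
`c₀` over the base point ends at `g i • c₀`. -/
def HasMonodromy {G : Type*} [Group G] {r : ℕ} (g : Fin r → G) (C : Type*) [TopologicalSpace C]
    [ChartedSpace ℂ C] [MulAction G C] : Prop :=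
  ∃ (f : C → OnePoint ℂ) (p : Fin r → OnePoint ℂ) (x₀ : PuncturedSphere p)
    (γ : Fin r → Path x₀ x₀) (c₀ : C),
    ContMDiff 𝓘(ℂ) 𝓘(ℂ) ω f ∧
    Function.Surjective f ∧
    (∀ x y : C, f x = f y ↔ ∃ a : G, a • x = y) ∧
    Function.Injective p ∧
    (∀ x : C, f x ∉ Set.range p → MulAction.stabilizer G x = ⊥) ∧
    IsStandardLoopSystem p x₀ γ ∧
    f c₀ = x₀ ∧
    (∀ i, ∃ l : Path c₀ (g i • c₀), ∀ t, f (l t) = γ i t)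

end Monodromy

/-! ### Product-quotient surfaces and their minimal resolutions -/

section Surface

universe u

variable (G : Type*) [Group G] (C₁ C₂ : Type*) [MulAction G C₁] [MulAction G C₂]

/-- The quotient `Y = (C₁ × C₂) / G` by the diagonal action (with the quotient topology). -/
abbrev ProductQuotient : Type _ := MulAction.orbitRel.Quotient G (C₁ × C₂)

/-- The quotient map `q : C₁ × C₂ → Y`. -/
def ProductQuotient.mk (c : C₁ × C₂) : ProductQuotient G C₁ C₂ := Quotient.mk'' c

/-- The points of `C₁ × C₂` with trivial stabilizer, i.e. the locus where `C₁ × C₂ → Y` is étale,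
which is the preimage of the smooth locus `Y°` of `Y`. -/
def freeLocus : Set (C₁ × C₂) := {c | MulAction.stabilizer G c = ⊥}

variable [TopologicalSpace C₁] [ChartedSpace ℂ C₁] [TopologicalSpace C₂] [ChartedSpace ℂ C₂]

/-- A map `π` from a complex surface to the complex space `Y = (C₁ × C₂) / G` is holomorphic. The
holomorphic functions on an open subset `V` of `Y` are the functions that become holomorphic on
the preimage of `V` in `C₁ × C₂`, and `π` has to be continuous and to pull them back to holomorphic
functions. -/
def IsHolomorphicToQuotient {X : Type*} [TopologicalSpace X] [ChartedSpace (EuclideanSpace ℂ (Fin 2)) X]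
    (π : X → ProductQuotient G C₁ C₂) : Prop :=
  Continuous π ∧
  ∀ (V : Set (ProductQuotient G C₁ C₂)) (F : ProductQuotient G C₁ C₂ → ℂ), IsOpen V →
    ContMDiffOn (𝓘(ℂ).prod 𝓘(ℂ)) 𝓘(ℂ) ω (F ∘ ProductQuotient.mk G C₁ C₂)
      (ProductQuotient.mk G C₁ C₂ ⁻¹' V) →
    ContMDiffOn 𝓘(ℂ, EuclideanSpace ℂ (Fin 2)) 𝓘(ℂ) ω (F ∘ π) (π ⁻¹' V)

/-- `π : X → Y` is a resolution of singularities of `Y = (C₁ × C₂) / G`: it is proper, holomorphic,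
an isomorphism over `Y°` (its inverse there is induced by the holomorphic map `σ` on the preimage
of `Y°` in `C₁ × C₂`), and the preimage of `Y°` is dense in `X`. -/
structure IsResolution {X : Type*} [TopologicalSpace X] [ChartedSpace (EuclideanSpace ℂ (Fin 2)) X]
    (π : X → ProductQuotient G C₁ C₂) : Prop where
  proper : IsProperMap π
  holomorphic : IsHolomorphicToQuotient G C₁ C₂ π
  iso : ∃ σ : C₁ × C₂ → X,
    ContMDiffOn (𝓘(ℂ).prod 𝓘(ℂ)) 𝓘(ℂ, EuclideanSpace ℂ (Fin 2)) ω σ (freeLocus G C₁ C₂) ∧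
    ∀ c ∈ freeLocus G C₁ C₂, ∀ x : X, π x = ProductQuotient.mk G C₁ C₂ c ↔ x = σ c
  dense : Dense (π ⁻¹' (ProductQuotient.mk G C₁ C₂ '' freeLocus G C₁ C₂))

/-- `π : X → Y` is the minimal resolution of `Y = (C₁ × C₂) / G`: it is a resolution, and every
resolution of `Y` by a complex surface factors through it. -/
def IsMinimalResolution {X : Type u} [TopologicalSpace X] [ChartedSpace (EuclideanSpace ℂ (Fin 2)) X]
    (π : X → ProductQuotient G C₁ C₂) : Prop :=
  IsResolution G C₁ C₂ π ∧
  ∀ (X' : Type u) [TopologicalSpace X'] [ChartedSpace (EuclideanSpace ℂ (Fin 2)) X']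
    [IsManifold 𝓘(ℂ, EuclideanSpace ℂ (Fin 2)) ω X'] [T2Space X'] (π' : X' → ProductQuotient G C₁ C₂),
    IsResolution G C₁ C₂ π' →
    ∃ h : X' → X, ContMDiff 𝓘(ℂ, EuclideanSpace ℂ (Fin 2)) 𝓘(ℂ, EuclideanSpace ℂ (Fin 2)) ω h ∧ ∀ x, π (h x) = π' x

end Surface

/-!
Both claims rest on a fact about words. Let `F` be the free group on `x₁, …, x_r`, mapped to `G` by
`x i ↦ g i`. When `g` extends a good presentation, the fibre product of `F` with itself over `G` is
generated, as a normal subgroup of itself, by `(1, x₁ ⋯ x_r)` and by the pairs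
`(u * x i ^ e * u⁻¹, v * x j ^ f * v⁻¹)` that it contains (`mem_of_lift_eq_lift`). In the orbifold
group `E` the first element becomes trivial and the pairs have finite order, so `E` is normally
generated by torsion.

For the surface, let `U k` be the part of the curve `C k` over the punctured sphere `P k`. The
quotient `(U 1 × U 2) / G` is the complement of a nowhere dense analytic subset of the resolution
`X`, so loops in `X` can be pushed into it (`HasNiceBasis.exists_homotopic`). Its fundamental group
is the fibre product over `G` of those of `P 1` and `P 2`, which are generated by the standard loops
`γ i` with product `1`. By the fact about words, it suffices that every element of the fibre product
given by a pair of conjugates of powers `γ i ^ e` and `γ j ^ f` becomes trivial in `X`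
(`normalSubgroup_eq_top_of_extendsGoodPresentation`).

Up to a path to the base point, such a pair is the boundary of a holomorphic map from a punctured
disc to `X`: lift the map `z ↦ z ^ e` to a disc around the branch point `p i` to the first curve,
and `z ↦ z ^ f` to the disc around `p j` to the second (`BranchedCover.nonempty_discLift`). Towards
the puncture the map tends to a compact fibre of `X` over the product of the spheres. Instead of
extending it over the puncture, one shows that some small circle has a short image. Its image lies
in the zero set of the holomorphic function `X₁ ^ f - X₂ ^ e`, where `X₁` and `X₂` are coordinates
on the spheres. Hence, in suitable charts of `X`, each coordinate takes each value a bounded number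
of times on the punctured disc, and the image has finite area. By the length-area argument the
images of some circles are arbitrarily short, so one of them lies in a simply connected chart domain
and is null-homotopic (`homotopic_refl_of_holomorphic_curve`).
-/

/-! ### The fibre product of two free groups over a group with a good presentation -/

section GroupTheory

variable {G : Type*} [Group G] {r : ℕ}

/-- Integer exponents can be replaced by natural ones, as the generators of `G` have finite
order. -/
theorem conj_zpow_pair_mem [Finite G] (g : Fin r → G)
    (K : Subgroup (FreeGroup (Fin r) × FreeGroup (Fin r)))
    (htors : ∀ (u v : FreeGroup (Fin r)) (i j : Fin r) (e f : ℕ),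
      FreeGroup.lift g (u * FreeGroup.of i ^ e * u⁻¹) =
        FreeGroup.lift g (v * FreeGroup.of j ^ f * v⁻¹) →
      (u * FreeGroup.of i ^ e * u⁻¹, v * FreeGroup.of j ^ f * v⁻¹) ∈ K)
    (u v : FreeGroup (Fin r)) (i j : Fin r) (e f : ℤ)
    (h : FreeGroup.lift g (u * FreeGroup.of i ^ e * u⁻¹) =
        FreeGroup.lift g (v * FreeGroup.of j ^ f * v⁻¹)) :
    (u * FreeGroup.of i ^ e * u⁻¹, v * FreeGroup.of j ^ f * v⁻¹) ∈ K := by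
  have key : ∀ (i : Fin r) (e : ℤ), ∃ n k : ℕ,
      (FreeGroup.of i : FreeGroup (Fin r)) ^ e =
        FreeGroup.of i ^ n * (FreeGroup.of i ^ (orderOf (g i) * k))⁻¹ := by
    intro i e
    have hpos : (1 : ℤ) ≤ orderOf (g i) := by exact_mod_cast orderOf_pos (g i)
    refine ⟨(e + orderOf (g i) * |e|).toNat, e.natAbs, ?_⟩
    have h0 : 0 ≤ e + orderOf (g i) * |e| := by
      have := neg_abs_le e
      nlinarith [abs_nonneg e]
    rw [← zpow_natCast, ← zpow_natCast, ← zpow_neg, ← zpow_add, Int.toNat_of_nonneg h0]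
    congr 1
    push_cast
    ring
  have hlift : ∀ (u : FreeGroup (Fin r)) (i : Fin r) (k : ℕ),
      FreeGroup.lift g (u * FreeGroup.of i ^ (orderOf (g i) * k) * u⁻¹) = 1 := by
    intro u i k
    simp [pow_mul, pow_orderOf_eq_one]
  obtain ⟨n, k, hn⟩ := key i e
  obtain ⟨n', k', hn'⟩ := key j f
  have h1 := htors u 1 i j (orderOf (g i) * k) 0 (by rw [hlift]; simp)
  have h2 := htors 1 v i j 0 (orderOf (g j) * k') (by rw [hlift]; simp)
  have e1 : u * FreeGroup.of i ^ e * u⁻¹ = (u * FreeGroup.of i ^ n * u⁻¹) *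
      (u * FreeGroup.of i ^ (orderOf (g i) * k) * u⁻¹)⁻¹ := by rw [hn]; group
  have e2 : v * FreeGroup.of j ^ f * v⁻¹ = (v * FreeGroup.of j ^ n' * v⁻¹) *
      (v * FreeGroup.of j ^ (orderOf (g j) * k') * v⁻¹)⁻¹ := by rw [hn']; group
  have h3 := htors u v i j n n' (by
    rwa [e1, e2, map_mul, map_inv _ (_ * _), hlift, inv_one, mul_one,
      map_mul _ (_ * _) (_ * _)⁻¹, map_inv _ (_ * _), hlift, inv_one, mul_one] at h)
  have := K.mul_mem (K.mul_mem h3 (K.inv_mem h1)) (K.inv_mem h2)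
  rw [e1, e2]
  simpa [Prod.mk_mul_mk] using this

/-- If `g` extends a good presentation, the fibre product `{(w₁, w₂) ∣ φ w₁ = φ w₂}` of two free
groups over `G` is generated, as a normal subgroup of itself, by `(1, x₁ ⋯ x_r)` and by the pairs
of conjugates of powers of generators that it contains. Every generator `x i` is equivalent to a
word in the generators of the presentation, which reduces the claim to pairs `(w, 1)` with `w` a
relator; for the two admissible shapes of relators these are products of the given elements. -/
theorem mem_of_lift_eq_lift [Finite G] (g : Fin r → G) (hgood : ExtendsGoodPresentation g)
    (K : Subgroup (FreeGroup (Fin r) × FreeGroup (Fin r)))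
    (hconj : ∀ v : FreeGroup (Fin r) × FreeGroup (Fin r),
      FreeGroup.lift g v.1 = FreeGroup.lift g v.2 → ∀ k ∈ K, v * k * v⁻¹ ∈ K)
    (hprod : (1, (List.ofFn fun i => FreeGroup.of i).prod) ∈ K)
    (htors : ∀ (u v : FreeGroup (Fin r)) (i j : Fin r) (e f : ℕ),
      FreeGroup.lift g (u * FreeGroup.of i ^ e * u⁻¹) =
        FreeGroup.lift g (v * FreeGroup.of j ^ f * v⁻¹) →
      (u * FreeGroup.of i ^ e * u⁻¹, v * FreeGroup.of j ^ f * v⁻¹) ∈ K)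
    (v : FreeGroup (Fin r) × FreeGroup (Fin r))
    (hv : FreeGroup.lift g v.1 = FreeGroup.lift g v.2) : v ∈ K := by
  have htorsZ := conj_zpow_pair_mem g K htors
  obtain ⟨s, R, e, a, ha, har, hgi, hR⟩ := hgood
  choose ι hι using har
  have hlift_a : ∀ w, FreeGroup.lift a w = e (PresentedGroup.mk _ w) := by
    intro w
    have : FreeGroup.lift a = e.toMonoidHom.comp (PresentedGroup.mk _) := by
      ext k
      simp [ha, PresentedGroup.of]
    rw [this]; rfl
  have hker : ∀ w, FreeGroup.lift a w = 1 ↔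
      w ∈ Subgroup.normalClosure (R : Set (FreeGroup (Fin s))) := by
    intro w
    rw [hlift_a, EmbeddingLike.map_eq_one_iff]
    exact QuotientGroup.eq_one_iff w
  have hsurj : Function.Surjective (FreeGroup.lift a) := by
    intro x
    obtain ⟨w, hw⟩ := QuotientGroup.mk_surjective (e.symm x)
    refine ⟨w, ?_⟩
    rw [hlift_a]
    have : PresentedGroup.mk (R : Set (FreeGroup (Fin s))) w = e.symm x := hw
    rw [this, MulEquiv.apply_symm_apply]
  let τ : FreeGroup (Fin s) →* FreeGroup (Fin r) := FreeGroup.lift fun k => FreeGroup.of (ι k)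
  have hτof : ∀ k, τ (FreeGroup.of k) = FreeGroup.of (ι k) := fun k => by simp [τ]
  have hτ : ∀ w, FreeGroup.lift g (τ w) = FreeGroup.lift a w := by
    intro w
    have : (FreeGroup.lift g).comp τ = FreeGroup.lift a := by
      ext k
      simp [hτof, hι]
    rw [← this]; rfl
  -- the words of the presentation that become trivial in `G`
  have hA : ∀ w, FreeGroup.lift a w = 1 → (τ w, 1) ∈ K := by
    let K' : Subgroup (FreeGroup (Fin s)) := K.comap (τ.prod 1)
    have hK' : K'.Normal := by
      refine ⟨fun w hw y => ?_⟩
      have := hconj (τ y, τ y) rfl _ (show (τ w, 1) ∈ K from hw)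
      change (τ (y * w * y⁻¹), 1) ∈ K
      simpa using this
    suffices h : Subgroup.normalClosure (R : Set (FreeGroup (Fin s))) ≤ K' from
      fun w hw => h ((hker w).1 hw)
    refine Subgroup.normalClosure_le_normal fun w hw => ?_
    obtain ⟨v, hvw, hv⟩ := hR w hw
    suffices hvK : v ∈ K' by
      obtain ⟨c, rfl⟩ := isConj_iff.1 hvw
      exact hK'.conj_mem _ hvK c
    have hv1 : FreeGroup.lift a v = 1 := by
      rw [hker]
      obtain ⟨c, rfl⟩ := isConj_iff.1 hvw.symm
      exact Subgroup.normalClosure_normal.conj_mem _ (Subgroup.subset_normalClosure hw) c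
    change (τ v, 1) ∈ K
    rcases hv with ⟨i, j, e₁, e₂, h, rfl⟩ | ⟨j, l, h, hgl, rfl⟩
    · rw [← hτ] at hv1
      have h1 := htorsZ 1 1 (ι i) (ι i) e₁ e₁ rfl
      have h2 := htorsZ (τ h) 1 (ι j) (ι i) e₂ (-e₁) (by
        simp only [map_mul, map_zpow, hτof, map_inv] at hv1
        have h5 := (mul_eq_one_iff_inv_eq.1 (by simpa only [mul_assoc] using hv1)).symm
        simp only [map_mul, map_zpow, map_inv, one_mul, inv_one, mul_one, zpow_neg]
        rw [mul_assoc]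
        exact h5)
      have := K.mul_mem h1 h2
      simpa [hτof, mul_assoc] using this
    · have h1 : ∀ i,
          (τ (h i) * FreeGroup.of (ι (j i)) ^ l i * (τ (h i))⁻¹, FreeGroup.of i) ∈ K := by
        intro i
        have := htorsZ (τ (h i)) 1 (ι (j i)) i (l i) 1 (by
          simp only [map_mul, map_zpow, map_inv, one_mul, inv_one, mul_one, zpow_one,
            hτ, FreeGroup.lift_apply_of, hι]
          exact (hgl i).symm)
        simpa using this
      have h2 : (List.ofFn fun i => (τ (h i) * FreeGroup.of (ι (j i)) ^ l i * (τ (h i))⁻¹,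
          FreeGroup.of i)).prod ∈ K := K.list_prod_mem fun x hx => by
        obtain ⟨i, rfl⟩ := (List.mem_ofFn' _ _).1 hx
        exact h1 i
      have h3 := K.mul_mem h2 (K.inv_mem hprod)
      convert h3 using 1
      refine Prod.ext ?_ ?_
      · simp only [Prod.fst_mul, Prod.fst_inv, inv_one, mul_one]
        rw [← MonoidHom.coe_fst, map_list_prod, map_list_prod, List.map_ofFn, List.map_ofFn]
        congr 2
        funext i
        simp [hτof]
      · simp only [Prod.snd_mul, Prod.snd_inv]
        rw [← MonoidHom.coe_snd, map_list_prod, List.map_ofFn]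
        exact (mul_inv_cancel _).symm
  choose j l h hgi using hgi
  choose h' hh' using fun i => hsurj (h i)
  -- `μ` rewrites the generators `x i` as words in the generators of the presentation
  let μ₀ : FreeGroup (Fin r) →* FreeGroup (Fin s) :=
    FreeGroup.lift fun i => h' i * FreeGroup.of (j i) ^ l i * (h' i)⁻¹
  have hμ₀ : ∀ w, FreeGroup.lift a (μ₀ w) = FreeGroup.lift g w := by
    intro w
    have : (FreeGroup.lift a).comp μ₀ = FreeGroup.lift g := by
      ext i
      simp [μ₀, hh', ← hgi]
    rw [← this]; rfl
  have hμi : ∀ i, τ (μ₀ (FreeGroup.of i)) =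
      τ (h' i) * FreeGroup.of (ι (j i)) ^ l i * (τ (h' i))⁻¹ := by
    intro i
    simp [μ₀, hτof]
  have hgi' : ∀ i, FreeGroup.lift g (τ (h' i) * FreeGroup.of (ι (j i)) ^ l i * (τ (h' i))⁻¹) =
      FreeGroup.lift g (1 * FreeGroup.of i ^ (1 : ℤ) * 1⁻¹) := by
    intro i
    rw [← hμi, hτ, hμ₀]
    simp
  have hμ : ∀ w, (w, τ (μ₀ w)) ∈ K := by
    intro w
    have : (MonoidHom.prod (MonoidHom.id _) (τ.comp μ₀)).range ≤ K := by
      rw [MonoidHom.range_eq_map, ← FreeGroup.closure_range_of, MonoidHom.map_closure,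
        Subgroup.closure_le]
      rintro _ ⟨_, ⟨i, rfl⟩, rfl⟩
      have := htorsZ 1 (τ (h' i)) i (ι (j i)) 1 (l i) (hgi' i).symm
      simpa [hμi] using this
    exact this ⟨w, rfl⟩
  have hμ' : ∀ w, (τ (μ₀ w), w) ∈ K := by
    intro w
    have : (MonoidHom.prod (τ.comp μ₀) (MonoidHom.id _)).range ≤ K := by
      rw [MonoidHom.range_eq_map, ← FreeGroup.closure_range_of, MonoidHom.map_closure,
        Subgroup.closure_le]
      rintro _ ⟨_, ⟨i, rfl⟩, rfl⟩
      have := htorsZ (τ (h' i)) 1 (ι (j i)) i (l i) 1 (hgi' i)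
      simpa [hμi] using this
    exact this ⟨w, rfl⟩
  have hone : ∀ k, FreeGroup.lift g k = 1 → (1, k) ∈ K := by
    intro k hk
    have := K.mul_mem (K.inv_mem (hA (μ₀ k) (by rw [hμ₀, hk]))) (hμ' k)
    simpa using this
  have := K.mul_mem (hμ v.1) (hone ((τ (μ₀ v.1))⁻¹ * v.2) (by
    rw [map_mul, map_inv, hτ, hμ₀, hv, inv_mul_cancel]))
  simpa using this

/-- The orbifold group is generated by torsion: the pairs of conjugates of powers of the
generators `c i` that it contains have finite order. -/
theorem normallyGeneratedByTorsion_orbifoldGroup [Finite G] (g : Fin r → G)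
    (hg : IsSphericalGenerators g) (hgood : ExtendsGoodPresentation g) :
    NormallyGeneratedByTorsion (orbifoldGroup g hg) := by
  let p := PresentedGroup.mk (orbifoldRelators fun i => orderOf (g i))
  have hp : ∀ w, classifyingMap g hg (p w) = FreeGroup.lift g w := fun w => rfl
  have hmem : ∀ v : FreeGroup (Fin r) × FreeGroup (Fin r),
      FreeGroup.lift g v.1 = FreeGroup.lift g v.2 → (p v.1, p v.2) ∈ orbifoldGroup g hg := by
    intro v hv
    change classifyingMap g hg (p v.1) = classifyingMap g hg (p v.2)
    rw [hp, hp, hv]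
  set N := Subgroup.normalClosure {x : orbifoldGroup g hg | IsOfFinOrder x} with hN
  have hpow : ∀ i, p (FreeGroup.of i ^ orderOf (g i)) = 1 := fun i =>
    PresentedGroup.one_of_mem (Or.inl ⟨i, rfl⟩)
  have hfin : ∀ (u : FreeGroup (Fin r)) (i : Fin r) (e : ℕ),
      p (u * FreeGroup.of i ^ e * u⁻¹) ^ orderOf (g i) = 1 := by
    intro u i e
    rw [← map_pow, conj_pow, ← pow_mul, mul_comm e, pow_mul, map_mul, map_mul, map_pow, hpow]
    simp
  have hK := mem_of_lift_eq_lift g hgood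
    ((N.map (orbifoldGroup g hg).subtype).comap (p.prodMap p)) ?_ ?_ ?_
  · refine Subgroup.eq_top_iff' _ |>.2 ?_
    rintro ⟨⟨x, y⟩, hxy⟩
    obtain ⟨w₁, rfl⟩ := QuotientGroup.mk_surjective x
    obtain ⟨w₂, rfl⟩ := QuotientGroup.mk_surjective y
    obtain ⟨z, hz, hz'⟩ := hK (w₁, w₂) hxy
    have : z = ⟨_, hxy⟩ := Subtype.ext hz'
    rw [← this]
    exact hz
  · rintro v hv k ⟨z, hz, hz'⟩
    refine ⟨⟨_, hmem v hv⟩ * z * ⟨_, hmem v hv⟩⁻¹,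
      Subgroup.normalClosure_normal.conj_mem _ hz _, ?_⟩
    rw [map_mul, map_mul, map_inv, map_mul, map_mul, map_inv, hz']
    rfl
  · have h1 : p (List.ofFn fun i => FreeGroup.of i).prod = 1 :=
      PresentedGroup.one_of_mem (Or.inr rfl)
    change (p 1, p (List.ofFn fun i => FreeGroup.of i).prod) ∈ N.map (orbifoldGroup g hg).subtype
    rw [h1, map_one]
    exact one_mem _
  · intro u v i j e f h
    refine ⟨⟨_, hmem (_, _) h⟩, Subgroup.subset_normalClosure ?_, rfl⟩
    refine isOfFinOrder_iff_pow_eq_one.2 ⟨orderOf (g i) * orderOf (g j),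
      Nat.mul_pos (orderOf_pos _) (orderOf_pos _), ?_⟩
    refine Subtype.ext (Prod.ext ?_ ?_)
    · change p (u * FreeGroup.of i ^ e * u⁻¹) ^ (orderOf (g i) * orderOf (g j)) = 1
      rw [pow_mul, hfin, one_pow]
    · change p (v * FreeGroup.of j ^ f * v⁻¹) ^ (orderOf (g i) * orderOf (g j)) = 1
      rw [mul_comm, pow_mul, hfin, one_pow]

end GroupTheory

/-! ### Injective holomorphic functions and zeros of holomorphic functions -/

section ComplexAnalysis

open Filter Set Metric

/-- An injective holomorphic function is open and has a holomorphic inverse. -/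
theorem exists_holomorphic_inverse {h : ℂ → ℂ} {U : Set ℂ} (hU : IsOpen U)
    (hd : DifferentiableOn ℂ h U) (hi : InjOn h U) :
    IsOpen (h '' U) ∧ ∃ k : ℂ → ℂ, DifferentiableOn ℂ k (h '' U) ∧ ∀ z ∈ U, k (h z) = z := by
  have hnc : ∀ z ∈ U, ¬ ∀ᶠ w in 𝓝 z, h w = h z := by
    intro z hz hc
    have h1 : ∀ᶠ w in 𝓝[≠] z, h w = h z := hc.filter_mono nhdsWithin_le_nhds
    have h2 : ∀ᶠ w in 𝓝[≠] z, w ∈ U := nhdsWithin_le_nhds (hU.mem_nhds hz)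
    obtain ⟨w, ⟨hw1, hw2⟩, hw3⟩ := ((h1.and h2).and self_mem_nhdsWithin).exists
    exact hw3 (hi hw2 hz hw1)
  have han : ∀ z ∈ U, AnalyticAt ℂ h z := fun z hz => hd.analyticAt (hU.mem_nhds hz)
  have hmap : ∀ z ∈ U, 𝓝 (h z) ≤ map h (𝓝 z) := fun z hz =>
    ((han z hz).eventually_constant_or_nhds_le_map_nhds).resolve_left (hnc z hz)
  have hopen : IsOpen (h '' U) := by
    rw [isOpen_iff_mem_nhds]
    rintro _ ⟨z, hz, rfl⟩
    exact hmap z hz (image_mem_map (hU.mem_nhds hz))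
  let k := Function.invFunOn h U
  have hk : ∀ z ∈ U, k (h z) = z := fun z hz => hi.leftInvOn_invFunOn hz
  have hcont : ∀ z ∈ U, ContinuousAt k (h z) := by
    intro z hz V hV
    rw [hk z hz] at hV
    have h1 : h '' (V ∩ U) ∈ 𝓝 (h z) :=
      hmap z hz (image_mem_map (inter_mem hV (hU.mem_nhds hz)))
    refine Filter.mem_map.2 (mem_of_superset h1 ?_)
    rintro _ ⟨w, ⟨hwV, hwU⟩, rfl⟩
    change k (h w) ∈ V
    rwa [hk w hwU]
  have hdiff : ∀ z ∈ U, deriv h z ≠ 0 → DifferentiableAt ℂ k (h z) := by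
    intro z hz hne
    refine (HasDerivAt.of_local_left_inverse (f := h) (hcont z hz) ?_ hne ?_).differentiableAt
    · rw [hk z hz]
      exact (hd.differentiableAt (hU.mem_nhds hz)).hasDerivAt
    · filter_upwards [hopen.mem_nhds (mem_image_of_mem h hz)]
      rintro _ ⟨w, hw, rfl⟩
      rw [hk w hw]
  refine ⟨hopen, k, ?_, hk⟩
  rintro _ ⟨z, hz, rfl⟩
  refine DifferentiableAt.differentiableWithinAt ?_
  rcases (han z hz).deriv.eventually_eq_zero_or_eventually_ne_zero with h0 | h0
  · exfalso
    obtain ⟨ε, hε, hball⟩ := Metric.eventually_nhds_iff_ball.1 (h0.and (hU.mem_nhds hz))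
    refine hnc z hz ?_
    filter_upwards [ball_mem_nhds z hε] with w hw
    exact isOpen_ball.is_const_of_deriv_eq_zero (convex_ball z ε).isPreconnected
      (hd.mono fun y hy => (hball y hy).2) (fun y hy => (hball y hy).1) hw (mem_ball_self hε)
  · refine Complex.analyticAt_of_differentiable_on_punctured_nhds_of_continuousAt ?_ (hcont z hz)
      |>.differentiableAt
    obtain ⟨ε, hε, hball⟩ := Metric.eventually_nhds_iff_ball.1
      ((eventually_nhdsWithin_iff.1 h0).and (hU.mem_nhds hz))
    have h1 : h '' (ball z ε) ∈ 𝓝 (h z) := hmap z hz (image_mem_map (ball_mem_nhds z hε))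
    filter_upwards [nhdsWithin_le_nhds h1, self_mem_nhdsWithin]
    rintro _ ⟨w, hw, rfl⟩ hne
    exact hdiff w (hball w hw).2 ((hball w hw).1 fun hwz => hne (congrArg h hwz))

/-- Dividing out a zero of `h` in the disc of radius `ρ` costs a factor `1 / 2` in the maximum
principle on the disc of radius `5 ρ`. -/
theorem norm_le_of_zeros {ρ : ℝ} (hρ : 0 < ρ) (s : Finset ℂ) :
    ∀ (h : ℂ → ℂ) (M : ℝ), DiffContOnCl ℂ h (ball 0 (5 * ρ)) →
      (∀ w, ‖w‖ = 5 * ρ → ‖h w‖ ≤ M) → (∀ w ∈ s, ‖w‖ < ρ ∧ h w = 0) →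
      ∀ w, ‖w‖ < ρ → ‖h w‖ ≤ M * (1 / 2) ^ s.card := by
  classical
  induction s using Finset.induction_on with
  | empty =>
    intro h M hd hM _ w hw
    have h5 : (5 * ρ) ≠ 0 := by positivity
    have := Complex.norm_le_of_forall_mem_frontier_norm_le isBounded_ball hd (C := M)
      (fun z hz => hM z (by rw [frontier_ball _ h5] at hz; simpa using hz))
      (subset_closure (show w ∈ ball (0 : ℂ) (5 * ρ) by rw [mem_ball_zero_iff]; linarith))
    simpa using this
  | insert a s ha ih =>
    intro h M hd hM hz w hw
    obtain ⟨haρ, ha0⟩ := hz a (Finset.mem_insert_self a s)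
    have haB : a ∈ ball (0 : ℂ) (5 * ρ) := by rw [mem_ball_zero_iff]; linarith
    have h5 : (5 * ρ) ≠ 0 := by positivity
    have hB : ball (0 : ℂ) (5 * ρ) ∈ 𝓝 a := isOpen_ball.mem_nhds haB
    have hd1 : DiffContOnCl ℂ (dslope h a) (ball 0 (5 * ρ)) := by
      refine ⟨(Complex.differentiableOn_dslope hB).2 hd.differentiableOn, ?_⟩
      exact (continuousOn_dslope (mem_of_superset hB subset_closure)).2
        ⟨hd.continuousOn, hd.differentiableOn.differentiableAt hB⟩
    have hsl : ∀ z, h z = (z - a) * dslope h a z := by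
      intro z
      have := sub_smul_dslope h a z
      rw [ha0, sub_zero, smul_eq_mul] at this
      exact this.symm
    have hM1 : ∀ z, ‖z‖ = 5 * ρ → ‖dslope h a z‖ ≤ M / (4 * ρ) := by
      intro z hz
      have h1 : 4 * ρ ≤ ‖z - a‖ := by
        have := norm_sub_norm_le z a
        linarith
      have h2 := hM z hz
      rw [hsl z, norm_mul] at h2
      rw [le_div_iff₀ (by positivity)]
      nlinarith [norm_nonneg (dslope h a z)]
    have := ih (dslope h a) (M / (4 * ρ)) hd1 hM1 (fun z hzs => by
      obtain ⟨h1, h2⟩ := hz z (Finset.mem_insert_of_mem hzs)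
      refine ⟨h1, ?_⟩
      rw [hsl z] at h2
      refine (mul_eq_zero.1 h2).resolve_left fun h3 => ha ?_
      rwa [← sub_eq_zero.1 h3]) w hw
    have h1 : ‖w - a‖ ≤ 2 * ρ := by
      have := norm_sub_le w a
      linarith
    have hM0 : 0 ≤ M / (4 * ρ) * (1 / 2) ^ s.card := (norm_nonneg _).trans this
    rw [Finset.card_insert_of_notMem ha, hsl w, norm_mul]
    calc ‖w - a‖ * ‖dslope h a w‖ ≤ (2 * ρ) * (M / (4 * ρ) * (1 / 2) ^ s.card) := by gcongr
      _ = M * (1 / 2) ^ (s.card + 1) := by field_simp; ring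

/-- A bound for the number of zeros in a disc that is uniform over all holomorphic functions with a
given upper bound and a given lower bound at some point. -/
theorem exists_card_zeros_le {ρ m : ℝ} (hρ : 0 < ρ) (hm : 0 < m) (M : ℝ) :
    ∃ N : ℕ, ∀ h : ℂ → ℂ, DiffContOnCl ℂ h (ball 0 (5 * ρ)) →
      (∀ w, ‖w‖ = 5 * ρ → ‖h w‖ ≤ M) → (∃ w, ‖w‖ < ρ ∧ m ≤ ‖h w‖) →
      ∀ s : Finset ℂ, (∀ w ∈ s, ‖w‖ < ρ ∧ h w = 0) → s.card ≤ N := by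
  have hlim : Tendsto (fun n : ℕ => M * (1 / 2 : ℝ) ^ n) atTop (𝓝 (M * 0)) :=
    (tendsto_pow_atTop_nhds_zero_of_lt_one (by norm_num) (by norm_num)).const_mul M
  rw [mul_zero] at hlim
  obtain ⟨N, hN⟩ := eventually_atTop.1 (hlim.eventually_lt_const hm)
  refine ⟨N, fun h hd hM hw s hs => ?_⟩
  obtain ⟨w, hw, hmw⟩ := hw
  by_contra hcon
  have := norm_le_of_zeros hρ s h M hd hM hs w hw
  linarith [hN s.card (by omega)]

/-! ### Area and energy of holomorphic curves -/

open MeasureTheory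

/-- The derivative of a holomorphic function, as a real linear map, has determinant `|h'|²`. -/
theorem det_smul_one (c : ℂ) : (c • (1 : ℂ →L[ℝ] ℂ)).det = ‖c‖ ^ 2 := by
  have h1 : ((c • (1 : ℂ →L[ℝ] ℂ) : ℂ →L[ℝ] ℂ) : ℂ →ₗ[ℝ] ℂ) = Algebra.lmul ℝ ℂ c := by
    ext; simp
  rw [ContinuousLinearMap.det, h1, ← Algebra.norm_apply, Algebra.norm_complex_apply,
    Complex.normSq_eq_norm_sq]

/-- The area formula for a holomorphic function that takes no value more than `K` times. -/
theorem lintegral_enorm_deriv_sq_le {h : ℂ → ℂ} {Ω A D : Set ℂ} (hΩ : IsOpen Ω)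
    (hd : DifferentiableOn ℂ h Ω) (hA : MeasurableSet A) (hAΩ : A ⊆ Ω) (hD : MapsTo h A D)
    (K : ℕ) (hK : ∀ z, ∀ s : Finset ℂ, (∀ w ∈ s, w ∈ A ∧ h w = z) → s.card ≤ K) :
    ∫⁻ z in A, ‖deriv h z‖ₑ ^ 2 ≤ K * volume D := by
  classical
  set A₀ := A ∩ {z | deriv h z ≠ 0} with hA₀
  have hmeas0 : MeasurableSet {z | deriv h z ≠ 0} :=
    (measurable_deriv h) (measurableSet_singleton 0).compl
  have hA₀m : MeasurableSet A₀ := hA.inter hmeas0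
  -- a countable open cover by sets on which `h` is injective
  have hloc : ∀ x ∈ A₀, ∃ O : Set ℂ, IsOpen O ∧ x ∈ O ∧ InjOn h O := by
    intro x hx
    have hs : HasStrictDerivAt h (deriv h x) x :=
      (hd.analyticAt (hΩ.mem_nhds (hAΩ hx.1))).hasStrictDerivAt
    have hs' := hs.hasStrictFDerivAt_equiv hx.2
    exact ⟨_, (hs'.toOpenPartialHomeomorph h).open_source,
      hs'.mem_toOpenPartialHomeomorph_source, (hs'.toOpenPartialHomeomorph h).injOn⟩
  choose! O hOo hxO hOi using hloc
  obtain ⟨t, htA, htc, hcov⟩ := TopologicalSpace.countable_cover_nhdsWithin (f := O) (s := A₀)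
    fun x hx => nhdsWithin_le_nhds ((hOo x hx).mem_nhds (hxO x hx))
  rcases t.eq_empty_or_nonempty with rfl | htne
  · have hemp : A₀ = ∅ := by simpa using hcov
    have : ∀ z ∈ A, ‖deriv h z‖ₑ ^ 2 = 0 := by
      intro z hz
      have : z ∉ A₀ := by simp [hemp]
      have h0 : deriv h z = 0 := by
        by_contra hne
        exact this ⟨hz, hne⟩
      simp [h0]
    rw [setLIntegral_congr_fun hA this]
    simp
  obtain ⟨e, he⟩ := htc.exists_eq_range htne
  have heA : ∀ n, e n ∈ A₀ := fun n => htA (he ▸ mem_range_self n)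
  let B : ℕ → Set ℂ := fun n => A₀ ∩ disjointed (fun n => O (e n)) n
  have hBm : ∀ n, MeasurableSet (B n) := fun n =>
    hA₀m.inter (MeasurableSet.disjointed (fun n => (hOo _ (heA n)).measurableSet) n)
  have hBd : Pairwise (Function.onFun Disjoint B) := fun m n hmn =>
    (disjoint_disjointed (fun n => O (e n)) hmn).mono inter_subset_right inter_subset_right
  have hBU : ⋃ n, B n = A₀ := by
    rw [← inter_iUnion, iUnion_disjointed]
    refine inter_eq_left.2 (hcov.trans ?_)
    rw [he]
    simp
  have hBi : ∀ n, InjOn h (B n) := fun n =>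
    (hOi _ (heA n)).mono (inter_subset_right.trans (disjointed_subset _ n))
  have hBΩ : ∀ n, B n ⊆ Ω := fun n x hx => hAΩ hx.1.1
  have hBint : ∀ n, ∫⁻ z in B n, ‖deriv h z‖ₑ ^ 2 = volume (h '' B n) := by
    intro n
    rw [← lintegral_abs_det_fderiv_eq_addHaar_image volume (hBm n)
      (f' := fun z => deriv h z • (1 : ℂ →L[ℝ] ℂ)) (fun x hx =>
        ((hd.differentiableAt
          (hΩ.mem_nhds (hBΩ n hx))).hasDerivAt.complexToReal_fderiv).hasFDerivWithinAt)
      (hBi n)]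
    refine lintegral_congr fun z => ?_
    rw [det_smul_one, abs_of_nonneg (by positivity), ENNReal.ofReal_pow (norm_nonneg _),
      ofReal_norm]
  have hBim : ∀ n, MeasurableSet (h '' B n) := fun n =>
    (hBm n).image_of_continuousOn_injOn (hd.continuousOn.mono (hBΩ n)) (hBi n)
  have hsplit : ∫⁻ z in A, ‖deriv h z‖ₑ ^ 2 = ∫⁻ z in A₀, ‖deriv h z‖ₑ ^ 2 := by
    rw [← lintegral_inter_add_sdiff (μ := volume) _ A hmeas0, ← hA₀]
    have : ∀ z ∈ A \ {z | deriv h z ≠ 0}, ‖deriv h z‖ₑ ^ 2 = 0 := by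
      intro z hz
      have h0 : deriv h z = 0 := not_not.1 hz.2
      simp [h0]
    rw [setLIntegral_congr_fun (hA.diff hmeas0) this]
    simp
  rw [hsplit, ← hBU, lintegral_iUnion hBm hBd]
  simp_rw [hBint]
  have hcount : ∀ z, ∑' n, (h '' B n).indicator (1 : ℂ → ENNReal) z ≤
      D.indicator (fun _ => (K : ENNReal)) z := by
    intro z
    by_cases hz : z ∈ D
    · rw [indicator_of_mem hz]
      refine ENNReal.tsum_le_of_sum_range_le fun N => ?_
      set T := (Finset.range N).filter fun n => z ∈ h '' B n with hT
      have h1 : ∑ n ∈ Finset.range N, (h '' B n).indicator (1 : ℂ → ENNReal) z = T.card := by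
        simp only [indicator_apply, Pi.one_apply]
        rw [← Finset.sum_filter, Finset.sum_const, nsmul_eq_mul, mul_one]
      rw [h1]
      have h2 : ∀ n ∈ T, ∃ w ∈ B n, h w = z := fun n hn => (Finset.mem_filter.1 hn).2
      choose! w hwB hwz using h2
      have hinj : InjOn w T := by
        intro m hm n hn hmn
        by_contra hne
        exact Set.disjoint_left.1 (hBd hne) (hwB m hm) (hmn ▸ hwB n hn)
      have := hK z (T.image w) fun x hx => by
        obtain ⟨n, hn, rfl⟩ := Finset.mem_image.1 hx
        exact ⟨(hwB n hn).1.1, hwz n hn⟩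
      rw [Finset.card_image_of_injOn hinj] at this
      exact_mod_cast this
    · rw [indicator_of_notMem hz]
      refine le_of_eq (ENNReal.tsum_eq_zero.2 fun n => indicator_of_notMem ?_ _)
      rintro ⟨w, hw, rfl⟩
      exact hz (hD hw.1.1)
  calc ∑' n, volume (h '' B n)
      = ∑' n, ∫⁻ z, (h '' B n).indicator (1 : ℂ → ENNReal) z := by
        congr 1
        funext n
        rw [lintegral_indicator_one (hBim n)]
    _ = ∫⁻ z, ∑' n, (h '' B n).indicator (1 : ℂ → ENNReal) z :=
        (lintegral_tsum fun n => (measurable_one.indicator (hBim n)).aemeasurable).symm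
    _ ≤ ∫⁻ z, D.indicator (fun _ => (K : ENNReal)) z := lintegral_mono hcount
    _ ≤ K * volume D := lintegral_indicator_const_le _ _

/-- A function of finite integral over a half-infinite horizontal strip has arbitrarily small
integral over some vertical segment. -/
theorem exists_vertical_lintegral_lt {E : ℂ → ENNReal} (hE : Measurable E) (b : ℝ) {T : Set ℝ}
    (hfin : ∫⁻ z in (Iio b ×ℂ T), E z ≠ ⊤) {ε : ENNReal} (hε : ε ≠ 0) :
    ∃ a < b, ∫⁻ θ in T, E (a + θ * Complex.I) < ε := by
  by_contra! hcon
  refine hfin (top_le_iff.1 ?_)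
  have hmp := Complex.volume_preserving_equiv_real_prod.symm
  have h1 : ∫⁻ z in (Iio b ×ℂ T), E z =
      ∫⁻ p in (Iio b ×ˢ T), E (Complex.measurableEquivRealProd.symm p) := by
    rw [← hmp.setLIntegral_comp_preimage_emb (MeasurableEquiv.measurableEmbedding _)]
    rfl
  have hE' : Measurable fun p : ℝ × ℝ => E (Complex.measurableEquivRealProd.symm p) :=
    hE.comp (MeasurableEquiv.measurable _)
  rw [h1, Measure.volume_eq_prod, ← Measure.prod_restrict, lintegral_prod _ hE'.aemeasurable]
  calc (⊤ : ENNReal) = ∫⁻ _ in Iio b, ε := by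
        rw [setLIntegral_const, Real.volume_Iio, ENNReal.mul_top hε]
    _ ≤ _ := by
        refine setLIntegral_mono' measurableSet_Iio fun a ha => (hcon a ha).trans ?_
        refine le_of_eq (lintegral_congr fun θ => ?_)
        congr 1
        apply Complex.ext <;> simp

end ComplexAnalysis

/-! ### Short circles on a holomorphic punctured disc -/

section ShortCircles

open Filter Set Metric MeasureTheory

/-- The uniform count of zeros of a holomorphic function of two variables on the lines parallel to
the first axis. -/
theorem exists_card_zeros_fst_le {η : ℂ × ℂ → ℂ} (hη : DifferentiableOn ℂ η (ball 0 20))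
    (h1 : η (1, 0) ≠ 0) : ∃ κ > 0, κ < 1 ∧ ∃ N : ℕ, ∀ w : ℂ, ‖w‖ < κ → ∀ s : Finset ℂ,
      (∀ z ∈ s, ‖z‖ < κ ∧ η (z, w) = 0) → s.card ≤ N := by
  have hcomp : IsCompact (closedBall (0 : ℂ × ℂ) 10) := isCompact_closedBall _ _
  have hsub : closedBall (0 : ℂ × ℂ) 10 ⊆ ball 0 20 := closedBall_subset_ball (by norm_num)
  obtain ⟨M, hM⟩ := hcomp.exists_bound_of_continuousOn (hη.continuousOn.mono hsub)
  have hm : 0 < ‖η (1, 0)‖ / 2 := by positivity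
  have hmem : ((1 : ℂ), (0 : ℂ)) ∈ ball (0 : ℂ × ℂ) 20 := by
    rw [mem_ball_zero_iff, Prod.norm_mk]
    simp
  have hcont : ContinuousAt (fun w : ℂ => ‖η (1, w)‖) 0 :=
    (ContinuousAt.comp (f := fun w : ℂ => ((1 : ℂ), w)) (g := η) (x := (0 : ℂ))
      ((hη.continuousOn.continuousAt (isOpen_ball.mem_nhds hmem)))
      (by fun_prop)).norm
  have hev : ∀ᶠ w in 𝓝 (0 : ℂ), ‖η (1, 0)‖ / 2 < ‖η (1, w)‖ :=
    hcont.eventually_const_lt (by linarith)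
  obtain ⟨κ, hκ, hball⟩ := Metric.eventually_nhds_iff_ball.1 hev
  obtain ⟨N, hN⟩ := exists_card_zeros_le (ρ := 2) (by norm_num) hm M
  refine ⟨min κ (1 / 2), by positivity, lt_of_le_of_lt (min_le_right _ _) (by norm_num), N,
    fun w hw s hs => ?_⟩
  have hw1 : ‖w‖ < κ := hw.trans_le (min_le_left _ _)
  have hw2 : ‖w‖ < 1 / 2 := hw.trans_le (min_le_right _ _)
  have hmaps : ∀ z : ℂ, ‖z‖ ≤ 10 → (z, w) ∈ closedBall (0 : ℂ × ℂ) 10 := by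
    intro z hz
    rw [mem_closedBall_zero_iff, Prod.norm_mk]
    exact max_le hz (by linarith)
  refine hN (fun z => η (z, w)) ?_ ?_ ⟨1, by norm_num, ?_⟩ s fun z hz => ⟨?_, (hs z hz).2⟩
  · refine DifferentiableOn.diffContOnCl ?_
    rw [closure_ball _ (by norm_num)]
    refine hη.comp (by fun_prop) fun z hz => hsub (hmaps z ?_)
    rw [mem_closedBall_zero_iff] at hz
    linarith
  · intro z hz
    exact hM _ (hmaps z (by rw [hz]; norm_num))
  · exact (hball w (by simpa using hw1)).le
  · exact ((hs z hz).1.trans_le (min_le_right _ _)).trans (by norm_num)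

/-- In suitable linear coordinates around `p`, a holomorphic function that vanishes on no nonempty
open set has a bounded number of zeros on every coordinate line. -/
theorem exists_polydisc_coordinates {E : Type*} [NormedAddCommGroup E] [NormedSpace ℂ E]
    [FiniteDimensional ℂ E] (hE : Module.finrank ℂ E = 2) {φ : E → ℂ} {p : E} {R : ℝ} (hR : 0 < R)
    (hφ : DifferentiableOn ℂ φ (ball p R))
    (hne : ∀ O : Set E, IsOpen O → O.Nonempty → O ⊆ ball p R → ∃ q ∈ O, φ q ≠ 0) :
    ∃ (Λ : E ≃L[ℂ] ℂ × ℂ) (κ : ℝ) (N : ℕ), 0 < κ ∧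
      (∀ v : ℂ × ℂ, ‖v‖ < κ → p + Λ.symm v ∈ ball p R) ∧
      (∀ w : ℂ, ∀ s : Finset ℂ, (∀ z ∈ s, ‖((z, w) : ℂ × ℂ)‖ < κ ∧ φ (p + Λ.symm (z, w)) = 0) →
        s.card ≤ N) ∧
      (∀ z : ℂ, ∀ s : Finset ℂ, (∀ w ∈ s, ‖((z, w) : ℂ × ℂ)‖ < κ ∧ φ (p + Λ.symm (z, w)) = 0) →
        s.card ≤ N) := by
  set δ := R / 100 with hδ
  have hδ0 : 0 < δ := by positivity
  have hδR : δ ≤ R := by rw [hδ]; linarith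
  have hdir : ∀ S : Submodule ℂ E, S ≠ ⊤ → ∃ q ∈ ball p δ, φ q ≠ 0 ∧ q - p ∉ S := by
    intro S hS
    have hcl : IsClosed (S : Set E) := Submodule.closed_of_finiteDimensional _
    have hO : IsOpen (ball p δ ∩ (fun q => q - p) ⁻¹' (S : Set E)ᶜ) :=
      isOpen_ball.inter (hcl.isOpen_compl.preimage (by fun_prop))
    obtain ⟨v, hv⟩ : ∃ v : E, v ∉ S := by
      by_contra! hall
      exact hS (Submodule.eq_top_iff'.2 hall)
    obtain ⟨q, hq, hq'⟩ := hne _ hO (by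
      have hv0 : 0 < ‖v‖ := norm_pos_iff.2 fun h => hv (h ▸ zero_mem _)
      have hc : (((δ / (2 * ‖v‖) : ℝ) : ℂ)) ≠ 0 := by
        exact_mod_cast (by positivity : δ / (2 * ‖v‖) ≠ 0)
      refine ⟨p + ((δ / (2 * ‖v‖) : ℝ) : ℂ) • v, ?_, ?_⟩
      · rw [mem_ball_iff_norm, add_sub_cancel_left, norm_smul, Complex.norm_real, Real.norm_eq_abs,
          abs_of_pos (by positivity), div_mul_eq_mul_div, div_lt_iff₀ (by positivity)]
        nlinarith
      · intro hmem
        simp only [add_sub_cancel_left, SetLike.mem_coe] at hmem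
        exact hv ((Submodule.smul_mem_iff _ hc).1 hmem))
      (inter_subset_left.trans (ball_subset_ball hδR))
    exact ⟨q, hq.1, hq', hq.2⟩
  obtain ⟨q₁, hq₁, hφ₁, hq₁0⟩ := hdir ⊥ (by
    intro h
    have := finrank_bot ℂ E
    rw [h, finrank_top, hE] at this
    omega)
  obtain ⟨q₂, hq₂, hφ₂, hind⟩ := hdir (Submodule.span ℂ {q₁ - p}) (by
    intro h
    have := finrank_span_le_card (R := ℂ) ({q₁ - p} : Set E)
    rw [h, finrank_top, hE] at this
    simp at this)
  rw [Submodule.mem_bot] at hq₁0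
  let T : ℂ × ℂ →ₗ[ℂ] E :=
    (LinearMap.toSpanSingleton ℂ E (q₁ - p)).coprod (LinearMap.toSpanSingleton ℂ E (q₂ - p))
  have hT : ∀ z w : ℂ, T (z, w) = z • (q₁ - p) + w • (q₂ - p) := fun z w => by simp [T]
  have hTi : Function.Injective T := by
    rw [← LinearMap.ker_eq_bot, LinearMap.ker_eq_bot']
    rintro ⟨z, w⟩ h
    rw [hT] at h
    have hw : w = 0 := by
      by_contra hw
      refine hind ((Submodule.smul_mem_iff _ hw).1 ?_)
      rw [eq_neg_of_add_eq_zero_right h]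
      exact neg_mem (Submodule.smul_mem _ _ (Submodule.mem_span_singleton_self _))
    rw [hw, zero_smul, add_zero] at h
    rw [hw, (smul_eq_zero.1 h).resolve_right hq₁0]
    rfl
  let Λ : E ≃L[ℂ] ℂ × ℂ :=
    (LinearMap.linearEquivOfInjective T hTi (by rw [hE]; simp)).symm.toContinuousLinearEquiv
  have hΛ : ∀ z w : ℂ, Λ.symm (z, w) = z • (q₁ - p) + w • (q₂ - p) := fun z w => hT z w
  have hball : ∀ v : ℂ × ℂ, ‖v‖ < 20 → p + Λ.symm v ∈ ball p R := by
    rintro ⟨z, w⟩ hv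
    rw [Prod.norm_mk, max_lt_iff] at hv
    rw [mem_ball_iff_norm, add_sub_cancel_left, hΛ]
    rw [mem_ball_iff_norm] at hq₁ hq₂
    calc ‖z • (q₁ - p) + w • (q₂ - p)‖ ≤ ‖z‖ * ‖q₁ - p‖ + ‖w‖ * ‖q₂ - p‖ := by
          refine (norm_add_le _ _).trans ?_
          rw [norm_smul, norm_smul]
      _ ≤ 20 * δ + 20 * δ := by
          gcongr
          exacts [hv.1.le, hv.2.le]
      _ < R := by rw [hδ]; linarith
  have hη : DifferentiableOn ℂ (fun v : ℂ × ℂ => φ (p + Λ.symm v)) (ball 0 20) :=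
    hφ.comp (by fun_prop) fun v hv => hball v (by simpa using hv)
  obtain ⟨κ₁, hκ₁, hκ₁1, N₁, hN₁⟩ := exists_card_zeros_fst_le hη (by
    simp only [hΛ, one_smul, zero_smul, add_zero, add_sub_cancel]
    exact hφ₁)
  obtain ⟨κ₂, hκ₂, hκ₂1, N₂, hN₂⟩ := exists_card_zeros_fst_le
    (η := fun v : ℂ × ℂ => φ (p + Λ.symm v.swap)) (hη.comp (f := Prod.swap)
      (differentiable_snd.prodMk differentiable_fst).differentiableOn fun v hv => by
        rw [mem_ball_zero_iff, Prod.norm_def, max_lt_iff] at hv ⊢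
        exact hv.symm) (by
    simp only [Prod.swap_prod_mk, hΛ, one_smul, zero_smul, zero_add, add_sub_cancel]
    exact hφ₂)
  have hpair : ∀ z w : ℂ, ‖((z, w) : ℂ × ℂ)‖ < min κ₁ κ₂ →
      (‖z‖ < κ₁ ∧ ‖w‖ < κ₁) ∧ (‖z‖ < κ₂ ∧ ‖w‖ < κ₂) := by
    intro z w h
    rw [Prod.norm_mk, max_lt_iff, lt_min_iff, lt_min_iff] at h
    tauto
  refine ⟨Λ, min κ₁ κ₂, max N₁ N₂, lt_min hκ₁ hκ₂, fun v hv => hball v ?_,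
    fun w s hs => ?_, fun z s hs => ?_⟩
  · have := min_le_left κ₁ κ₂
    linarith
  · rcases s.eq_empty_or_nonempty with rfl | ⟨z₀, hz₀⟩
    · simp
    · exact (hN₁ w (hpair _ _ (hs z₀ hz₀).1).1.2 s fun z hz =>
        ⟨(hpair _ _ (hs z hz).1).1.1, (hs z hz).2⟩).trans (le_max_left _ _)
  · rcases s.eq_empty_or_nonempty with rfl | ⟨w₀, hw₀⟩
    · simp
    · exact (hN₂ z (hpair _ _ (hs w₀ hw₀).1).2.1 s fun w hw =>
        ⟨(hpair _ _ (hs w hw).1).2.2, (hs w hw).2⟩).trans (le_max_right _ _)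

/-- The distance between two points of a holomorphic curve on a vertical line is at most the
energy in between, up to an arbitrarily small multiple of the height. -/
theorem enorm_sub_le_energy {h : ℂ → ℂ} {A : Set ℂ} (hA : IsOpen A) (hd : DifferentiableOn ℂ h A)
    (a : ℝ) {t : ℝ} (ht : 0 ≤ t) (hseg : ∀ θ ∈ Icc 0 t, (a + θ * Complex.I : ℂ) ∈ A)
    {δ : ℝ} (hδ : 0 < δ) :
    ‖h (a + t * Complex.I) - h a‖ₑ ≤ ENNReal.ofReal δ * ENNReal.ofReal t +
      (ENNReal.ofReal δ)⁻¹ * ∫⁻ θ in Ico 0 t, ‖deriv h (a + θ * Complex.I)‖ₑ ^ 2 := by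
  set u : ℝ → ℂ := fun θ => h (a + θ * Complex.I) with hu
  have hline : ∀ θ : ℝ, HasDerivAt (fun θ : ℝ => (a + θ * Complex.I : ℂ)) Complex.I θ := by
    intro θ
    simpa using ((Complex.ofRealCLM.hasDerivAt (x := θ)).mul_const Complex.I).const_add (a : ℂ)
  have hderiv : ∀ θ ∈ Icc 0 t, HasDerivAt u (deriv h (a + θ * Complex.I) * Complex.I) θ := by
    intro θ hθ
    exact ((hd.differentiableAt (hA.mem_nhds (hseg θ hθ))).hasDerivAt).comp_of_eq θ (hline θ) rfl
  have hC : ContDiffOn ℝ 1 u (Icc 0 t) := by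
    have h1 : ContDiffOn ℝ 1 h A := ((hd.contDiffOn hA).restrict_scalars ℝ)
    have h2 : ContDiff ℝ 1 fun θ : ℝ => (a + θ * Complex.I : ℂ) :=
      contDiff_const.add (Complex.ofRealCLM.contDiff.mul contDiff_const)
    exact h1.comp h2.contDiffOn hseg
  have h1 := enorm_sub_le_lintegral_deriv_of_contDiffOn_Icc hC ht
  have h0 : u 0 = h a := by simp [hu]
  rw [h0] at h1
  refine h1.trans ?_
  have hδ0 : ENNReal.ofReal δ ≠ 0 := by simpa using hδ
  have hpt : ∀ x : ENNReal, x ≤ ENNReal.ofReal δ + (ENNReal.ofReal δ)⁻¹ * x ^ 2 := by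
    intro x
    rcases le_total x (ENNReal.ofReal δ) with hx | hx
    · exact hx.trans le_self_add
    · refine le_trans ?_ le_add_self
      calc x = (ENNReal.ofReal δ)⁻¹ * (ENNReal.ofReal δ * x) := by
            rw [← mul_assoc, ENNReal.inv_mul_cancel hδ0 ENNReal.ofReal_ne_top, one_mul]
        _ ≤ _ := by
            rw [sq]
            gcongr
  calc ∫⁻ θ in Icc 0 t, ‖deriv u θ‖ₑ
      = ∫⁻ θ in Ico 0 t, ‖deriv u θ‖ₑ := setLIntegral_congr Ico_ae_eq_Icc.symm
    _ ≤ ∫⁻ θ in Ico 0 t, (ENNReal.ofReal δ +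
          (ENNReal.ofReal δ)⁻¹ * ‖deriv h (a + θ * Complex.I)‖ₑ ^ 2) := by
        refine setLIntegral_mono' measurableSet_Ico fun θ hθ => ?_
        rw [(hderiv θ (Ico_subset_Icc_self hθ)).deriv, enorm_mul]
        have : ‖Complex.I‖ₑ = 1 := by simp [← ofReal_norm]
        rw [this, mul_one]
        exact hpt _
    _ = _ := by
        rw [lintegral_add_left measurable_const, lintegral_const_mul' _ _ (by simpa using hδ),
          setLIntegral_const, Real.volume_Ico, sub_zero]

/-- The preimage of a nonempty convex set under a chart is simply connected. -/
theorem isSimplyConnected_symm_image {X E : Type*} [TopologicalSpace X] [NormedAddCommGroup E]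
    [NormedSpace ℝ E] (Θ : OpenPartialHomeomorph X E) {B : Set E} (hB : Convex ℝ B)
    (hne : B.Nonempty) (hsub : B ⊆ Θ.target) : IsSimplyConnected (Θ.symm '' B) := by
  have := hB.contractibleSpace hne
  have e : B ≃ₜ (Θ.symm '' B) := Θ.symm.homeomorphOfImageSubsetSource hsub rfl
  exact e.symm.toHomotopyEquiv.simplyConnectedSpace

/-- A holomorphic curve `x` on a left half-plane that tends to a compact set `F`, and that takes
each value of each coordinate a bounded number of times in suitable charts around the points of
`F`, maps some vertical segment of length `2 π` into a single simply connected chart domain: the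
area of the curve is finite, so some segment has a short image. -/
theorem exists_vertical_segment_mem {X : Type*} [TopologicalSpace X] [T2Space X] {x : ℂ → X}
    (hx : Continuous x) {F : Set X} (hF : IsCompact F)
    (hlim : ∀ W : Set X, IsOpen W → F ⊆ W → ∃ b : ℝ, ∀ s : ℂ, s.re < b → x s ∈ W)
    (hloc : ∀ y ∈ F, ∃ (Θ : OpenPartialHomeomorph X (ℂ × ℂ)) (κ : ℝ) (K : ℕ) (b : ℝ), 0 < κ ∧
      y ∈ Θ.source ∧ Θ y = 0 ∧ ball 0 κ ⊆ Θ.target ∧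
      DifferentiableOn ℂ (fun s => Θ (x s)) {s | s.re < b ∧ x s ∈ Θ.source} ∧
      (∀ z, ∀ S : Finset ℂ, (∀ s ∈ S, s ∈ Iio b ×ℂ Ico 0 (2 * Real.pi) ∧ x s ∈ Θ.source ∧
        ‖Θ (x s)‖ < κ ∧ (Θ (x s)).1 = z) → S.card ≤ K) ∧
      (∀ z, ∀ S : Finset ℂ, (∀ s ∈ S, s ∈ Iio b ×ℂ Ico 0 (2 * Real.pi) ∧ x s ∈ Θ.source ∧
        ‖Θ (x s)‖ < κ ∧ (Θ (x s)).2 = z) → S.card ≤ K)) :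
    ∃ a < (0 : ℝ), ∃ P : Set X, IsSimplyConnected P ∧
      ∀ θ ∈ Icc 0 (2 * Real.pi), x (a + θ * Complex.I) ∈ P := by
  obtain ⟨y₀, hy₀⟩ : F.Nonempty := by
    rw [nonempty_iff_ne_empty]
    rintro rfl
    obtain ⟨b, hb⟩ := hlim ∅ isOpen_empty subset_rfl
    exact hb ((b - 1 : ℝ) : ℂ) (by simp)
  have : Nonempty (OpenPartialHomeomorph X (ℂ × ℂ)) := ⟨(hloc y₀ hy₀).choose⟩
  choose! Θ κ K b hκ hyΘ hΘ0 hκΘ hhol hc1 hc2 using hloc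
  let inner : X → Set X := fun y => (Θ y).source ∩ Θ y ⁻¹' ball 0 (κ y / 2)
  have hinner : ∀ y, IsOpen (inner y) := fun y => (Θ y).isOpen_inter_preimage isOpen_ball
  obtain ⟨t, htF, hcov⟩ := hF.elim_nhds_subcover inner fun y hy =>
    (hinner y).mem_nhds ⟨hyΘ y hy, by
      rw [mem_preimage, hΘ0 y hy]
      exact mem_ball_self (half_pos (hκ y hy))⟩
  obtain ⟨b₀, hb₀⟩ := hlim _ (isOpen_biUnion fun y _ => hinner y) hcov
  obtain ⟨b₁, hb₁⟩ : ∃ b₁ : ℝ, b₁ ≤ b₀ ∧ b₁ ≤ 0 ∧ ∀ y ∈ t, b₁ ≤ b y := by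
    obtain ⟨c, hc⟩ := (t.finite_toSet.image b).bddBelow
    refine ⟨min c (min b₀ 0), ?_, ?_, fun y hy => ?_⟩
    · exact (min_le_right _ _).trans (min_le_left _ _)
    · exact (min_le_right _ _).trans (min_le_right _ _)
    · exact (min_le_left _ _).trans (hc (mem_image_of_mem b hy))
  have htne : t.Nonempty := by
    have := hb₀ ((b₀ - 1 : ℝ) : ℂ) (by simp)
    simp only [mem_iUnion] at this
    obtain ⟨y, hy, -⟩ := this
    exact ⟨y, hy⟩
  obtain ⟨ym, hymt, hym⟩ := t.exists_min_image κ htne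
  set κm := κ ym with hκm
  have hκm0 : 0 < κm := hκ ym (htF ym hymt)
  let A : X → Set ℂ := fun y => {s | s.re < b₁ ∧ x s ∈ (Θ y).source ∧ ‖Θ y (x s)‖ < κ y}
  have hAo : ∀ y, IsOpen (A y) := by
    intro y
    have h1 : IsOpen ((Θ y).source ∩ Θ y ⁻¹' ball 0 (κ y)) :=
      (Θ y).isOpen_inter_preimage isOpen_ball
    have h2 : A y = {s | s.re < b₁} ∩ x ⁻¹' ((Θ y).source ∩ Θ y ⁻¹' ball 0 (κ y)) := by
      ext s
      simp [A]
    rw [h2]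
    exact (isOpen_lt Complex.continuous_re continuous_const).inter (h1.preimage hx)
  have hAd : ∀ y ∈ t, DifferentiableOn ℂ (fun s => Θ y (x s)) (A y) := fun y hy =>
    (hhol y (htF y hy)).mono fun s hs => ⟨hs.1.trans_le (hb₁.2.2 y hy), hs.2.1⟩
  let e : X → ℂ → ENNReal := fun y s =>
    (A y).indicator (fun s => ‖deriv (fun s => (Θ y (x s)).1) s‖ₑ ^ 2) s +
    (A y).indicator (fun s => ‖deriv (fun s => (Θ y (x s)).2) s‖ₑ ^ 2) s
  have hm1 : ∀ y, Measurable ((A y).indicator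
      (fun s => ‖deriv (fun s => (Θ y (x s)).1) s‖ₑ ^ 2)) := fun y =>
    ((measurable_deriv _).enorm.pow_const 2).indicator (hAo y).measurableSet
  have hm2 : ∀ y, Measurable ((A y).indicator
      (fun s => ‖deriv (fun s => (Θ y (x s)).2) s‖ₑ ^ 2)) := fun y =>
    ((measurable_deriv _).enorm.pow_const 2).indicator (hAo y).measurableSet
  have hem : ∀ y, Measurable (e y) := fun y => (hm1 y).add (hm2 y)
  set T : Set ℝ := Ico 0 (2 * Real.pi) with hT
  have hSm : MeasurableSet (Iio b₁ ×ℂ T) :=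
    (measurableSet_Iio.preimage Complex.measurable_re).inter
      (measurableSet_Ico.preimage Complex.measurable_im)
  have hefin : ∀ y ∈ t, ∫⁻ s in (Iio b₁ ×ℂ T), e y s ≠ ⊤ := by
    intro y hy
    have hsubS : Iio b₁ ×ℂ T ⊆ Iio (b y) ×ℂ T := fun s hs =>
      ⟨lt_of_lt_of_le hs.1 (hb₁.2.2 y hy), hs.2⟩
    have hfin : (K y : ENNReal) * volume (ball (0 : ℂ) (κ y)) ≠ ⊤ :=
      ENNReal.mul_ne_top (by simp) measure_ball_lt_top.ne
    rw [lintegral_add_left (hm1 y)]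
    refine ENNReal.add_ne_top.2 ⟨ne_top_of_le_ne_top hfin ?_, ne_top_of_le_ne_top hfin ?_⟩
    · rw [setLIntegral_indicator (hAo y).measurableSet]
      refine lintegral_enorm_deriv_sq_le (hAo y) (hAd y hy).fst
        ((hAo y).measurableSet.inter hSm) inter_subset_left (fun s hs => ?_) (K y)
        fun z S hS => hc1 y (htF y hy) z S fun s hs => ?_
      · rw [mem_ball_zero_iff]
        exact (norm_fst_le _).trans_lt hs.1.2.2
      · obtain ⟨⟨h1, h2⟩, h3⟩ := hS s hs
        exact ⟨hsubS h2, h1.2.1, h1.2.2, h3⟩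
    · rw [setLIntegral_indicator (hAo y).measurableSet]
      refine lintegral_enorm_deriv_sq_le (hAo y) (hAd y hy).snd
        ((hAo y).measurableSet.inter hSm) inter_subset_left (fun s hs => ?_) (K y)
        fun z S hS => hc2 y (htF y hy) z S fun s hs => ?_
      · rw [mem_ball_zero_iff]
        exact (norm_snd_le _).trans_lt hs.1.2.2
      · obtain ⟨⟨h1, h2⟩, h3⟩ := hS s hs
        exact ⟨hsubS h2, h1.2.1, h1.2.2, h3⟩
  have hEfin : ∫⁻ s in (Iio b₁ ×ℂ T), ∑ y ∈ t, e y s ≠ ⊤ := by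
    rw [lintegral_finsetSum _ fun y _ => hem y]
    exact ENNReal.sum_ne_top.2 hefin
  -- a vertical segment of energy so small that its image moves by less than `κm / 4`
  set δ := κm / 64 with hδ
  have hδ0 : 0 < δ := by positivity
  obtain ⟨a, hab, hae⟩ := exists_vertical_lintegral_lt
    (Finset.measurable_fun_sum t fun y _ => hem y) b₁ hEfin (ε := ENNReal.ofReal (δ * (κm / 8)))
    (by simpa using by positivity)
  obtain ⟨y, hyt, hya⟩ : ∃ y ∈ t, x a ∈ inner y := by
    have := hb₀ (a : ℂ) (by simpa using hab.trans_le hb₁.1)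
    simpa using this
  have hyF := htF y hyt
  have hκy : κm ≤ κ y := hym y hyt
  have hpi : 2 * Real.pi < 7 := by
    have := Real.pi_lt_d2
    linarith
  have hmove : ∀ τ ∈ Icc 0 (2 * Real.pi), (∀ θ ∈ Icc 0 τ, (a + θ * Complex.I : ℂ) ∈ A y) →
      ‖Θ y (x (a + τ * Complex.I)) - Θ y (x a)‖ < κ y / 4 := by
    intro τ hτ hseg
    have hτT : Ico 0 τ ⊆ T := Ico_subset_Ico_right hτ.2
    have hreal : ENNReal.ofReal δ * ENNReal.ofReal τ +
        (ENNReal.ofReal δ)⁻¹ * ENNReal.ofReal (δ * (κm / 8)) < ENNReal.ofReal (κ y / 4) := by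
      rw [← ENNReal.ofReal_mul hδ0.le, ← ENNReal.ofReal_inv_of_pos hδ0,
        ← ENNReal.ofReal_mul (by positivity), ← mul_assoc, inv_mul_cancel₀ hδ0.ne', one_mul,
        ← ENNReal.ofReal_add (mul_nonneg hδ0.le hτ.1) (by positivity)]
      refine (ENNReal.ofReal_lt_ofReal_iff (by linarith)).2 ?_
      have : δ * τ ≤ δ * 7 := by
        have := hτ.2
        gcongr
        linarith
      linarith
    have hle : ∀ θ ∈ Ico 0 τ, ∀ f : ℂ → ENNReal,
        (∀ s ∈ A y, f s ≤ e y s) → f (a + θ * Complex.I) ≤ ∑ y ∈ t, e y (a + θ * Complex.I) :=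
      fun θ hθ f hf => (hf _ (hseg θ (Ico_subset_Icc_self hθ))).trans
        (Finset.single_le_sum (f := fun y => e y (a + θ * Complex.I)) (fun _ _ => zero_le) hyt)
    have hcomp : ∀ h : ℂ → ℂ, DifferentiableOn ℂ h (A y) →
        (∀ s ∈ A y, ‖deriv h s‖ₑ ^ 2 ≤ e y s) →
        ‖h (a + τ * Complex.I) - h a‖ < κ y / 4 := by
      intro h hd hbound
      have h1 := enorm_sub_le_energy (hAo y) hd a hτ.1 hseg hδ0
      have h2 : ∫⁻ θ in Ico 0 τ, ‖deriv h (a + θ * Complex.I)‖ₑ ^ 2 ≤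
          ENNReal.ofReal (δ * (κm / 8)) :=
        ((setLIntegral_mono' measurableSet_Ico fun θ hθ =>
          hle θ hθ (fun s => ‖deriv h s‖ₑ ^ 2) hbound).trans
          (lintegral_mono_set hτT)).trans hae.le
      have h3 : ‖h (a + τ * Complex.I) - h a‖ₑ < ENNReal.ofReal (κ y / 4) :=
        (h1.trans (by gcongr)).trans_lt hreal
      rw [← ofReal_norm] at h3
      exact (ENNReal.ofReal_lt_ofReal_iff (by linarith)).1 h3
    rw [Prod.norm_def, max_lt_iff]
    refine ⟨hcomp _ (hAd y hyt).fst fun s hs => ?_, hcomp _ (hAd y hyt).snd fun s hs => ?_⟩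
    · simp only [e, indicator_of_mem hs]
      exact le_self_add
    · simp only [e, indicator_of_mem hs]
      exact le_add_self
  -- a compact, hence closed, neighbourhood that the segment cannot leave
  set Z : Set X := (Θ y).symm '' closedBall 0 (3 * κ y / 4) with hZ
  have hκ0 : 0 < κ y := hκ y hyF
  have hZsub : closedBall (0 : ℂ × ℂ) (3 * κ y / 4) ⊆ (Θ y).target :=
    (closedBall_subset_ball (by linarith)).trans (hκΘ y hyF)
  have hZc : IsClosed Z :=
    ((isCompact_closedBall _ _).image_of_continuousOn
      ((Θ y).continuousOn_symm.mono hZsub)).isClosed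
  have hZmem : ∀ q, q ∈ Z ↔ q ∈ (Θ y).source ∧ ‖Θ y q‖ ≤ 3 * κ y / 4 := by
    intro q
    constructor
    · rintro ⟨v, hv, rfl⟩
      refine ⟨(Θ y).map_target (hZsub hv), ?_⟩
      rw [(Θ y).right_inv (hZsub hv)]
      simpa using hv
    · rintro ⟨h1, h2⟩
      exact ⟨Θ y q, by simpa using h2, (Θ y).left_inv h1⟩
  have hline : Continuous fun θ : ℝ => x (a + θ * Complex.I) := hx.comp (by fun_prop)
  have hstay : Icc 0 (2 * Real.pi) ⊆ {τ : ℝ | ∀ θ ∈ Icc 0 τ, x (a + θ * Complex.I) ∈ Z} := by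
    have hcl : IsClosed ({τ : ℝ | ∀ θ ∈ Icc 0 τ, x (a + θ * Complex.I) ∈ Z} ∩
        Icc 0 (2 * Real.pi)) := by
      refine IsClosed.inter (isClosed_of_closure_subset fun τ hτ θ hθ => ?_) isClosed_Icc
      rcases hθ.2.lt_or_eq with hlt | heq
      · obtain ⟨τ', hτ', hmem⟩ := mem_closure_iff.1 hτ (Ioi θ) isOpen_Ioi hlt
        exact hmem θ ⟨hθ.1, le_of_lt hτ'⟩
      · rcases hθ.1.lt_or_eq with h0 | h0
        · have hsub : Ioo 0 θ ⊆ (fun θ : ℝ => x (a + θ * Complex.I)) ⁻¹' Z := by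
            intro θ' hθ'
            obtain ⟨τ', hτ', hmem⟩ := mem_closure_iff.1 hτ (Ioi θ') isOpen_Ioi
              (heq ▸ hθ'.2)
            exact hmem θ' ⟨hθ'.1.le, le_of_lt hτ'⟩
          have := (hZc.preimage hline).closure_subset_iff.2 hsub
          rw [closure_Ioo h0.ne] at this
          exact this ⟨h0.le, le_rfl⟩
        · obtain ⟨τ', hτ', hmem⟩ := mem_closure_iff.1 hτ (Ioi (-1)) isOpen_Ioi (by
            change -1 < τ
            linarith [hθ.1, hθ.2])
          by_cases h : 0 ≤ τ'
          · exact hmem θ ⟨h0.le, h0 ▸ h⟩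
          · rw [← h0]
            refine (hZmem _).2 ⟨by simpa using hya.1, ?_⟩
            have := hya.2
            simp only [mem_preimage, mem_ball_zero_iff] at this
            simp only [Complex.ofReal_zero, zero_mul, add_zero]
            linarith
    refine hcl.Icc_subset_of_forall_exists_gt ?_ ?_
    · intro θ hθ
      have h0 : θ = 0 := le_antisymm hθ.2 hθ.1
      rw [h0]
      refine (hZmem _).2 ⟨by simpa using hya.1, ?_⟩
      have := hya.2
      simp only [mem_preimage, mem_ball_zero_iff] at this
      simp only [Complex.ofReal_zero, zero_mul, add_zero]
      linarith
    · rintro τ ⟨hτ, hτ0⟩ c hc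
      have hsegA : ∀ θ ∈ Icc 0 τ, (a + θ * Complex.I : ℂ) ∈ A y := by
        intro θ hθ
        obtain ⟨h1, h2⟩ := (hZmem _).1 (hτ θ hθ)
        refine ⟨by simpa using hab, h1, ?_⟩
        linarith
      have h1 := hmove τ ⟨hτ0.1, hτ0.2.le⟩ hsegA
      have h2 : ‖Θ y (x (a + τ * Complex.I))‖ < 3 * κ y / 4 := by
        have h3 := hya.2
        simp only [mem_preimage, mem_ball_zero_iff] at h3
        have h4 := norm_le_norm_add_norm_sub' (Θ y (x (a + τ * Complex.I))) (Θ y (x a))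
        linarith
      have hO : IsOpen ((fun θ : ℝ => x (a + θ * Complex.I)) ⁻¹'
          ((Θ y).source ∩ Θ y ⁻¹' ball 0 (3 * κ y / 4))) :=
        ((Θ y).isOpen_inter_preimage isOpen_ball).preimage hline
      obtain ⟨l, u, hlu, hsub⟩ := mem_nhds_iff_exists_Ioo_subset.1 (hO.mem_nhds
        (show τ ∈ _ from ⟨(hsegA τ ⟨hτ0.1, le_rfl⟩).2.1, by simpa using h2⟩))
      obtain ⟨τ', hτ'1, hτ'2⟩ := exists_between (lt_min hlu.2 (show τ < c from hc))
      refine ⟨τ', fun θ hθ => ?_, hτ'1, (hτ'2.trans_le (min_le_right _ _)).le⟩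
      rcases le_or_gt θ τ with h | h
      · exact hτ θ ⟨hθ.1, h⟩
      · have := hsub ⟨hlu.1.trans h, hθ.2.trans_lt (hτ'2.trans_le (min_le_left _ _))⟩
        refine (hZmem _).2 ⟨this.1, ?_⟩
        have h5 := this.2
        simp only [mem_preimage, mem_ball_zero_iff] at h5
        exact h5.le
  refine ⟨a, hab.trans_le hb₁.2.1, (Θ y).symm '' closedBall 0 (3 * κ y / 4),
    isSimplyConnected_symm_image _ (convex_closedBall _ _)
      (nonempty_closedBall.2 (by positivity)) hZsub, fun θ hθ => hstay hθ θ ⟨hθ.1, le_rfl⟩⟩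

end ShortCircles

/-! ### Filling the image of a circle around a puncture -/

section Filling

open Filter Set Metric

/-- On a half-open horizontal strip of height `2 π`, the function `s ↦ exp (n * s)` takes each value
at most `n` times. -/
theorem card_le_of_exp_eq {n : ℕ} (hn : 0 < n) (S : Finset ℂ)
    (hS : ∀ s ∈ S, s.im ∈ Ico 0 (2 * Real.pi))
    (hexp : ∀ s ∈ S, ∀ s' ∈ S, Complex.exp (n * s) = Complex.exp (n * s')) : S.card ≤ n := by
  have hpi := Real.pi_pos
  have hn' : (0 : ℝ) < n := by exact_mod_cast hn
  have hcard : (Finset.Ico (0 : ℤ) n).card = n := by simp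
  rw [← hcard]
  refine Finset.card_le_card_of_injOn (fun s => ⌊n * s.im / (2 * Real.pi)⌋) ?_ ?_
  · intro s hs
    obtain ⟨h1, h2⟩ := hS s hs
    rw [Finset.coe_Ico]
    refine ⟨Int.floor_nonneg.2 (by positivity), Int.floor_lt.2 ?_⟩
    rw [div_lt_iff₀ (by positivity)]
    push_cast
    gcongr
  · intro s hs s' hs' heq
    obtain ⟨k, hk⟩ := Complex.exp_eq_exp_iff_exists_int.1 (hexp s hs s' hs')
    have him : n * s.im = n * s'.im + k * (2 * Real.pi) := by
      have := congrArg Complex.im hk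
      simpa using this
    have hk0 : k = 0 := by
      simp only at heq
      rw [him, add_div, mul_div_cancel_right₀ _ (by positivity), Int.floor_add_intCast] at heq
      omega
    rw [hk0] at hk
    have : (n : ℂ) * s = n * s' := by simpa using hk
    exact mul_left_cancel₀ (by exact_mod_cast hn.ne') this

/-- The loop over one period of a map with period `2 π i` can be moved along the strip, and is
null-homotopic as soon as some translate of it lies in a simply connected set. -/
theorem homotopic_refl_of_vertical_segment_mem {X : Type*} [TopologicalSpace X] {x : ℂ → X}
    (hx : Continuous x) (hper : ∀ s, x (s + 2 * Real.pi * Complex.I) = x s) (a : ℝ) {P : Set X}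
    (hP : IsSimplyConnected P) (hmem : ∀ θ ∈ Icc 0 (2 * Real.pi), x (a + θ * Complex.I) ∈ P)
    (γ : Path (x 0) (x 0)) (hγ : ∀ t : unitInterval, γ t = x (2 * Real.pi * Complex.I * (t : ℝ))) :
    γ.Homotopic (Path.refl _) := by
  set c : ℂ := 2 * Real.pi * Complex.I with hc
  -- the circle at real part `a`, and the path that leads there
  let γ₂ : Path (x a) (x a) :=
    { toFun := fun t => x (a + c * (t : ℝ))
      continuous_toFun := hx.comp (by fun_prop)
      source' := by simp
      target' := by simpa using hper a }
  let q : Path (x 0) (x a) :=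
    { toFun := fun t => x (a * (t : ℝ))
      continuous_toFun := hx.comp (by fun_prop)
      source' := by simp
      target' := by simp }
  let l₁ : Path (0 : ℂ) c :=
    { toFun := fun t => c * (t : ℝ)
      continuous_toFun := by fun_prop
      source' := by simp
      target' := by simp }
  let l₂ : Path (a : ℂ) (a + c) :=
    { toFun := fun t => a + c * (t : ℝ)
      continuous_toFun := by fun_prop
      source' := by simp
      target' := by simp }
  let p : Path (0 : ℂ) a :=
    { toFun := fun t => a * (t : ℝ)
      continuous_toFun := by fun_prop
      source' := by simp
      target' := by simp }
  let p' : Path (c : ℂ) (a + c) :=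
    { toFun := fun t => a * (t : ℝ) + c
      continuous_toFun := by fun_prop
      source' := by simp
      target' := by simp }
  have h1 : l₁.Homotopic ((p.trans l₂).trans p'.symm) := SimplyConnectedSpace.paths_homotopic _ _
  have hc0 : x 0 = x c := by simpa using (hper 0).symm
  have h2 := (h1.map ⟨x, hx⟩).pathCast (x₂ := x 0) (x₃ := x 0) rfl hc0
  have h3 : (l₁.map hx).cast rfl hc0 = γ := by
    ext t
    exact (hγ t).symm
  have h4 : ((((p.trans l₂).trans p'.symm).map hx).cast rfl hc0 : Path (x 0) (x 0)) =
      (q.trans γ₂).trans q.symm := by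
    ext t
    simp only [Path.map_trans, Path.cast_coe, Path.trans_apply]
    split_ifs
    · rfl
    · rfl
    · exact hper _
  have h5 : γ₂.Homotopic (Path.refl _) := by
    obtain ⟨F, -⟩ := (isSimplyConnected_iff_exists_homotopy_refl_forall_mem.1 hP).2 _ γ₂ fun t => by
      have := hmem (2 * Real.pi * t) ⟨by have := t.2.1; positivity, by
        have := t.2.2
        have := Real.pi_pos
        nlinarith⟩
      have heq : (a + c * (t : ℝ) : ℂ) = a + (2 * Real.pi * t : ℝ) * Complex.I := by
        rw [hc]
        push_cast
        ring
      rw [← heq] at this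
      exact this
    exact ⟨F⟩
  have h6 : γ.Homotopic ((q.trans γ₂).trans q.symm) := by
    rw [← h3, ← h4]
    exact h2
  refine h6.trans ?_
  rw [← Path.Homotopic.Quotient.eq] at h5 ⊢
  simp only [Path.Homotopic.Quotient.mk_trans, h5, Path.Homotopic.Quotient.mk_symm,
    Path.Homotopic.Quotient.mk_refl]
  simp

variable {X : Type*} [TopologicalSpace X] [ChartedSpace (EuclideanSpace ℂ (Fin 2)) X]
  [IsManifold 𝓘(ℂ, EuclideanSpace ℂ (Fin 2)) ω X]

/-- A holomorphic curve `x` that lies in the zero set of a holomorphic function `Φ` takes, in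
suitable coordinates, each value of each coordinate a bounded number of times. -/
theorem exists_chart_card_le {x : ℂ → X}
    (hhol : MDifferentiableOn 𝓘(ℂ) 𝓘(ℂ, EuclideanSpace ℂ (Fin 2)) x {s | s.re < 0})
    {n : ℕ} (hn : 0 < n) (hinj : ∀ s s' : ℂ, s.re < 0 → s'.re < 0 →
      x s = x s' → Complex.exp (n * s) = Complex.exp (n * s'))
    {y : X} {W : Set X} (hW : IsOpen W) (hyW : y ∈ W) {Φ : X → ℂ}
    (hΦ : MDifferentiableOn 𝓘(ℂ, EuclideanSpace ℂ (Fin 2)) 𝓘(ℂ) Φ W)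
    (hne : ∀ O : Set X, IsOpen O → O.Nonempty → O ⊆ W → ∃ q ∈ O, Φ q ≠ 0)
    {b : ℝ} (hb : b ≤ 0) (hzero : ∀ s : ℂ, s.re < b → x s ∈ W → Φ (x s) = 0) :
    ∃ (Θ : OpenPartialHomeomorph X (ℂ × ℂ)) (κ : ℝ) (K : ℕ) (b : ℝ), 0 < κ ∧
      y ∈ Θ.source ∧ Θ y = 0 ∧ ball 0 κ ⊆ Θ.target ∧
      DifferentiableOn ℂ (fun s => Θ (x s)) {s | s.re < b ∧ x s ∈ Θ.source} ∧
      (∀ z, ∀ S : Finset ℂ, (∀ s ∈ S, s ∈ Iio b ×ℂ Ico 0 (2 * Real.pi) ∧ x s ∈ Θ.source ∧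
        ‖Θ (x s)‖ < κ ∧ (Θ (x s)).1 = z) → S.card ≤ K) ∧
      (∀ z, ∀ S : Finset ℂ, (∀ s ∈ S, s ∈ Iio b ×ℂ Ico 0 (2 * Real.pi) ∧ x s ∈ Θ.source ∧
        ‖Θ (x s)‖ < κ ∧ (Θ (x s)).2 = z) → S.card ≤ K) := by
  classical
  set c := chartAt (EuclideanSpace ℂ (Fin 2)) y with hc
  have hys : y ∈ c.source := mem_chart_source _ y
  set p := c y with hp
  have hcsymm : MDifferentiableOn 𝓘(ℂ, EuclideanSpace ℂ (Fin 2)) 𝓘(ℂ, EuclideanSpace ℂ (Fin 2))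
      c.symm c.target :=
    (contMDiffOn_chart_symm (I := 𝓘(ℂ, EuclideanSpace ℂ (Fin 2))) (n := ω)
      (x := y)).mdifferentiableOn (by simp)
  have hcd : MDifferentiableOn 𝓘(ℂ, EuclideanSpace ℂ (Fin 2)) 𝓘(ℂ, EuclideanSpace ℂ (Fin 2))
      c c.source :=
    (contMDiffOn_chart (I := 𝓘(ℂ, EuclideanSpace ℂ (Fin 2))) (n := ω) (x := y)).mdifferentiableOn
      (by simp)
  have hopen : IsOpen (c.target ∩ c.symm ⁻¹' W) := c.symm.isOpen_inter_preimage hW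
  obtain ⟨R, hR, hball⟩ := Metric.isOpen_iff.1 hopen p ⟨c.map_source hys, by
    rw [mem_preimage, hp, c.left_inv hys]; exact hyW⟩
  have hφ : DifferentiableOn ℂ (fun q => Φ (c.symm q)) (ball p R) := by
    rw [← mdifferentiableOn_iff_differentiableOn]
    exact hΦ.comp (hcsymm.mono fun q hq => (hball hq).1) fun q hq => (hball hq).2
  obtain ⟨Λ, κ, N, hκ, hsub, hc1, hc2⟩ := exists_polydisc_coordinates (by simp) hR hφ
    fun O hO hOne hOsub => by
      obtain ⟨q, ⟨v, hv, rfl⟩, hq⟩ := hne (c.symm '' O)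
        (c.isOpen_image_symm_of_subset_target hO fun v hv => (hball (hOsub hv)).1)
        (hOne.image _) (by
          rintro _ ⟨v, hv, rfl⟩
          exact (hball (hOsub hv)).2)
      exact ⟨v, hv, hq⟩
  let H : EuclideanSpace ℂ (Fin 2) ≃ₜ ℂ × ℂ := (Homeomorph.addRight (-p)).trans Λ.toHomeomorph
  have hH : ∀ q, H q = Λ (q - p) := fun q => by simp [H, sub_eq_add_neg]
  have hHs : ∀ v, H.symm v = p + Λ.symm v := fun v => by
    rw [H.symm_apply_eq, hH]; simp
  let Θ : OpenPartialHomeomorph X (ℂ × ℂ) := c.trans H.toOpenPartialHomeomorph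
  have hΘs : Θ.source = c.source := by simp [Θ]
  have hΘ : ∀ q, Θ q = H (c q) := fun q => rfl
  have hinv : ∀ q ∈ c.source, q = c.symm (p + Λ.symm (Θ q)) := by
    intro q hq
    rw [← hHs, hΘ, Homeomorph.symm_apply_apply, c.left_inv hq]
  have hzero' : ∀ s : ℂ, s.re < b → x s ∈ c.source → ‖Θ (x s)‖ < κ →
      Φ (c.symm (p + Λ.symm (Θ (x s)))) = 0 := by
    intro s hs hxs hlt
    have hW' : x s ∈ W := by
      rw [hinv _ hxs]
      exact (hball (hsub _ hlt)).2
    rw [← hinv _ hxs]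
    exact hzero s hs hW'
  have hfib : ∀ S : Finset ℂ, (∀ s ∈ S, s ∈ Iio b ×ℂ Ico 0 (2 * Real.pi) ∧ x s ∈ Θ.source) →
      (∀ s ∈ S, ∀ s' ∈ S, Θ (x s) = Θ (x s')) → S.card ≤ n := by
    intro S hS hS'
    refine card_le_of_exp_eq hn S (fun s hs => (hS s hs).1.2) fun s hs s' hs' => hinj _ _
      (lt_of_lt_of_le (hS s hs).1.1 hb) (lt_of_lt_of_le (hS s' hs').1.1 hb) ?_
    exact Θ.injOn (hS s hs).2 (hS s' hs').2 (hS' s hs s' hs')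
  refine ⟨Θ, κ, n * N, b, hκ, hΘs ▸ hys, ?_, ?_, ?_, ?_, ?_⟩
  · rw [hΘ, hH, ← hp, sub_self, map_zero]
  · intro v hv
    have : Θ.target = H.symm ⁻¹' c.target := by simp [Θ]
    rw [this, mem_preimage, hHs]
    exact (hball (hsub v (by simpa using hv))).1
  · have h1 : DifferentiableOn ℂ (fun s => c (x s)) {s | s.re < b ∧ x s ∈ Θ.source} := by
      rw [← mdifferentiableOn_iff_differentiableOn]
      refine hcd.comp (hhol.mono fun s hs => ?_) fun s hs => hΘs ▸ hs.2
      exact lt_of_lt_of_le hs.1 hb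
    have h2 : (fun s => Θ (x s)) = fun s => Λ (c (x s) - p) := funext fun s => by rw [hΘ, hH]
    rw [h2]
    exact Λ.differentiable.comp_differentiableOn (h1.sub_const p)
  · intro z S hS
    refine (S.card_le_mul_card_image (f := fun s => (Θ (x s)).2) n fun w _ => ?_).trans
      (Nat.mul_le_mul_left n (hc2 z _ fun w hw => ?_))
    · refine hfib _ (fun s hs => ?_) fun s hs s' hs' => ?_
      · obtain ⟨h1, h2, -, -⟩ := hS s (Finset.mem_filter.1 hs).1
        exact ⟨h1, h2⟩
      · rw [Finset.mem_filter] at hs hs'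
        exact Prod.ext ((hS s hs.1).2.2.2.trans (hS s' hs'.1).2.2.2.symm) (hs.2.trans hs'.2.symm)
    · obtain ⟨s, hs, rfl⟩ := Finset.mem_image.1 hw
      obtain ⟨h1, h2, h3, rfl⟩ := hS s hs
      exact ⟨h3, hzero' s h1.1 (hΘs ▸ h2) h3⟩
  · intro w S hS
    refine (S.card_le_mul_card_image (f := fun s => (Θ (x s)).1) n fun w _ => ?_).trans
      (Nat.mul_le_mul_left n (hc1 w _ fun z hz => ?_))
    · refine hfib _ (fun s hs => ?_) fun s hs s' hs' => ?_
      · obtain ⟨h1, h2, -, -⟩ := hS s (Finset.mem_filter.1 hs).1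
        exact ⟨h1, h2⟩
      · rw [Finset.mem_filter] at hs hs'
        exact Prod.ext (hs.2.trans hs'.2.symm) ((hS s hs.1).2.2.2.trans (hS s' hs'.1).2.2.2.symm)
    · obtain ⟨s, hs, rfl⟩ := Finset.mem_image.1 hz
      obtain ⟨h1, h2, h3, rfl⟩ := hS s hs
      exact ⟨h3, hzero' s h1.1 (hΘs ▸ h2) h3⟩

/-- Let `x` be a holomorphic map from a punctured disc (in the logarithmic coordinate `s`) to a
complex surface that tends to a compact set, near which its image lies in the zero sets of
holomorphic functions that vanish on no open set. Then the image of the boundary circle is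
null-homotopic. -/
theorem homotopic_refl_of_holomorphic_curve [T2Space X] {x : ℂ → X} (hx : Continuous x)
    (hhol : MDifferentiableOn 𝓘(ℂ) 𝓘(ℂ, EuclideanSpace ℂ (Fin 2)) x {s | s.re < 0})
    (hper : ∀ s, x (s + 2 * Real.pi * Complex.I) = x s)
    {n : ℕ} (hn : 0 < n) (hinj : ∀ s s' : ℂ, s.re < 0 → s'.re < 0 →
      x s = x s' → Complex.exp (n * s) = Complex.exp (n * s'))
    {F : Set X} (hF : IsCompact F)
    (hlim : ∀ W : Set X, IsOpen W → F ⊆ W → ∃ b : ℝ, ∀ s : ℂ, s.re < b → x s ∈ W)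
    {W : Set X} (hW : IsOpen W) (hFW : F ⊆ W) {Φ : X → ℂ}
    (hΦ : MDifferentiableOn 𝓘(ℂ, EuclideanSpace ℂ (Fin 2)) 𝓘(ℂ) Φ W)
    (hne : ∀ O : Set X, IsOpen O → O.Nonempty → O ⊆ W → ∃ q ∈ O, Φ q ≠ 0)
    {b : ℝ} (hb : b ≤ 0) (hzero : ∀ s : ℂ, s.re < b → x s ∈ W → Φ (x s) = 0)
    (γ : Path (x 0) (x 0)) (hγ : ∀ t : unitInterval, γ t = x (2 * Real.pi * Complex.I * (t : ℝ))) :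
    γ.Homotopic (Path.refl _) := by
  obtain ⟨a, -, P, hP, hmem⟩ := exists_vertical_segment_mem hx hF hlim fun y hy =>
    exists_chart_card_le hhol hn hinj hW (hFW hy) hΦ hne hb hzero
  exact homotopic_refl_of_vertical_segment_mem hx hper a hP hmem γ hγ

end Filling

/-! ### Complements of analytic subsets -/

section Complements

open Filter Set Metric

/-- Two points of a convex open set of the plane can be joined off a countable set by the union of
two segments. -/
theorem joinedIn_diff_countable {D Z : Set ℂ} (hD : IsOpen D) (hDc : Convex ℝ D)
    (hZ : Z.Countable) {a b : ℂ} (ha : a ∈ D \ Z) (hb : b ∈ D \ Z) : JoinedIn (D \ Z) a b := by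
  rcases eq_or_ne a b with rfl | hab
  · exact JoinedIn.refl ha
  -- For given endpoints `u`, `v`, each point of `Z` lies on at most one of the segments from `u`
  -- to `u + (1 / 2 + t * I) * (v - u)`.
  have hbad : ∀ u v : ℂ, u ≠ v → {t : ℝ | ∃ s : ℝ, 0 < s ∧
      u + s * ((1 / 2 + t * Complex.I) * (v - u)) ∈ Z}.Countable := by
    intro u v huv
    refine (hZ.image fun z => ((z - u) / (v - u)).im / (2 * ((z - u) / (v - u)).re)).mono ?_
    rintro t ⟨s, hs, hmem⟩
    refine ⟨_, hmem, ?_⟩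
    have h1 : v - u ≠ 0 := sub_ne_zero.2 huv.symm
    have h2 : (u + s * ((1 / 2 + t * Complex.I) * (v - u)) - u) / (v - u) =
        ⟨s / 2, s * t⟩ := by
      rw [add_sub_cancel_left, ← mul_assoc, mul_div_assoc, div_self h1, mul_one]
      apply Complex.ext <;> simp; ring
    simp only [h2]
    field_simp
  have hmid : (1 / 2 : ℝ) • a + (1 / 2 : ℝ) • b ∈ D :=
    hDc ha.1 hb.1 (by norm_num) (by norm_num) (by norm_num)
  have hopen : IsOpen ((fun t : ℝ => a + (1 / 2 + t * Complex.I) * (b - a)) ⁻¹' D) :=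
    hD.preimage (by fun_prop)
  obtain ⟨t, htD, ht⟩ := (((hbad a b hab).union ((hbad b a hab.symm).preimage
    (neg_injective (G := ℝ)))).dense_compl ℝ).inter_open_nonempty _ hopen ⟨0, by
      simp only [mem_preimage]
      convert hmid using 1
      simp only [Complex.real_smul]
      push_cast
      ring⟩
  simp only [mem_preimage] at htD
  simp only [mem_compl_iff, mem_union, not_or, mem_preimage, mem_ofPred_eq, not_exists, not_and]
    at ht
  set c := a + (1 / 2 + t * Complex.I) * (b - a) with hc
  have hcb : c = b + (1 / 2 + (-t : ℝ) * Complex.I) * (a - b) := by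
    rw [hc]
    push_cast
    ring
  have hseg : ∀ u v : ℂ, u ∈ D \ Z → ∀ t : ℝ, c = u + (1 / 2 + t * Complex.I) * (v - u) →
      (∀ s : ℝ, 0 < s → u + s * ((1 / 2 + t * Complex.I) * (v - u)) ∉ Z) →
      segment ℝ u c ⊆ D \ Z := by
    intro u v hu t hcu hs z hz
    refine ⟨hDc.segment_subset hu.1 htD hz, ?_⟩
    rw [segment_eq_image'] at hz
    obtain ⟨s, hs01, rfl⟩ := hz
    rcases hs01.1.eq_or_lt with rfl | h0
    · simpa using hu.2
    · have := hs s h0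
      rw [hcu, add_sub_cancel_left]
      simpa only [Complex.real_smul] using this
  exact (JoinedIn.of_segment_subset (hseg a b ha t rfl fun s hs => ht.1 s hs)).trans
    (JoinedIn.of_segment_subset (hseg b a hb (-t) hcb fun s hs => ht.2 s hs)).symm

/-- The nonvanishing locus of a holomorphic function on a ball is path-connected: two of its points
lie on a complex line, on which the zeros are isolated. -/
theorem isPathConnected_ball_inter_ne_zero {E : Type*} [NormedAddCommGroup E] [NormedSpace ℂ E]
    {φ : E → ℂ} {p : E} {R : ℝ} (hφ : DifferentiableOn ℂ φ (ball p R))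
    (hne : ∃ q ∈ ball p R, φ q ≠ 0) : IsPathConnected (ball p R ∩ {q | φ q ≠ 0}) := by
  obtain ⟨q₀, hq₀, hφ₀⟩ := hne
  refine ⟨q₀, ⟨hq₀, hφ₀⟩, fun q₁ hq₁ => ?_⟩
  let ℓ : ℂ → E := fun τ => q₀ + τ • (q₁ - q₀)
  have hℓ : Differentiable ℂ ℓ := by fun_prop
  have hℓ0 : ℓ 0 = q₀ := by simp [ℓ]
  have hℓ1 : ℓ 1 = q₁ := by simp [ℓ]
  let D : Set ℂ := ℓ ⁻¹' ball p R
  have hDo : IsOpen D := isOpen_ball.preimage hℓ.continuous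
  have hDc : Convex ℝ D := by
    intro u hu v hv x y hx hy hxy
    have : ℓ (x • u + y • v) = x • ℓ u + y • ℓ v := by
      simp only [ℓ, smul_add, add_smul, smul_assoc]
      rw [add_add_add_comm, ← add_smul, hxy, one_smul]
    rw [mem_preimage, this]
    exact convex_ball p R hu hv hx hy hxy
  have hd : DifferentiableOn ℂ (φ ∘ ℓ) D := hφ.comp hℓ.differentiableOn fun τ hτ => hτ
  have han : AnalyticOnNhd ℂ (φ ∘ ℓ) D := hd.analyticOnNhd hDo
  have h0D : (0 : ℂ) ∈ D := by rw [mem_preimage, hℓ0]; exact hq₀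
  have h1D : (1 : ℂ) ∈ D := by rw [mem_preimage, hℓ1]; exact hq₁.1
  set Z : Set ℂ := D ∩ {τ | φ (ℓ τ) = 0} with hZdef
  have hZ : Z.Countable := by
    obtain ⟨t, -, htc, ht⟩ := TopologicalSpace.countable_cover_nhdsWithin
      (f := fun x : ℂ => ({x} : Set ℂ)) (s := Z) fun x hx => by
        rcases (han x hx.1).eventually_eq_zero_or_eventually_ne_zero with h | h
        · exfalso
          have := han.eqOn_zero_of_preconnected_of_eventuallyEq_zero hDc.isPreconnected hx.1 h h0D
          simp only [Function.comp_apply, hℓ0, Pi.zero_apply] at this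
          exact hφ₀ this
        · rw [eventually_nhdsWithin_iff] at h
          rw [mem_nhdsWithin_iff_eventually]
          filter_upwards [h] with w hw hwZ
          by_contra hwx
          exact hw hwx hwZ.2
    exact htc.mono (ht.trans (by simp))
  have hj := joinedIn_diff_countable hDo hDc hZ (a := 0) (b := 1)
    ⟨h0D, fun h => hφ₀ (by simpa [hℓ0] using h.2)⟩ ⟨h1D, fun h => hq₁.2 (by simpa [hℓ1] using h.2)⟩
  obtain ⟨γ, hγ⟩ := hj
  exact ⟨(γ.map hℓ.continuous).cast hℓ0.symm hℓ1.symm,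
    fun t => ⟨(hγ t).1, fun h => (hγ t).2 ⟨(hγ t).1, h⟩⟩⟩

/-- Around every point there are arbitrarily small simply connected open sets that meet `U` in a
path-connected set. -/
def HasNiceBasis {X : Type*} [TopologicalSpace X] (U : Set X) : Prop :=
  ∀ (x : X) (W : Set X), IsOpen W → x ∈ W →
    ∃ B ⊆ W, x ∈ B ∧ IsOpen B ∧ IsSimplyConnected B ∧ IsPathConnected (B ∩ U)

/-- The complement of a nowhere dense analytic subset of a complex manifold. -/
theorem hasNiceBasis_of_ne_zero {E : Type*} [NormedAddCommGroup E] [NormedSpace ℂ E]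
    {X : Type*} [TopologicalSpace X] [ChartedSpace E X] [IsManifold 𝓘(ℂ, E) ω X] {U : Set X}
    (hU : Dense U)
    (hloc : ∀ x : X, ∃ (W : Set X) (Φ : X → ℂ), IsOpen W ∧ x ∈ W ∧
      MDifferentiableOn 𝓘(ℂ, E) 𝓘(ℂ) Φ W ∧ ∀ y ∈ W, y ∈ U ↔ Φ y ≠ 0) : HasNiceBasis U := by
  intro x W₀ hW₀ hxW₀
  obtain ⟨W, Φ, hW, hxW, hΦ, hΦU⟩ := hloc x
  set c := chartAt E x with hc
  have hopen : IsOpen (c.target ∩ c.symm ⁻¹' (W ∩ W₀)) :=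
    c.symm.isOpen_inter_preimage (hW.inter hW₀)
  have hxs : x ∈ c.source := mem_chart_source E x
  obtain ⟨R, hR, hball⟩ := Metric.isOpen_iff.1 hopen (c x) ⟨c.map_source hxs, by
    rw [mem_preimage, c.left_inv hxs]; exact ⟨hxW, hxW₀⟩⟩
  have hsub : ball (c x) R ⊆ c.target := fun v hv => (hball hv).1
  have hφ : DifferentiableOn ℂ (fun q => Φ (c.symm q)) (ball (c x) R) := by
    rw [← mdifferentiableOn_iff_differentiableOn]
    exact hΦ.comp (((contMDiffOn_chart_symm (I := 𝓘(ℂ, E)) (n := ω) (x := x)).mdifferentiableOn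
      (by simp)).mono hsub) fun q hq => (hball hq).2.1
  have hBo : IsOpen (c.symm '' ball (c x) R) :=
    c.isOpen_image_symm_of_subset_target isOpen_ball hsub
  have hxB : x ∈ c.symm '' ball (c x) R := ⟨c x, mem_ball_self hR, c.left_inv hxs⟩
  have hBU : c.symm '' ball (c x) R ∩ U =
      c.symm '' (ball (c x) R ∩ {q | Φ (c.symm q) ≠ 0}) := by
    ext y
    constructor
    · rintro ⟨⟨v, hv, rfl⟩, hy⟩
      exact ⟨v, ⟨hv, (hΦU _ (hball hv).2.1).1 hy⟩, rfl⟩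
    · rintro ⟨v, ⟨hv, hv'⟩, rfl⟩
      exact ⟨⟨v, hv, rfl⟩, (hΦU _ (hball hv).2.1).2 hv'⟩
  refine ⟨c.symm '' ball (c x) R, ?_, hxB, hBo, ?_, ?_⟩
  · rintro _ ⟨v, hv, rfl⟩
    exact (hball hv).2.2
  · let _ : NormedSpace ℝ E := NormedSpace.restrictScalars ℝ ℂ E
    exact isSimplyConnected_symm_image _ (convex_ball _ _) (nonempty_ball.2 hR) hsub
  · rw [hBU]
    refine IsPathConnected.image' (isPathConnected_ball_inter_ne_zero hφ ?_)
      (c.continuousOn_symm.mono (inter_subset_left.trans hsub))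
    obtain ⟨y, hyB, hyU⟩ := hU.inter_open_nonempty _ hBo ⟨x, hxB⟩
    obtain ⟨v, hv, rfl⟩ := hyB
    exact ⟨v, hv, (hΦU _ (hball hv).2.1).1 hyU⟩

variable {X : Type*} [TopologicalSpace X] {U : Set X}

theorem HasNiceBasis.isPathConnected [ConnectedSpace X] (hU : HasNiceBasis U) :
    IsPathConnected U := by
  obtain ⟨x₀⟩ := (inferInstance : Nonempty X)
  obtain ⟨B₀, -, -, -, -, hB₀⟩ := hU x₀ univ isOpen_univ (mem_univ _)
  obtain ⟨u₀, hu₀⟩ := hB₀.nonempty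
  let S : Set X := {x | ∃ B : Set X, x ∈ B ∧ IsOpen B ∧ IsPathConnected (B ∩ U) ∧
    ∃ u ∈ B ∩ U, JoinedIn U u₀ u}
  have hS : IsClopen S := by
    constructor
    · rw [← isOpen_compl_iff, isOpen_iff_mem_nhds]
      intro x hx
      obtain ⟨B, -, hxB, hBo, -, hB⟩ := hU x univ isOpen_univ (mem_univ _)
      refine mem_of_superset (hBo.mem_nhds hxB) fun y hyB hyS => hx ?_
      obtain ⟨B', hyB', hB'o, hB', u, hu, hju⟩ := hyS
      obtain ⟨B'', hB''sub, -, -, -, hB''⟩ := hU y (B ∩ B') (hBo.inter hB'o) ⟨hyB, hyB'⟩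
      obtain ⟨u'', hu''⟩ := hB''.nonempty
      refine ⟨B, hxB, hBo, hB, u'', ⟨(hB''sub hu''.1).1, hu''.2⟩, hju.trans ?_⟩
      exact (hB'.joinedIn u hu u'' ⟨(hB''sub hu''.1).2, hu''.2⟩).mono inter_subset_right
    · rw [isOpen_iff_mem_nhds]
      rintro x ⟨B, hxB, hBo, hB, hBu⟩
      exact mem_of_superset (hBo.mem_nhds hxB) fun y hy => ⟨B, hy, hBo, hB, hBu⟩
  obtain ⟨B₁, -, hx₀, hB₁o, -, hB₁⟩ := hU u₀ univ isOpen_univ (mem_univ _)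
  have hne : S.Nonempty := ⟨u₀, B₁, hx₀, hB₁o, hB₁, u₀, ⟨hx₀, hu₀.2⟩, JoinedIn.refl hu₀.2⟩
  refine ⟨u₀, hu₀.2, fun {u} hu => ?_⟩
  obtain ⟨B, hxB, -, hB, u', hu', hj⟩ : u ∈ S := hS.eq_univ hne ▸ mem_univ u
  exact hj.trans ((hB.joinedIn u' hu' u ⟨hxB, hu⟩).mono inter_subset_right)

theorem IsSimplyConnected.homotopic {S : Set X} (hS : IsSimplyConnected S) {a b : X}
    (p q : Path a b) (hp : ∀ t, p t ∈ S) (hq : ∀ t, q t ∈ S) : p.Homotopic q := by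
  have := hS.simplyConnectedSpace
  have ha : a ∈ S := by simpa using hp 0
  have hb : b ∈ S := by simpa using hp 1
  let p' : Path (⟨a, ha⟩ : S) ⟨b, hb⟩ :=
    ⟨⟨fun t => ⟨p t, hp t⟩, by fun_prop⟩, by simp, by simp⟩
  let q' : Path (⟨a, ha⟩ : S) ⟨b, hb⟩ :=
    ⟨⟨fun t => ⟨q t, hq t⟩, by fun_prop⟩, by simp, by simp⟩
  exact (SimplyConnectedSpace.paths_homotopic p' q').map ⟨Subtype.val, continuous_subtype_val⟩

theorem Path.trans_mem {S : Set X} {a b c : X} {p : Path a b} {q : Path b c}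
    (hp : ∀ t, p t ∈ S) (hq : ∀ t, q t ∈ S) (t : unitInterval) : p.trans q t ∈ S := by
  rw [Path.trans_apply]
  split_ifs
  exacts [hp _, hq _]

/-- Every path between points of `U` can be pushed into `U`. -/
theorem HasNiceBasis.exists_homotopic (hU : HasNiceBasis U) {a b : X} (p : Path a b) (ha : a ∈ U)
    (hb : b ∈ U) : ∃ q : Path a b, (∀ t, q t ∈ U) ∧ p.Homotopic q := by
  -- the initial piece of the path up to `p t`, completed by a path `η` inside a small set, can be
  -- pushed into `U`
  let T : unitInterval → Set X → Prop := fun t B => ∃ (u : X) (κ : Path (p 0) u) (η : Path (p t) u),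
    (∀ s, κ s ∈ U) ∧ (∀ s, η s ∈ B) ∧ ((p.subpath 0 t).trans η).Homotopic κ
  have hmove : ∀ (B : Set X) (t t' : unitInterval), (∀ s ∈ uIcc t t', p s ∈ B) →
      T t B → T t' B := by
    rintro B t t' hB ⟨u, κ, η, hκ, hη, hh⟩
    refine ⟨u, κ, (p.subpath t' t).trans η, hκ, Path.trans_mem (fun s => ?_) hη, ?_⟩
    · have : p.subpath t' t s ∈ range (p.subpath t' t) := mem_range_self s
      rw [Path.range_subpath, uIcc_comm] at this
      obtain ⟨s', hs', hs'eq⟩ := this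
      rw [← hs'eq]
      exact hB s' hs'
    · refine Path.Homotopic.trans ?_ hh
      have h1 : ((p.subpath 0 t').trans (p.subpath t' t)).Homotopic (p.subpath 0 t) :=
        ⟨Path.Homotopy.subpathTransSubpath p 0 t' t⟩
      rw [← Path.Homotopic.Quotient.eq] at h1 ⊢
      simp only [Path.Homotopic.Quotient.mk_trans] at h1 ⊢
      rw [← Path.Homotopic.Quotient.trans_assoc, h1]
  have hchange : ∀ (B B' : Set X) (t : unitInterval), IsOpen B → IsOpen B' → p t ∈ B → p t ∈ B' →
      IsSimplyConnected B → IsPathConnected (B ∩ U) → T t B → T t B' := by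
    rintro B B' t hBo hB'o hB hB' hBs hBU ⟨u, κ, η, hκ, hη, hh⟩
    obtain ⟨B'', hsub, hmem, -, hB''s, hB''U⟩ := hU (p t) (B ∩ B') (hBo.inter hB'o) ⟨hB, hB'⟩
    obtain ⟨u'', hu''⟩ := hB''U.nonempty
    have huB : u ∈ B ∩ U := ⟨by simpa using hη 1, by simpa using hκ 1⟩
    obtain ⟨η'', hη''⟩ := hB''s.isPathConnected.joinedIn _ hmem _ hu''.1
    obtain ⟨κ'', hκ''⟩ := hBU.joinedIn u huB u'' ⟨(hsub hu''.1).1, hu''.2⟩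
    refine ⟨u'', κ.trans κ'', η'', Path.trans_mem hκ fun s => (hκ'' s).2,
      fun s => (hsub (hη'' s)).2, ?_⟩
    have h1 : η''.Homotopic (η.trans κ'') := hBs.homotopic _ _ (fun s => (hsub (hη'' s)).1)
      (Path.trans_mem hη fun s => (hκ'' s).1)
    rw [← Path.Homotopic.Quotient.eq] at h1 hh ⊢
    simp only [Path.Homotopic.Quotient.mk_trans] at h1 hh ⊢
    rw [h1, ← hh, Path.Homotopic.Quotient.trans_assoc]
  let S : Set unitInterval := {t | ∀ B : Set X, IsOpen B → p t ∈ B → T t B}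
  have hlocal : ∀ t, ∀ᶠ t' in 𝓝 t, (t ∈ S ↔ t' ∈ S) := by
    intro t
    obtain ⟨B, -, htB, hBo, hBs, hBU⟩ := hU (p t) univ isOpen_univ (mem_univ _)
    have hnhds : p ⁻¹' B ∈ 𝓝 t := (hBo.preimage p.continuous).mem_nhds htB
    have hIcc := (tendsto_const_nhds (x := t) (f := 𝓝 t)).uIcc (tendsto_id (x := 𝓝 t))
    rw [tendsto_smallSets_iff] at hIcc
    filter_upwards [hIcc _ hnhds] with t' ht'
    have ht'B : p t' ∈ B := ht' right_mem_uIcc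
    constructor
    · intro h B' hB'o hB'
      exact hchange B B' t' hBo hB'o ht'B hB' hBs hBU
        (hmove B t t' (fun s hs => ht' hs) (h B hBo htB))
    · intro h B' hB'o hB'
      exact hchange B B' t hBo hB'o htB hB' hBs hBU
        (hmove B t' t (fun s hs => ht' (uIcc_comm t t' ▸ hs)) (h B hBo ht'B))
  have hS : IsClopen S := by
    constructor
    · rw [← isOpen_compl_iff, isOpen_iff_mem_nhds]
      intro t ht
      filter_upwards [hlocal t] with t' ht' h
      exact ht (ht'.2 h)
    · rw [isOpen_iff_mem_nhds]
      intro t ht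
      filter_upwards [hlocal t] with t' ht'
      exact ht'.1 ht
  have h0 : (0 : unitInterval) ∈ S := by
    intro B hBo hB
    refine ⟨p 0, Path.refl _, Path.refl _, fun s => by simpa using ha,
      fun s => by simpa using hB, ?_⟩
    rw [Path.subpath_self]
    exact ⟨Path.Homotopy.reflTrans _⟩
  have h1 : (1 : unitInterval) ∈ S := hS.eq_univ ⟨0, h0⟩ ▸ mem_univ _
  obtain ⟨B, -, hB, hBo, hBs, hBU⟩ := hU (p 1) univ isOpen_univ (mem_univ _)
  obtain ⟨u, κ, η, hκ, hη, hh⟩ := h1 B hBo hB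
  have huB : u ∈ B ∩ U := ⟨by simpa using hη 1, by simpa using hκ 1⟩
  obtain ⟨κ'', hκ''⟩ := hBU.joinedIn u huB (p 1) ⟨hB, by simpa using hb⟩
  refine ⟨(κ.trans κ'').cast p.source.symm p.target.symm,
    Path.trans_mem hκ fun s => (hκ'' s).2, ?_⟩
  have h2 : (Path.refl (p 1)).Homotopic (η.trans κ'') := hBs.homotopic _ _
    (fun s => by simpa using hB)
    (Path.trans_mem hη fun s => (hκ'' s).1)
  have h3 : (p.subpath 0 1).Homotopic (κ.trans κ'') := by
    rw [← Path.Homotopic.Quotient.eq] at h2 hh ⊢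
    simp only [Path.Homotopic.Quotient.mk_trans, Path.Homotopic.Quotient.mk_refl] at h2 hh ⊢
    rw [← hh, Path.Homotopic.Quotient.trans_assoc, ← h2, Path.Homotopic.Quotient.trans_refl]
  rw [Path.subpath_zero_one] at h3
  exact h3.pathCast p.source.symm p.target.symm

/-- If the loops in `U` are null-homotopic in the whole space, the space is simply connected. -/
theorem HasNiceBasis.simplyConnectedSpace (hU : HasNiceBasis U) (hc : IsPathConnected U) {x₀ : X}
    (hx₀ : x₀ ∈ U) (h : ∀ γ : Path x₀ x₀, (∀ t, γ t ∈ U) → γ.Homotopic (Path.refl x₀)) :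
    SimplyConnectedSpace X := by
  have hj : ∀ x, Joined x₀ x := by
    intro x
    obtain ⟨B, -, hxB, -, hBs, hBU⟩ := hU x univ isOpen_univ (mem_univ _)
    obtain ⟨u, hu⟩ := hBU.nonempty
    exact (hc.joinedIn x₀ hx₀ u hu.2).joined.trans
      (hBs.isPathConnected.joinedIn u hu.1 x hxB).joined
  rw [simply_connected_iff_loops_nullhomotopic]
  refine ⟨⟨⟨x₀⟩, fun x y => (hj x).symm.trans (hj y)⟩, fun x γ => ?_⟩
  obtain ⟨β⟩ := hj x
  obtain ⟨q, hqU, hq⟩ := hU.exists_homotopic ((β.trans γ).trans β.symm) hx₀ hx₀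
  have h1 := Path.Homotopic.Quotient.eq.2 (hq.trans (h q hqU))
  rw [← Path.Homotopic.Quotient.eq]
  simp only [Path.Homotopic.Quotient.mk_trans, Path.Homotopic.Quotient.mk_symm,
    Path.Homotopic.Quotient.mk_refl] at h1 ⊢
  set b := Path.Homotopic.Quotient.mk β
  set c := Path.Homotopic.Quotient.mk γ
  calc c = (b.symm.trans ((b.trans c).trans b.symm)).trans b := by
        simp only [Path.Homotopic.Quotient.trans_assoc, Path.Homotopic.Quotient.symm_trans,
          Path.Homotopic.Quotient.trans_refl]
        rw [← Path.Homotopic.Quotient.trans_assoc, Path.Homotopic.Quotient.symm_trans,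
          Path.Homotopic.Quotient.refl_trans]
    _ = _ := by
        rw [h1, Path.Homotopic.Quotient.trans_refl, Path.Homotopic.Quotient.symm_trans]

end Complements

/-! ### The fundamental group of a quotient of a product of coverings -/

section QuotientCoverings

open Filter Set MulOpposite

variable {G : Type*} [Group G]

/-- An open quotient map by a free action of a finite group on a Hausdorff space is a covering. -/
theorem isQuotientCoveringMap_of_isOpenMap {E B : Type*} [TopologicalSpace E] [TopologicalSpace B]
    [T2Space E] [Finite G] [MulAction G E] {f : E → B} (hc : Continuous f) (ho : IsOpenMap f)
    (hs : Function.Surjective f) (hact : ∀ a : G, Continuous fun x : E => a • x)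
    (hfib : ∀ x y, f x = f y ↔ ∃ a : G, a • x = y) (hfree : ∀ (x : E) (a : G), a • x = x → a = 1) :
    IsQuotientCoveringMap f G where
  toIsQuotientMap := ho.isQuotientMap hc hs
  continuous_const_smul := hact
  apply_eq_iff_mem_orbit {x y} := by
    rw [eq_comm, hfib]
    rfl
  disjoint e := by
    have hsep : ∀ a : G, ∃ V : Set E, V ∈ 𝓝 e ∧ (a ≠ 1 → Disjoint ((a • ·) '' V) V) := by
      intro a
      by_cases ha : a = 1
      · exact ⟨univ, univ_mem, fun h => absurd ha h⟩
      · obtain ⟨V₁, V₂, hV₁, hV₂, h₁, h₂, hd⟩ := t2_separation fun h : a • e = e => ha (hfree e a h)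
        refine ⟨(a • ·) ⁻¹' V₁ ∩ V₂, inter_mem ((hact a).continuousAt (hV₁.mem_nhds h₁))
          (hV₂.mem_nhds h₂), fun _ => hd.mono ?_ inter_subset_right⟩
        rintro _ ⟨v, hv, rfl⟩
        exact hv.1
    choose V hV hVd using hsep
    refine ⟨⋂ a, V a, (iInter_mem).2 hV, fun a hne => ?_⟩
    by_contra ha
    obtain ⟨x, ⟨v, hv, rfl⟩, hx⟩ := hne
    exact Set.disjoint_left.1 (hVd a ha) ⟨v, mem_iInter.1 hv a, rfl⟩ (mem_iInter.1 hx a)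

namespace IsQuotientCoveringMap

variable {E B : Type*} [TopologicalSpace E] [TopologicalSpace B] [MulAction G E] {f : E → B}
  (hp : IsQuotientCoveringMap f G) {e : E} {a : G}

/-- The loop in the base that is covered by a path from `e` to a translate of `e`. -/
def loopOfPath (α : Path e (a • e)) : FundamentalGroup B (f e) :=
  FundamentalGroup.fromPath (Path.Homotopic.Quotient.mk
    ((α.map hp.continuous).cast rfl (hp.map_smul a).symm))

theorem exists_loopOfPath (b : FundamentalGroup B (f e)) :
    ∃ (a : G) (α : Path e (a • e)), hp.loopOfPath α = b := by
  obtain ⟨γ, rfl⟩ := Path.Homotopic.Quotient.mk_surjective b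
  let L := hp.isCoveringMap.liftPath (γ : C(unitInterval, B)) e γ.source
  have hL : ∀ t, f (L t) = γ t := fun t =>
    congrFun (hp.isCoveringMap.liftPath_lifts (γ : C(unitInterval, B)) e γ.source) t
  have h1 : f (L 1) = f e := by rw [hL]; exact γ.target
  obtain ⟨a, ha⟩ := hp.apply_eq_iff_mem_orbit.1 h1
  refine ⟨a, ⟨L, hp.isCoveringMap.liftPath_zero (γ : C(unitInterval, B)) e γ.source, ha.symm⟩, ?_⟩
  change Path.Homotopic.Quotient.mk _ = _
  congr 1
  ext t
  exact hL t

theorem fundamentalGroupToMulOpposite_loopOfPath (α : Path e (a • e)) :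
    hp.fundamentalGroupToMulOpposite (⟨e, rfl⟩ : f ⁻¹' {f e}) (hp.loopOfPath α) = op a := by
  rw [fundamentalGroupToMulOpposite_apply_eq_Iff]
  have := hp.isCoveringMap.monodromy_eq_of_map_eq (x := f e) (y := f e)
    (γ := Path.Homotopic.Quotient.mk ((α.map hp.continuous).cast rfl (hp.map_smul a).symm))
    (ex := ⟨e, rfl⟩) (ey := ⟨a • e, hp.map_smul a⟩) (Path.Homotopic.Quotient.mk α) rfl
  exact (congrArg Subtype.val this).symm

theorem homotopic_of_loopOfPath_eq {α β : Path e (a • e)}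
    (h : hp.loopOfPath α = hp.loopOfPath β) : α.Homotopic β := by
  have h1 : ((α.map hp.continuous).cast rfl (hp.map_smul a).symm).Homotopic
      ((β.map hp.continuous).cast rfl (hp.map_smul a).symm) := Path.Homotopic.Quotient.eq.1 h
  have h2 := h1.pathCast (x₂ := f e) (x₃ := f (a • e)) rfl (hp.map_smul a)
  rw [← Path.Homotopic.Quotient.eq]
  apply hp.isCoveringMap.injective_path_homotopic_map
  exact Path.Homotopic.Quotient.eq.2 h2

theorem loopOfPath_eq_of_homotopic {α β : Path e (a • e)} (h : α.Homotopic β) :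
    hp.loopOfPath α = hp.loopOfPath β :=
  Path.Homotopic.Quotient.eq.2 ((h.map ⟨f, hp.continuous⟩).pathCast rfl (hp.map_smul a).symm)

end IsQuotientCoveringMap

variable {E₁ E₂ B₁ B₂ Y : Type*} [TopologicalSpace E₁] [TopologicalSpace E₂] [TopologicalSpace B₁]
  [TopologicalSpace B₂] [TopologicalSpace Y] [MulAction G E₁] [MulAction G E₂]
  {f₁ : E₁ → B₁} {f₂ : E₂ → B₂} {σ : E₁ × E₂ → Y}
  {e₁ : E₁} {e₂ : E₂}

theorem mapOfEq_fst_loopOfPath (h₁ : IsQuotientCoveringMap f₁ G)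
    (hσ : IsQuotientCoveringMap σ G) (Q₁ : C(Y, B₁)) (hQ₁ : ∀ c, Q₁ (σ c) = f₁ c.1) {a : G}
    (α : Path (e₁, e₂) (a • (e₁, e₂))) :
    FundamentalGroup.mapOfEq Q₁ (hQ₁ (e₁, e₂)) (hσ.loopOfPath α) =
      h₁.loopOfPath (α.map continuous_fst : Path e₁ (a • e₁)) := by
  rw [FundamentalGroup.mapOfEq_apply]
  change Path.Homotopic.Quotient.mk _ = Path.Homotopic.Quotient.mk _
  congr 1
  ext t
  exact hQ₁ _

theorem mapOfEq_snd_loopOfPath (h₂ : IsQuotientCoveringMap f₂ G)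
    (hσ : IsQuotientCoveringMap σ G) (Q₂ : C(Y, B₂)) (hQ₂ : ∀ c, Q₂ (σ c) = f₂ c.2) {a : G}
    (α : Path (e₁, e₂) (a • (e₁, e₂))) :
    FundamentalGroup.mapOfEq Q₂ (hQ₂ (e₁, e₂)) (hσ.loopOfPath α) =
      h₂.loopOfPath (α.map continuous_snd : Path e₂ (a • e₂)) := by
  rw [FundamentalGroup.mapOfEq_apply]
  change Path.Homotopic.Quotient.mk _ = Path.Homotopic.Quotient.mk _
  congr 1
  ext t
  exact hQ₂ _

/-- A loop in the quotient of `E₁ × E₂` by the diagonal action is determined by its images in the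
bases of the two factors. -/
theorem eq_of_mapOfEq_eq (h₁ : IsQuotientCoveringMap f₁ G)
    (h₂ : IsQuotientCoveringMap f₂ G) (hσ : IsQuotientCoveringMap σ G)
    (Q₁ : C(Y, B₁)) (Q₂ : C(Y, B₂))
    (hQ₁ : ∀ c, Q₁ (σ c) = f₁ c.1) (hQ₂ : ∀ c, Q₂ (σ c) = f₂ c.2)
    {a b : FundamentalGroup Y (σ (e₁, e₂))}
    (hab₁ : FundamentalGroup.mapOfEq Q₁ (hQ₁ (e₁, e₂)) a =
      FundamentalGroup.mapOfEq Q₁ (hQ₁ (e₁, e₂)) b)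
    (hab₂ : FundamentalGroup.mapOfEq Q₂ (hQ₂ (e₁, e₂)) a =
      FundamentalGroup.mapOfEq Q₂ (hQ₂ (e₁, e₂)) b) : a = b := by
  obtain ⟨x, α, rfl⟩ := hσ.exists_loopOfPath a
  obtain ⟨y, β, rfl⟩ := hσ.exists_loopOfPath b
  rw [mapOfEq_fst_loopOfPath h₁ hσ Q₁ hQ₁, mapOfEq_fst_loopOfPath h₁ hσ Q₁ hQ₁] at hab₁
  rw [mapOfEq_snd_loopOfPath h₂ hσ Q₂ hQ₂, mapOfEq_snd_loopOfPath h₂ hσ Q₂ hQ₂] at hab₂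
  have hxy : x = y := by
    have := congrArg (h₁.fundamentalGroupToMulOpposite (⟨e₁, rfl⟩ : f₁ ⁻¹' {f₁ e₁})) hab₁
    rw [h₁.fundamentalGroupToMulOpposite_loopOfPath,
      h₁.fundamentalGroupToMulOpposite_loopOfPath] at this
    exact op_injective this
  subst hxy
  obtain ⟨H₁⟩ := h₁.homotopic_of_loopOfPath_eq hab₁
  obtain ⟨H₂⟩ := h₂.homotopic_of_loopOfPath_eq hab₂
  exact hσ.loopOfPath_eq_of_homotopic ⟨Path.Homotopic.prodHomotopy H₁ H₂⟩

/-- Two loops in the bases with the same monodromy come from a loop in the quotient of `E₁ × E₂`. -/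
theorem exists_mapOfEq_eq (h₁ : IsQuotientCoveringMap f₁ G)
    (h₂ : IsQuotientCoveringMap f₂ G) (hσ : IsQuotientCoveringMap σ G)
    (Q₁ : C(Y, B₁)) (Q₂ : C(Y, B₂))
    (hQ₁ : ∀ c, Q₁ (σ c) = f₁ c.1) (hQ₂ : ∀ c, Q₂ (σ c) = f₂ c.2)
    (b₁ : FundamentalGroup B₁ (f₁ e₁)) (b₂ : FundamentalGroup B₂ (f₂ e₂))
    (hb : h₁.fundamentalGroupToMulOpposite (⟨e₁, rfl⟩ : f₁ ⁻¹' {f₁ e₁}) b₁ =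
      h₂.fundamentalGroupToMulOpposite (⟨e₂, rfl⟩ : f₂ ⁻¹' {f₂ e₂}) b₂) :
    ∃ a : FundamentalGroup Y (σ (e₁, e₂)),
      FundamentalGroup.mapOfEq Q₁ (hQ₁ (e₁, e₂)) a = b₁ ∧
      FundamentalGroup.mapOfEq Q₂ (hQ₂ (e₁, e₂)) a = b₂ := by
  obtain ⟨x, α, rfl⟩ := h₁.exists_loopOfPath b₁
  obtain ⟨y, β, rfl⟩ := h₂.exists_loopOfPath b₂
  rw [h₁.fundamentalGroupToMulOpposite_loopOfPath,
    h₂.fundamentalGroupToMulOpposite_loopOfPath] at hb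
  obtain rfl := op_injective hb
  let α' : Path (e₁, e₂) (x • (e₁, e₂)) := α.prod β
  refine ⟨hσ.loopOfPath α', ?_, ?_⟩
  · rw [mapOfEq_fst_loopOfPath h₁ hσ Q₁ hQ₁]
    rfl
  · rw [mapOfEq_snd_loopOfPath h₂ hσ Q₂ hQ₂]
    rfl

theorem same_monodromy_of_mapOfEq (h₁ : IsQuotientCoveringMap f₁ G)
    (h₂ : IsQuotientCoveringMap f₂ G) (hσ : IsQuotientCoveringMap σ G)
    (Q₁ : C(Y, B₁)) (Q₂ : C(Y, B₂))
    (hQ₁ : ∀ c, Q₁ (σ c) = f₁ c.1) (hQ₂ : ∀ c, Q₂ (σ c) = f₂ c.2)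
    (a : FundamentalGroup Y (σ (e₁, e₂))) :
    h₁.fundamentalGroupToMulOpposite (⟨e₁, rfl⟩ : f₁ ⁻¹' {f₁ e₁})
        (FundamentalGroup.mapOfEq Q₁ (hQ₁ (e₁, e₂)) a) =
      h₂.fundamentalGroupToMulOpposite (⟨e₂, rfl⟩ : f₂ ⁻¹' {f₂ e₂})
        (FundamentalGroup.mapOfEq Q₂ (hQ₂ (e₁, e₂)) a) := by
  obtain ⟨x, α, rfl⟩ := hσ.exists_loopOfPath a
  rw [mapOfEq_fst_loopOfPath h₁ hσ Q₁ hQ₁, mapOfEq_snd_loopOfPath h₂ hσ Q₂ hQ₂,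
    h₁.fundamentalGroupToMulOpposite_loopOfPath, h₂.fundamentalGroupToMulOpposite_loopOfPath]

/-- The fundamental group of `(E₁ × E₂) / G` is the fibre product over `G` of those of `E₁ / G` and
`E₂ / G`. If the latter are generated by loops with monodromy `g`, and `g` extends a good
presentation, then a normal subgroup is everything as soon as it contains the pairs of conjugates of
powers of these loops. -/
theorem normalSubgroup_eq_top_of_extendsGoodPresentation [Finite G] {r : ℕ} {g : Fin r → G}
    (hgood : ExtendsGoodPresentation g) (h₁ : IsQuotientCoveringMap f₁ G)
    (h₂ : IsQuotientCoveringMap f₂ G) (hσ : IsQuotientCoveringMap σ G)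
    (Q₁ : C(Y, B₁)) (Q₂ : C(Y, B₂))
    (hQ₁ : ∀ c, Q₁ (σ c) = f₁ c.1) (hQ₂ : ∀ c, Q₂ (σ c) = f₂ c.2)
    (w₁ : FreeGroup (Fin r) →* (FundamentalGroup B₁ (f₁ e₁))ᵐᵒᵖ)
    (w₂ : FreeGroup (Fin r) →* (FundamentalGroup B₂ (f₂ e₂))ᵐᵒᵖ)
    (hw₁ : Function.Surjective w₁) (hw₂ : Function.Surjective w₂)
    (hm₁ : ∀ w, h₁.fundamentalGroupToMulOpposite (⟨e₁, rfl⟩ : f₁ ⁻¹' {f₁ e₁}) (unop (w₁ w)) =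
      op (FreeGroup.lift g w))
    (hm₂ : ∀ w, h₂.fundamentalGroupToMulOpposite (⟨e₂, rfl⟩ : f₂ ⁻¹' {f₂ e₂}) (unop (w₂ w)) =
      op (FreeGroup.lift g w))
    (hprod : w₂ (List.ofFn fun i => FreeGroup.of i).prod = 1)
    (N : Subgroup (FundamentalGroup Y (σ (e₁, e₂)))) [hN : N.Normal]
    (htors : ∀ (u v : FreeGroup (Fin r)) (i j : Fin r) (e f : ℕ),
      FreeGroup.lift g (u * FreeGroup.of i ^ e * u⁻¹) =
        FreeGroup.lift g (v * FreeGroup.of j ^ f * v⁻¹) →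
      ∃ a ∈ N, FundamentalGroup.mapOfEq Q₁ (hQ₁ (e₁, e₂)) a =
          unop (w₁ (u * FreeGroup.of i ^ e * u⁻¹)) ∧
        FundamentalGroup.mapOfEq Q₂ (hQ₂ (e₁, e₂)) a =
          unop (w₂ (v * FreeGroup.of j ^ f * v⁻¹))) : N = ⊤ := by
  -- the pairs of words that are represented by an element of `N`
  let K : Subgroup (FreeGroup (Fin r) × FreeGroup (Fin r)) :=
    { carrier := {v | ∃ a ∈ N, FundamentalGroup.mapOfEq Q₁ (hQ₁ (e₁, e₂)) a = unop (w₁ v.1) ∧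
        FundamentalGroup.mapOfEq Q₂ (hQ₂ (e₁, e₂)) a = unop (w₂ v.2)}
      one_mem' := ⟨1, one_mem N, by rw [map_one, Prod.fst_one, map_one, unop_one],
        by rw [map_one, Prod.snd_one, map_one, unop_one]⟩
      mul_mem' := by
        rintro v v' ⟨a, ha, ha₁, ha₂⟩ ⟨b, hb, hb₁, hb₂⟩
        exact ⟨b * a, mul_mem hb ha, by
          rw [map_mul, ha₁, hb₁, Prod.fst_mul, map_mul, unop_mul], by
          rw [map_mul, ha₂, hb₂, Prod.snd_mul, map_mul, unop_mul]⟩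
      inv_mem' := by
        rintro v ⟨a, ha, ha₁, ha₂⟩
        exact ⟨a⁻¹, inv_mem ha, by rw [map_inv, ha₁, Prod.fst_inv, map_inv, unop_inv],
          by rw [map_inv, ha₂, Prod.snd_inv, map_inv, unop_inv]⟩ }
  have hK := mem_of_lift_eq_lift g hgood K ?_ ⟨1, one_mem N, by rw [map_one, map_one, unop_one],
    by rw [map_one, hprod, unop_one]⟩ htors
  · rw [Subgroup.eq_top_iff']
    intro a
    obtain ⟨v₁, hv₁⟩ := hw₁ (op (FundamentalGroup.mapOfEq Q₁ (hQ₁ (e₁, e₂)) a))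
    obtain ⟨v₂, hv₂⟩ := hw₂ (op (FundamentalGroup.mapOfEq Q₂ (hQ₂ (e₁, e₂)) a))
    obtain ⟨b, hb, hb₁, hb₂⟩ := hK (v₁, v₂) (by
      have := same_monodromy_of_mapOfEq h₁ h₂ hσ Q₁ Q₂ hQ₁ hQ₂ a
      rw [← MulOpposite.unop_op (FundamentalGroup.mapOfEq Q₁ _ a), ← hv₁, hm₁,
        ← MulOpposite.unop_op (FundamentalGroup.mapOfEq Q₂ _ a), ← hv₂, hm₂] at this
      exact op_injective this)
    rw [eq_of_mapOfEq_eq h₁ h₂ hσ Q₁ Q₂ hQ₁ hQ₂ (a := a) (b := b)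
      (by rw [hb₁, hv₁, MulOpposite.unop_op])
      (by rw [hb₂, hv₂, MulOpposite.unop_op])]
    exact hb
  · rintro v hv k ⟨b, hb, hb₁, hb₂⟩
    obtain ⟨c, hc₁, hc₂⟩ := exists_mapOfEq_eq h₁ h₂ hσ Q₁ Q₂ hQ₁ hQ₂ (unop (w₁ v.1))
      (unop (w₂ v.2)) (by rw [hm₁, hm₂, hv])
    refine ⟨c⁻¹ * b * c, by simpa using hN.conj_mem b hb c⁻¹, ?_, ?_⟩
    · rw [map_mul, map_mul, map_inv, hc₁, hb₁, Prod.fst_mul, Prod.fst_mul, Prod.fst_inv, map_mul,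
        map_mul, map_inv, unop_mul, unop_mul, unop_inv, mul_assoc]
    · rw [map_mul, map_mul, map_inv, hc₂, hb₂, Prod.snd_mul, Prod.snd_mul, Prod.snd_inv, map_mul,
        map_mul, map_inv, unop_mul, unop_mul, unop_inv, mul_assoc]

end QuotientCoverings

/-! ### Branched Galois covers of the sphere -/

section BranchedCovers

open Filter Set MulOpposite

variable {G : Type*} [Group G] {r : ℕ}

/-- A Galois cover of the sphere with its monodromy, as in `HasMonodromy`, where the base point of
the loops is taken to be the image of a point `c₀` of the covering curve. -/
structure BranchedCover (g : Fin r → G) (C : Type*) [TopologicalSpace C] [ChartedSpace ℂ C]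
    [MulAction G C] where
  f : C → OnePoint ℂ
  p : Fin r → OnePoint ℂ
  c₀ : C
  c₀_mem : f c₀ ∉ range p
  γ : Fin r → Path (⟨f c₀, c₀_mem⟩ : PuncturedSphere p) ⟨f c₀, c₀_mem⟩
  holo : ContMDiff 𝓘(ℂ) 𝓘(ℂ) ω f
  surj : Function.Surjective f
  fib : ∀ x y : C, f x = f y ↔ ∃ a : G, a • x = y
  free : ∀ x : C, f x ∉ range p → MulAction.stabilizer G x = ⊥
  loops : IsStandardLoopSystem p ⟨f c₀, c₀_mem⟩ γ
  lifts : ∀ i, ∃ l : Path c₀ (g i • c₀), ∀ t, f (l t) = γ i t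

theorem HasMonodromy.nonempty_branchedCover {g : Fin r → G} {C : Type*} [TopologicalSpace C]
    [ChartedSpace ℂ C] [MulAction G C] (h : HasMonodromy g C) : Nonempty (BranchedCover g C) := by
  obtain ⟨f, p, ⟨x₀, hx₀⟩, γ, c₀, holo, surj, fib, -, free, loops, h₀, lifts⟩ := h
  obtain rfl : f c₀ = x₀ := h₀
  exact ⟨⟨f, p, c₀, hx₀, γ, holo, surj, fib, free, loops, lifts⟩⟩

/-- The quotient map of a compact space by a finite group is open. -/
theorem isOpenMap_of_fiber_eq_orbit {C S : Type*} [TopologicalSpace C] [CompactSpace C]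
    [TopologicalSpace S] [T2Space S] [MulAction G C] {f : C → S} (hf : Continuous f)
    (hs : Function.Surjective f) (hact : ∀ a : G, Continuous fun x : C => a • x)
    (hfib : ∀ x y, f x = f y ↔ ∃ a : G, a • x = y) : IsOpenMap f := by
  intro O hO
  rw [← (hf.isClosedMap.isQuotientMap hf hs).isOpen_preimage]
  have : f ⁻¹' (f '' O) = ⋃ a : G, (fun x : C => a • x) ⁻¹' O := by
    ext x
    simp only [mem_preimage, mem_image, mem_iUnion]
    constructor
    · rintro ⟨y, hy, hyx⟩
      obtain ⟨a, ha⟩ := (hfib x y).1 hyx.symm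
      exact ⟨a, ha ▸ hy⟩
    · rintro ⟨a, ha⟩
      exact ⟨a • x, ha, ((hfib x (a • x)).2 ⟨a, rfl⟩).symm⟩
  rw [this]
  exact isOpen_iUnion fun a => hO.preimage (hact a)

/-- A finite subset of a Riemann surface is locally the zero set of a holomorphic function. -/
theorem exists_local_equation_of_finite {S : Type*} [TopologicalSpace S] [T1Space S]
    [ChartedSpace ℂ S] [IsManifold 𝓘(ℂ) ω S] {F : Set S} (hF : F.Finite) (z : S) :
    ∃ (V : Set S) (Y : S → ℂ), IsOpen V ∧ z ∈ V ∧ ContMDiffOn 𝓘(ℂ) 𝓘(ℂ) ω Y V ∧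
      ∀ w ∈ V, w ∉ F ↔ Y w ≠ 0 := by
  by_cases hz : z ∈ F
  · set χ := chartAt ℂ z with hχ
    have hsource : z ∈ χ.source := mem_chart_source ℂ _
    refine ⟨χ.source ∩ (F \ {z})ᶜ, fun w => χ w - χ z,
      χ.open_source.inter hF.sdiff.isClosed.isOpen_compl, ⟨hsource, fun h => h.2 rfl⟩, ?_, ?_⟩
    · have h1 : ContMDiffOn 𝓘(ℂ) 𝓘(ℂ) ω χ χ.source := contMDiffOn_chart
      exact (h1.mono inter_subset_left).sub contMDiffOn_const
    · rintro w ⟨hw1, hw2⟩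
      rw [sub_ne_zero, Ne, χ.injOn.eq_iff hw1 hsource]
      refine not_congr ⟨fun h => ?_, fun h => h ▸ hz⟩
      by_contra hne
      exact hw2 ⟨h, hne⟩
  · exact ⟨Fᶜ, fun _ => 1, hF.isClosed.isOpen_compl, hz, contMDiffOn_const,
      fun w hw => iff_of_true hw one_ne_zero⟩

namespace BranchedCover

variable {g : Fin r → G} {C : Type*} [TopologicalSpace C] [ChartedSpace ℂ C] [MulAction G C]
  (D : BranchedCover g C)

theorem f_smul (a : G) (x : C) : D.f (a • x) = D.f x := ((D.fib x (a • x)).2 ⟨a, rfl⟩).symm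

/-- The part of the curve over the punctured sphere. -/
def U : SubMulAction G C where
  carrier := {c | D.f c ∉ range D.p}
  smul_mem' a x hx := by simpa only [mem_ofPred_eq, D.f_smul] using hx

theorem mem_U {c : C} : c ∈ D.U ↔ D.f c ∉ range D.p := Iff.rfl

/-- The unramified part of the cover. -/
def fU (c : D.U) : PuncturedSphere D.p := ⟨D.f c, c.2⟩

/-- The base point of the unramified part of the curve. -/
def base : D.U := ⟨D.c₀, D.c₀_mem⟩

theorem isOpen_U : IsOpen (D.U : Set C) :=
  (finite_range D.p).isClosed.isOpen_compl.preimage D.holo.continuous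

theorem isOpenMap_f [CompactSpace C] (hact : ∀ a : G, ContMDiff 𝓘(ℂ) 𝓘(ℂ) ω fun x : C => a • x) :
    IsOpenMap D.f :=
  isOpenMap_of_fiber_eq_orbit D.holo.continuous D.surj (fun a => (hact a).continuous) D.fib

theorem smul_eq_self {x : C} (hx : x ∈ D.U) {a : G} (ha : a • x = x) : a = 1 := by
  have : a ∈ MulAction.stabilizer G x := ha
  rwa [D.free x hx, Subgroup.mem_bot] at this

theorem isQuotientCoveringMap [Finite G] [CompactSpace C] [T2Space C]
    (hact : ∀ a : G, ContMDiff 𝓘(ℂ) 𝓘(ℂ) ω fun x : C => a • x) :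
    IsQuotientCoveringMap D.fU G := by
  refine isQuotientCoveringMap_of_isOpenMap ?_ ?_ ?_ (fun a => ?_) ?_ ?_
  · exact (D.holo.continuous.comp continuous_subtype_val).subtype_mk _
  · exact (D.isOpenMap_f hact).restrictPreimage (range D.p)ᶜ
  · rintro ⟨z, hz⟩
    obtain ⟨c, rfl⟩ := D.surj z
    exact ⟨⟨c, hz⟩, rfl⟩
  · exact ((hact a).continuous.comp continuous_subtype_val).subtype_mk _
  · intro x y
    rw [Subtype.ext_iff]
    refine (D.fib x y).trans (exists_congr fun a => ?_)
    rw [Subtype.ext_iff]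
    rfl
  · intro x a ha
    exact D.smul_eq_self x.2 (congrArg Subtype.val ha)

theorem dense_U [CompactSpace C] (hact : ∀ a : G, ContMDiff 𝓘(ℂ) 𝓘(ℂ) ω fun x : C => a • x) :
    Dense (D.U : Set C) := by
  have : Dense ((range D.p)ᶜ) := by
    rw [compl_eq_univ_sdiff]
    exact dense_univ.sdiff_finite (finite_range D.p)
  exact this.preimage (D.isOpenMap_f hact)


/-- Near every point the ramified part of the cover is the zero set of a holomorphic function. -/
theorem exists_local_equation (x : C) : ∃ (W : Set C) (Φ : C → ℂ),
    IsOpen W ∧ x ∈ W ∧ MDifferentiableOn 𝓘(ℂ) 𝓘(ℂ) Φ W ∧ ∀ y ∈ W, y ∈ D.U ↔ Φ y ≠ 0 := by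
  obtain ⟨V, Y, hV, hxV, hY, hYV⟩ := exists_local_equation_of_finite (finite_range D.p) (D.f x)
  exact ⟨D.f ⁻¹' V, fun y => Y (D.f y), hV.preimage D.holo.continuous, hxV,
    (hY.mdifferentiableOn (by simp)).comp (D.holo.mdifferentiable (by simp)).mdifferentiableOn
      fun y hy => hy, fun y hy => hYV _ hy⟩

theorem isPathConnected_U [IsManifold 𝓘(ℂ) ω C] [CompactSpace C] [ConnectedSpace C]
    (hact : ∀ a : G, ContMDiff 𝓘(ℂ) 𝓘(ℂ) ω fun x : C => a • x) :
    IsPathConnected (D.U : Set C) :=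
  (hasNiceBasis_of_ne_zero (D.dense_U hact) D.exists_local_equation).isPathConnected

/-- The homotopy class of the loop that corresponds to a word in the standard loops. -/
noncomputable def word : FreeGroup (Fin r) →* (FundamentalGroup (PuncturedSphere D.p)
    (D.fU D.base))ᵐᵒᵖ :=
  FreeGroup.lift fun i => op (FundamentalGroup.fromPath (Path.Homotopic.Quotient.mk (D.γ i)))

theorem word_of (i : Fin r) : D.word (FreeGroup.of i) =
    op (FundamentalGroup.fromPath (Path.Homotopic.Quotient.mk (D.γ i))) :=
  FreeGroup.lift_apply_of

theorem unop_word_mul (u v : FreeGroup (Fin r)) : unop (D.word (u * v)) =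
    Path.Homotopic.Quotient.trans (unop (D.word u)) (unop (D.word v)) := by
  rw [map_mul, unop_mul, FundamentalGroup.mul_def]

theorem word_surjective : Function.Surjective D.word := by
  rw [← MonoidHom.range_eq_top]
  have h : (⊤ : Subgroup (FundamentalGroup (PuncturedSphere D.p) (D.fU D.base))) ≤
      D.word.range.unop := by
    refine D.loops.generates.symm.le.trans ((Subgroup.closure_le _).2 ?_)
    rintro _ ⟨i, rfl⟩
    exact ⟨FreeGroup.of i, D.word_of i⟩
  rw [Subgroup.eq_top_iff']
  intro x
  exact h (Subgroup.mem_top (unop x))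

theorem word_prod : D.word (List.ofFn fun i => FreeGroup.of i).prod = 1 := by
  have key : ∀ l : List (Fin r), unop (D.word (l.map FreeGroup.of).prod) =
      Path.Homotopic.Quotient.mk ((l.map D.γ).foldr Path.trans (Path.refl _)) := by
    intro l
    induction l with
    | nil => rw [List.map_nil, List.prod_nil, map_one]; rfl
    | cons i l ih =>
      rw [List.map_cons, List.prod_cons, unop_word_mul, ih, word_of]
      rfl
  have h := key (List.finRange r)
  rw [← List.ofFn_eq_map, ← List.ofFn_eq_map] at h
  apply unop_injective
  rw [h]
  exact Path.Homotopic.Quotient.eq.2 D.loops.prod_eq_one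

theorem monodromy_word (h : IsQuotientCoveringMap D.fU G) (w : FreeGroup (Fin r)) :
    h.fundamentalGroupToMulOpposite (⟨D.base, rfl⟩ : D.fU ⁻¹' {D.fU D.base}) (unop (D.word w)) =
      op (FreeGroup.lift g w) := by
  induction w using FreeGroup.induction_on with
  | C1 => rw [map_one, unop_one, map_one, map_one, op_one]
  | of i =>
    obtain ⟨l, hl⟩ := D.lifts i
    have hmem : ∀ t, l t ∈ D.U := fun t => by
      rw [D.mem_U, hl]
      exact (D.γ i t).2
    let l' : Path D.base (g i • D.base) :=
      { toFun := fun t => ⟨l t, hmem t⟩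
        continuous_toFun := l.continuous.subtype_mk _
        source' := Subtype.ext l.source
        target' := Subtype.ext l.target }
    have : unop (D.word (FreeGroup.of i)) = h.loopOfPath l' := by
      rw [word_of]
      change Path.Homotopic.Quotient.mk _ = Path.Homotopic.Quotient.mk _
      congr 1
      ext t
      exact (hl t).symm
    rw [this, h.fundamentalGroupToMulOpposite_loopOfPath, FreeGroup.lift_apply_of]
  | inv_of i ih => rw [map_inv, unop_inv, map_inv, ih, map_inv, op_inv]
  | mul x y hx hy => rw [map_mul, unop_mul, map_mul, hx, hy, map_mul, op_mul]

end BranchedCover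
end BranchedCovers

/-! ### Lifting punctured discs to a branched cover -/

section DiscLifts

open Filter Set Metric MulOpposite

/-- A continuous lift of a holomorphic map through a locally injective holomorphic map is
holomorphic. -/
theorem mdifferentiableAt_of_injOn {C S : Type*} [TopologicalSpace C] [ChartedSpace ℂ C]
    [IsManifold 𝓘(ℂ) ω C] [TopologicalSpace S] [ChartedSpace ℂ S] [IsManifold 𝓘(ℂ) ω S]
    {f : C → S} {O : Set C} (hO : IsOpen O) (hf : MDifferentiableOn 𝓘(ℂ) 𝓘(ℂ) f O)
    (hinj : InjOn f O) {L : ℂ → C} {s : ℂ} (hL : ContinuousAt L s) (hs : L s ∈ O)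
    (hfL : MDifferentiableAt 𝓘(ℂ) 𝓘(ℂ) (fun t => f (L t)) s) :
    MDifferentiableAt 𝓘(ℂ) 𝓘(ℂ) L s := by
  set c := chartAt ℂ (L s) with hc
  set χ := chartAt ℂ (f (L s)) with hχ
  have hO' : IsOpen (O ∩ f ⁻¹' χ.source) := hf.continuousOn.isOpen_inter_preimage hO χ.open_source
  have hcs : L s ∈ c.source := mem_chart_source ℂ _
  have hχs : f (L s) ∈ χ.source := mem_chart_source ℂ _
  set A := c.target ∩ c.symm ⁻¹' (O ∩ f ⁻¹' χ.source) with hA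
  have hAo : IsOpen A := c.symm.isOpen_inter_preimage hO'
  have hcsymm : MDifferentiableOn 𝓘(ℂ) 𝓘(ℂ) c.symm c.target :=
    (contMDiffOn_chart_symm (I := 𝓘(ℂ)) (n := ω) (x := L s)).mdifferentiableOn (by simp)
  have hχd : MDifferentiableOn 𝓘(ℂ) 𝓘(ℂ) χ χ.source :=
    (contMDiffOn_chart (I := 𝓘(ℂ)) (n := ω) (x := f (L s))).mdifferentiableOn (by simp)
  have hd : DifferentiableOn ℂ (fun z => χ (f (c.symm z))) A := by
    rw [← mdifferentiableOn_iff_differentiableOn]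
    exact hχd.comp (hf.comp (hcsymm.mono fun z hz => hz.1) fun z hz => hz.2.1) fun z hz => hz.2.2
  obtain ⟨hko, k, hk, hkinv⟩ := exists_holomorphic_inverse hAo hd (by
    intro z hz w hw hzw
    exact c.symm.injOn hz.1 hw.1 (hinj hz.2.1 hw.2.1 (χ.injOn hz.2.2 hw.2.2 hzw)))
  have hmem : c (L s) ∈ A := ⟨c.map_source hcs, by
    rw [mem_preimage, c.left_inv hcs]; exact ⟨hs, hχs⟩⟩
  have heq : ∀ᶠ t in 𝓝 s, L t = c.symm (k (χ (f (L t)))) := by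
    filter_upwards [hL ((c.open_source.inter hO').mem_nhds ⟨hcs, hs, hχs⟩)] with t ht
    have h1 : c (L t) ∈ A := ⟨c.map_source ht.1, by
      rw [mem_preimage, c.left_inv ht.1]; exact ht.2⟩
    have h2 := hkinv _ h1
    rw [c.left_inv ht.1] at h2
    rw [h2, c.left_inv ht.1]
  have hks : k (χ (f (L s))) = c (L s) := by
    have h2 := hkinv _ hmem
    rwa [c.left_inv hcs] at h2
  have hkd : MDifferentiableAt 𝓘(ℂ) 𝓘(ℂ) k (χ (f (L s))) := by
    rw [mdifferentiableAt_iff_differentiableAt]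
    refine hk.differentiableAt (hko.mem_nhds ⟨c (L s), hmem, ?_⟩)
    simp only [c.left_inv hcs]
  have h3 : MDifferentiableAt 𝓘(ℂ) 𝓘(ℂ) (fun t => k (χ (f (L t)))) s :=
    hkd.comp s ((hχd.mdifferentiableAt (χ.open_source.mem_nhds hχs)).comp s hfL)
  have h4 : MDifferentiableAt 𝓘(ℂ) 𝓘(ℂ) c.symm (k (χ (f (L s)))) := by
    rw [hks]
    exact hcsymm.mdifferentiableAt (c.open_target.mem_nhds (c.map_source hcs))
  exact (h4.comp s h3).congr_of_eventuallyEq heq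

/-- The inverse of a holomorphic disc is a local coordinate at its centre. -/
theorem exists_coordinate_of_disc {S : Type*} [TopologicalSpace S] [ChartedSpace ℂ S]
    [IsManifold 𝓘(ℂ) ω S] {ψ : ℂ → S} {R : ℝ} (hR : 0 < R)
    (hψ : MDifferentiableOn 𝓘(ℂ) 𝓘(ℂ) ψ (ball 0 R)) (hinj : InjOn ψ (ball 0 R)) :
    ∃ (V : Set S) (X : S → ℂ) (ρ : ℝ), IsOpen V ∧ ContMDiffOn 𝓘(ℂ) 𝓘(ℂ) ω X V ∧ InjOn X V ∧
      0 < ρ ∧ ∀ z ∈ ball 0 ρ, ψ z ∈ V ∧ X (ψ z) = z := by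
  set χ := chartAt ℂ (ψ 0) with hχ
  have hχs : ψ 0 ∈ χ.source := mem_chart_source ℂ _
  have hχd : MDifferentiableOn 𝓘(ℂ) 𝓘(ℂ) χ χ.source :=
    (contMDiffOn_chart (I := 𝓘(ℂ)) (n := ω) (x := ψ 0)).mdifferentiableOn (by simp)
  obtain ⟨ρ, hρ, hball⟩ := Metric.isOpen_iff.1
    (hψ.continuousOn.isOpen_inter_preimage isOpen_ball χ.open_source) 0 ⟨mem_ball_self hR, hχs⟩
  have hd : DifferentiableOn ℂ (fun z => χ (ψ z)) (ball 0 ρ) := by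
    rw [← mdifferentiableOn_iff_differentiableOn]
    exact hχd.comp (hψ.mono fun z hz => (hball hz).1) fun z hz => (hball hz).2
  obtain ⟨hko, k, hk, hkinv⟩ := exists_holomorphic_inverse isOpen_ball hd
    fun z hz w hw hzw => hinj (hball hz).1 (hball hw).1 (χ.injOn (hball hz).2 (hball hw).2 hzw)
  refine ⟨χ.source ∩ χ ⁻¹' ((fun z => χ (ψ z)) '' ball 0 ρ), fun x => k (χ x), ρ,
    χ.isOpen_inter_preimage hko, ?_, ?_, hρ, fun z hz => ⟨⟨(hball hz).2, z, hz, rfl⟩, hkinv z hz⟩⟩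
  · have h1 : ContMDiffOn 𝓘(ℂ) 𝓘(ℂ) ω χ χ.source := contMDiffOn_chart
    exact (hk.contDiffOn hko).contMDiffOn.comp (h1.mono fun x hx => hx.1) fun x hx => hx.2
  · rintro x ⟨hx, z, hz, hzx⟩ y ⟨hy, w, hw, hwy⟩ hxy
    simp only at hzx hwy hxy
    rw [← hzx, ← hwy, hkinv z hz, hkinv w hw] at hxy
    exact χ.injOn hx hy (by rw [← hzx, ← hwy, hxy])

theorem apply_add_natCast_mul_period {X : Type*} {E : ℂ → X}
    (hE : ∀ s, E (s + 2 * Real.pi * Complex.I) = E s) (n : ℕ) (s : ℂ) :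
    E (s + n * (2 * Real.pi * Complex.I)) = E s := by
  induction n with
  | zero => simp
  | succ n ih =>
    rw [← ih, ← hE (s + n * (2 * Real.pi * Complex.I))]
    congr 1
    push_cast
    ring

/-- The loop over `n` periods of a map with period `2 π i`. -/
noncomputable def periodLoop {X : Type*} [TopologicalSpace X] (E : C(ℂ, X))
    (hE : ∀ s, E (s + 2 * Real.pi * Complex.I) = E s) (n : ℕ) : Path (E 0) (E 0) where
  toFun t := E (n * (2 * Real.pi * Complex.I * (t : ℝ)))
  continuous_toFun := by fun_prop
  source' := by simp
  target' := by simpa using apply_add_natCast_mul_period hE n 0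

theorem periodLoop_succ {X : Type*} [TopologicalSpace X] (E : C(ℂ, X))
    (hE : ∀ s, E (s + 2 * Real.pi * Complex.I) = E s) (n : ℕ) :
    (periodLoop E hE (n + 1)).Homotopic ((periodLoop E hE n).trans (periodLoop E hE 1)) := by
  set c : ℂ := 2 * Real.pi * Complex.I with hc
  let l : Path (0 : ℂ) ((n + 1 : ℕ) * c) :=
    { toFun := fun t => (n + 1 : ℕ) * (c * (t : ℝ))
      continuous_toFun := by fun_prop
      source' := by simp
      target' := by simp }
  let l₁ : Path (0 : ℂ) (n * c) :=
    { toFun := fun t => n * (c * (t : ℝ))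
      continuous_toFun := by fun_prop
      source' := by simp
      target' := by simp }
  let l₂ : Path (n * c) ((n + 1 : ℕ) * c) :=
    { toFun := fun t => c * (t : ℝ) + n * c
      continuous_toFun := by fun_prop
      source' := by simp
      target' := by simp; ring }
  have h1 : l.Homotopic (l₁.trans l₂) := SimplyConnectedSpace.paths_homotopic _ _
  have hc0 : E 0 = E ((n + 1 : ℕ) * c) := by
    simpa using (apply_add_natCast_mul_period hE (n + 1) 0).symm
  have h2 := (h1.map E).pathCast (x₂ := E 0) (x₃ := E 0) rfl hc0
  have h3 : (l.map E.continuous).cast rfl hc0 = periodLoop E hE (n + 1) := rfl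
  have h4 : ((l₁.trans l₂).map E.continuous).cast rfl hc0 =
      (periodLoop E hE n).trans (periodLoop E hE 1) := by
    ext t
    simp only [Path.map_trans, Path.cast_coe, Path.trans_apply]
    split_ifs
    · rfl
    · refine (apply_add_natCast_mul_period hE n _).trans ?_
      change _ = E ((1 : ℕ) * (c * _))
      rw [Nat.cast_one, one_mul]
  rw [← h3, ← h4]
  exact h2

/-- The punctured disc `ψ` in the logarithmic coordinate, extended continuously to the plane. -/
theorem exists_punctured_disc {r : ℕ} {p : Fin r → OnePoint ℂ} {ψ : ℂ → OnePoint ℂ}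
    (hψ : ContinuousOn ψ (ball 0 2))
    (hp : ∀ z ∈ closedBall (0 : ℂ) 1, z ≠ 0 → ψ z ∉ range p) :
    ∃ E : C(ℂ, PuncturedSphere p), (∀ s : ℂ, s.re ≤ 0 → (E s : OnePoint ℂ) = ψ (Complex.exp s)) ∧
      ∀ s, E (s + 2 * Real.pi * Complex.I) = E s := by
  -- the real part is truncated so that the exponential stays in the closed unit disc
  let τ : ℂ → ℂ := fun s => (min s.re 0 : ℝ) + s.im * Complex.I
  have hτ : Continuous τ := by fun_prop
  have hn : ∀ s, ‖Complex.exp (τ s)‖ ≤ 1 := fun s => by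
    rw [Complex.norm_exp]
    simp [τ]
  have hmem : ∀ s, ψ (Complex.exp (τ s)) ∉ range p := fun s =>
    hp _ (by simpa using hn s) (Complex.exp_ne_zero _)
  refine ⟨⟨fun s => ⟨ψ (Complex.exp (τ s)), hmem s⟩, ?_⟩, fun s hs => ?_, fun s => ?_⟩
  · refine Continuous.subtype_mk (hψ.comp_continuous (Complex.continuous_exp.comp hτ) fun s => ?_) _
    rw [mem_ball_zero_iff]
    exact (hn s).trans_lt one_lt_two
  · have : τ s = s := by
      simp only [τ, min_eq_left hs]
      exact Complex.re_add_im s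
    change ψ (Complex.exp (τ s)) = _
    rw [this]
  · apply Subtype.ext
    change ψ (Complex.exp (τ _)) = ψ (Complex.exp (τ s))
    have : τ (s + 2 * Real.pi * Complex.I) = τ s + 2 * Real.pi * Complex.I := by
      simp only [τ, Complex.add_re, Complex.add_im]
      simp
      ring
    rw [this, Complex.exp_add, Complex.exp_two_pi_mul_I, mul_one]

variable {G : Type*} [Group G] {r : ℕ}

/-- The lift to a branched cover of an `e`-fold punctured disc around a branch point, in the
logarithmic coordinate `s`, joined to the base point by a path `A`. Its boundary represents the
loop `b` in the punctured sphere with monodromy `a`; the projection to the sphere tends to `q` as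
`Re s → -∞`, where it is given by `X = exp (e * s)` in a local coordinate `X`. For `e = 0` the
curve is constant. -/
structure DiscLift {g : Fin r → G} {C : Type*} [TopologicalSpace C] [ChartedSpace ℂ C]
    [MulAction G C] (D : BranchedCover g C) (h : IsQuotientCoveringMap D.fU G)
    (b : FundamentalGroup (PuncturedSphere D.p) (D.fU D.base)) (a : G) (e : ℕ) where
  L : C(ℂ, D.U)
  A : Path D.base (L 0)
  period : ∀ s, L (s + 2 * Real.pi * Complex.I) = a • L s
  loop : ∀ β : Path (L 0) (a • L 0), (∀ t, β t = L (2 * Real.pi * Complex.I * (t : ℝ))) →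
    h.loopOfPath ((A.trans β).trans (A.map (h.continuous_const_smul a)).symm) = b
  holo : MDifferentiableOn 𝓘(ℂ) 𝓘(ℂ) (fun s => (L s : C)) {s | s.re < 0}
  inj : ∀ s s' : ℂ, s.re < 0 → s'.re < 0 → D.f (L s) = D.f (L s') →
    Complex.exp (e * s) = Complex.exp (e * s')
  q : OnePoint ℂ
  lim : ∀ V' : Set (OnePoint ℂ), IsOpen V' → q ∈ V' → ∃ b : ℝ, ∀ s : ℂ, s.re < b → D.f (L s) ∈ V'
  V : Set (OnePoint ℂ)
  isOpen_V : IsOpen V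
  q_mem : q ∈ V
  X : OnePoint ℂ → ℂ
  X_holo : ContMDiffOn 𝓘(ℂ) 𝓘(ℂ) ω X V
  X_inj : InjOn X V
  b₀ : ℝ
  b₀_nonpos : b₀ ≤ 0
  X_eq : ∀ s : ℂ, s.re < b₀ → X (D.f (L s)) = Complex.exp (e * s)

namespace BranchedCover

variable {g : Fin r → G} {C : Type*} [TopologicalSpace C] [ChartedSpace ℂ C] [MulAction G C]
  (D : BranchedCover g C)

/-- A power of a standard loop is represented by a path followed by a multiple of the boundary of a
punctured disc. -/
theorem unop_word_of_pow {i : Fin r} {E : C(ℂ, PuncturedSphere D.p)}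
    {hE : ∀ s, E (s + 2 * Real.pi * Complex.I) = E s} {α : Path (D.fU D.base) (E 0)}
    (hγ : (D.γ i).Homotopic ((α.trans (periodLoop E hE 1)).trans α.symm)) (e : ℕ) :
    unop (D.word (FreeGroup.of i ^ e)) =
      Path.Homotopic.Quotient.mk ((α.trans (periodLoop E hE e)).trans α.symm) := by
  induction e with
  | zero =>
    have h0 : periodLoop E hE 0 = Path.refl _ := by
      ext t
      simp [periodLoop]
    rw [pow_zero, map_one, unop_one, h0, FundamentalGroup.one_def]
    simp only [Path.Homotopic.Quotient.mk_trans, Path.Homotopic.Quotient.mk_symm,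
      Path.Homotopic.Quotient.mk_refl]
    simp
  | succ e ih =>
    have h1 := Path.Homotopic.Quotient.eq.2 (periodLoop_succ E hE e)
    have h2 : unop (D.word (FreeGroup.of i)) =
        Path.Homotopic.Quotient.mk ((α.trans (periodLoop E hE 1)).trans α.symm) := by
      rw [word_of]
      exact Path.Homotopic.Quotient.eq.2 hγ
    rw [pow_succ, unop_word_mul, ih, h2]
    simp only [Path.Homotopic.Quotient.mk_trans, Path.Homotopic.Quotient.mk_symm, h1]
    simp only [Path.Homotopic.Quotient.trans_assoc]
    rw [← Path.Homotopic.Quotient.trans_assoc (Path.Homotopic.Quotient.mk α).symm]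
    simp

theorem unop_word_conj {i : Fin r} {E : C(ℂ, PuncturedSphere D.p)}
    {hE : ∀ s, E (s + 2 * Real.pi * Complex.I) = E s} {α : Path (D.fU D.base) (E 0)}
    (hγ : (D.γ i).Homotopic ((α.trans (periodLoop E hE 1)).trans α.symm)) (e : ℕ)
    (u : FreeGroup (Fin r)) : ∃ A : Path (D.fU D.base) (E 0),
      unop (D.word (u * FreeGroup.of i ^ e * u⁻¹)) =
        Path.Homotopic.Quotient.mk ((A.trans (periodLoop E hE e)).trans A.symm) := by
  obtain ⟨ν, hν⟩ := Path.Homotopic.Quotient.mk_surjective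
    (FundamentalGroup.toPath (unop (D.word u)))
  refine ⟨ν.trans α, ?_⟩
  have hu : unop (D.word u) = Path.Homotopic.Quotient.mk ν := hν.symm
  have hu' : unop (D.word u⁻¹) = (Path.Homotopic.Quotient.mk ν).symm := by
    rw [map_inv, unop_inv, hu]
    rfl
  rw [unop_word_mul, unop_word_mul, hu, hu', D.unop_word_of_pow hγ, Path.trans_symm]
  simp only [Path.Homotopic.Quotient.mk_trans, Path.Homotopic.Quotient.mk_symm,
    Path.Homotopic.Quotient.trans_assoc]

theorem nonempty_discLift [IsManifold 𝓘(ℂ) ω C] (h : IsQuotientCoveringMap D.fU G)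
    (u : FreeGroup (Fin r)) (i : Fin r) (e : ℕ) :
    Nonempty (DiscLift D h (unop (D.word (u * FreeGroup.of i ^ e * u⁻¹)))
      (FreeGroup.lift g (u * FreeGroup.of i ^ e * u⁻¹)) e) := by
  obtain ⟨ψ, y, α, δ, hψ, hψinj, hψ0, hψp, hδ, hγ⟩ := D.loops.simple i
  obtain ⟨E, hEψ, hE⟩ := exists_punctured_disc hψ.continuousOn hψp
  have hψd : MDifferentiableOn 𝓘(ℂ) 𝓘(ℂ) ψ (ball 0 2) := hψ.mdifferentiableOn (by simp)
  obtain rfl : E 0 = y := by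
    apply Subtype.ext
    have := hδ 0
    rw [hEψ 0 (by simp)]
    simpa using this.symm
  obtain rfl : δ = periodLoop E hE 1 := by
    ext t
    refine (hδ t).trans ?_
    change _ = ((E ((1 : ℕ) * (2 * Real.pi * Complex.I * (t : ℝ)))) : OnePoint ℂ)
    rw [Nat.cast_one, one_mul, hEψ _ (by simp)]
  obtain ⟨A, hA⟩ := D.unop_word_conj hγ e u
  have cov := h.isCoveringMap
  -- the lift of the path `A` and then of the punctured disc
  obtain ⟨A', hA', hA'0⟩ := cov.exists_path_lifts (A : C(unitInterval, PuncturedSphere D.p)) D.base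
    A.source
  have hA't : ∀ t, D.fU (A' t) = A t := fun t => congrFun hA' t
  let E' : C(ℂ, PuncturedSphere D.p) := E.comp ⟨fun s => e * s, by fun_prop⟩
  have hE'per : ∀ s, E' (s + 2 * Real.pi * Complex.I) = E' s := fun s => by
    change E (e * (s + _)) = E (e * s)
    rw [mul_add]
    exact apply_add_natCast_mul_period hE e _
  obtain ⟨L, ⟨hL0, hL⟩, -⟩ := cov.existsUnique_continuousMap_lifts E' 0 (A' 1) (by
    rw [hA't]
    change A 1 = E (e * 0)
    rw [mul_zero, A.target])
  have hLs : ∀ s, D.fU (L s) = E (e * s) := fun s => congrFun hL s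
  obtain ⟨a, ha⟩ : ∃ a : G, a • L 0 = L (2 * Real.pi * Complex.I) := by
    refine h.apply_eq_iff_mem_orbit.1 ?_
    rw [hLs, hLs]
    simpa using apply_add_natCast_mul_period hE e 0
  have hper : ∀ s, L (s + 2 * Real.pi * Complex.I) = a • L s := by
    refine congrFun (cov.eq_of_comp_eq (g₁ := fun s => L (s + 2 * Real.pi * Complex.I))
      (g₂ := fun s => a • L s) (by fun_prop) ((h.continuous_const_smul a).comp L.continuous)
      ?_ 0 ?_)
    · funext s
      simp only [Function.comp_apply]
      rw [h.map_smul, hLs, hLs]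
      exact hE'per s
    · simpa using ha.symm
  let B : Path D.base (L 0) := ⟨A', hA'0, hL0.symm⟩
  have hloop : ∀ β : Path (L 0) (a • L 0), (∀ t, β t = L (2 * Real.pi * Complex.I * (t : ℝ))) →
      h.loopOfPath ((B.trans β).trans (B.map (h.continuous_const_smul a)).symm) =
        unop (D.word (u * FreeGroup.of i ^ e * u⁻¹)) := by
    intro β hβ
    rw [hA]
    change Path.Homotopic.Quotient.mk _ = Path.Homotopic.Quotient.mk _
    congr 1
    ext t
    change (D.fU (((B.trans β).trans (B.map (h.continuous_const_smul a)).symm) t) :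
      OnePoint ℂ) = _
    congr 1
    simp only [Path.trans_apply, Path.symm_apply, Path.map_coe, Function.comp_apply]
    split_ifs
    · exact hA't _
    · rw [hβ, hLs]
      rfl
    · rw [h.map_smul]
      exact hA't _
  let β : Path (L 0) (a • L 0) :=
    { toFun := fun t => L (2 * Real.pi * Complex.I * (t : ℝ))
      continuous_toFun := by fun_prop
      source' := by simp
      target' := by simpa using ha.symm }
  have hmon : FreeGroup.lift g (u * FreeGroup.of i ^ e * u⁻¹) = a := by
    have h1 := D.monodromy_word h (u * FreeGroup.of i ^ e * u⁻¹)
    rw [← hloop β fun t => rfl, h.fundamentalGroupToMulOpposite_loopOfPath] at h1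
    exact (op_injective h1).symm
  rw [hmon]
  have hf : ∀ s : ℂ, s.re ≤ 0 → D.f (L s) = ψ (Complex.exp (e * s)) := fun s hs => by
    rw [← hEψ _ (by simpa using mul_nonpos_of_nonneg_of_nonpos e.cast_nonneg hs), ← hLs]
    rfl
  have hexp : ∀ s : ℂ, s.re ≤ 0 → Complex.exp (e * s) ∈ ball (0 : ℂ) 2 := fun s hs => by
    rw [mem_ball_zero_iff, Complex.norm_exp]
    refine lt_of_le_of_lt (Real.exp_le_one_iff.2 ?_) one_lt_two
    simpa using mul_nonpos_of_nonneg_of_nonpos e.cast_nonneg hs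
  have hholo : MDifferentiableOn 𝓘(ℂ) 𝓘(ℂ) (fun s => (L s : C)) {s | s.re < 0} := by
    intro s hs
    apply MDifferentiableAt.mdifferentiableWithinAt
    obtain ⟨O, hO, hsO, hOinj⟩ := cov.isLocalHomeomorph.isLocallyInjective (L s)
    refine mdifferentiableAt_of_injOn (f := D.f) (D.isOpen_U.isOpenMap_subtype_val O hO)
      (D.holo.mdifferentiable (by simp)).mdifferentiableOn ?_
      (continuous_subtype_val.comp L.continuous).continuousAt ⟨L s, hsO, rfl⟩ ?_
    · rintro _ ⟨x, hx, rfl⟩ _ ⟨y, hy, rfl⟩ hxy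
      exact congrArg Subtype.val (hOinj hx hy (Subtype.ext hxy))
    · have h1 : MDifferentiableAt 𝓘(ℂ) 𝓘(ℂ) (fun t : ℂ => Complex.exp (e * t)) s := by
        rw [mdifferentiableAt_iff_differentiableAt]
        fun_prop
      refine ((hψd.mdifferentiableAt (isOpen_ball.mem_nhds (hexp s (le_of_lt hs)))).comp s
        h1).congr_of_eventuallyEq ?_
      filter_upwards [(isOpen_Iio.preimage Complex.continuous_re).mem_nhds hs] with t ht
      exact hf t (le_of_lt ht)
  have hinj : ∀ s s' : ℂ, s.re < 0 → s'.re < 0 → D.f (L s) = D.f (L s') →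
      Complex.exp (e * s) = Complex.exp (e * s') := by
    intro s s' hs hs' hss'
    rw [hf s hs.le, hf s' hs'.le] at hss'
    exact hψinj (hexp s hs.le) (hexp s' hs'.le) hss'
  rcases Nat.eq_zero_or_pos e with rfl | he
  · -- the curve is constant
    set χ := chartAt ℂ (ψ 1) with hχ
    have hf1 : ∀ s : ℂ, s.re < 0 → D.f (L s) = ψ 1 := fun s hs => by
      rw [hf s (le_of_lt hs)]
      simp
    have hχd : ContMDiffOn 𝓘(ℂ) 𝓘(ℂ) ω χ χ.source := contMDiffOn_chart
    exact ⟨{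
      L := L
      A := B
      period := hper
      loop := hloop
      holo := hholo
      inj := hinj
      q := ψ 1
      lim := fun V' hV' hq => ⟨0, fun s hs => by rwa [hf1 s hs]⟩
      V := χ.source
      isOpen_V := χ.open_source
      q_mem := mem_chart_source ℂ _
      X := fun x => χ x - (χ (ψ 1) - 1)
      X_holo := hχd.sub contMDiffOn_const
      X_inj := fun x hx y hy hxy => χ.injOn hx hy (sub_left_injective hxy)
      b₀ := 0
      b₀_nonpos := le_rfl
      X_eq := fun s hs => by rw [hf1 s hs]; simp }⟩
  · obtain ⟨V, X, ρ, hV, hXd, hXi, hρ, hX⟩ := exists_coordinate_of_disc two_pos hψd hψinj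
    have hsmall : ∀ ε > 0, ∃ b ≤ 0, ∀ s : ℂ, s.re < b → Complex.exp (e * s) ∈ ball (0 : ℂ) ε := by
      intro ε hε
      refine ⟨min 0 (Real.log ε), min_le_left _ _, fun s hs => ?_⟩
      rw [lt_min_iff] at hs
      rw [mem_ball_zero_iff, Complex.norm_exp, ← Real.lt_log_iff_exp_lt hε]
      have h1 : (1 : ℝ) ≤ e := by exact_mod_cast he
      have h2 : ((e : ℂ) * s).re = e * s.re := by simp
      rw [h2]
      nlinarith
    obtain ⟨b₀, hb₀, hb₀ρ⟩ := hsmall ρ hρ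
    exact ⟨{
      L := L
      A := B
      period := hper
      loop := hloop
      holo := hholo
      inj := hinj
      q := ψ 0
      lim := fun V' hV' hq => by
        obtain ⟨ε, hε, hball⟩ := Metric.isOpen_iff.1
          (hψd.continuousOn.isOpen_inter_preimage isOpen_ball hV') 0 ⟨mem_ball_self two_pos, hq⟩
        obtain ⟨b, hb, hbε⟩ := hsmall ε hε
        refine ⟨b, fun s hs => ?_⟩
        rw [hf s (hs.le.trans hb)]
        exact (hball (hbε s hs)).2
      V := V
      isOpen_V := hV
      q_mem := (hX 0 (mem_ball_self hρ)).1
      X := X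
      X_holo := hXd
      X_inj := hXi
      b₀ := b₀
      b₀_nonpos := hb₀
      X_eq := fun s hs => by
        rw [hf s (hs.le.trans hb₀)]
        exact (hX _ (hb₀ρ s hs)).2 }⟩

end BranchedCover

end DiscLifts

/-! ### The part of a resolution over the unramified locus -/

section Resolutions

open Filter Set

variable {G : Type*} [Group G] {r : ℕ} {g : Fin r → G} {C₁ C₂ : Type*}
  [MulAction G C₁] [MulAction G C₂]

theorem ProductQuotient.mk_eq_mk_iff {c d : C₁ × C₂} :
    ProductQuotient.mk G C₁ C₂ c = ProductQuotient.mk G C₁ C₂ d ↔ ∃ a : G, a • c = d := by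
  rw [eq_comm]
  exact Quotient.eq''

/-- The map on the quotient induced by an invariant map. -/
def ProductQuotient.lift {Z : Type*} (F : C₁ × C₂ → Z) (hF : ∀ (a : G) c, F (a • c) = F c) :
    ProductQuotient G C₁ C₂ → Z :=
  Quotient.lift F fun c d (h : c ∈ MulAction.orbit G d) => by
    obtain ⟨a, rfl⟩ := h
    exact hF a d

variable [TopologicalSpace C₁]

theorem ProductQuotient.continuous_lift [TopologicalSpace C₂] {Z : Type*} [TopologicalSpace Z]
    {F : C₁ × C₂ → Z}
    (hF : ∀ (a : G) c, F (a • c) = F c) (hc : Continuous F) :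
    Continuous (ProductQuotient.lift F hF) :=
  Continuous.quotient_lift (s := MulAction.orbitRel G (C₁ × C₂)) hc _

section Projections

variable {X : Type*} [TopologicalSpace C₂]

/-- The map to the sphere through the first factor. -/
def BranchedCover.proj₁ [ChartedSpace ℂ C₁] (D₁ : BranchedCover g C₁)
    (π : X → ProductQuotient G C₁ C₂) (x : X) : OnePoint ℂ :=
  ProductQuotient.lift (fun c => D₁.f c.1) (fun a c => D₁.f_smul a c.1) (π x)

/-- The map to the sphere through the second factor. -/
def BranchedCover.proj₂ [ChartedSpace ℂ C₂] (D₂ : BranchedCover g C₂)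
    (π : X → ProductQuotient G C₁ C₂) (x : X) : OnePoint ℂ :=
  ProductQuotient.lift (fun c => D₂.f c.2) (fun a c => D₂.f_smul a c.2) (π x)

theorem BranchedCover.continuous_proj₁ [ChartedSpace ℂ C₁] (D₁ : BranchedCover g C₁)
    [TopologicalSpace X] {π : X → ProductQuotient G C₁ C₂} (hπ : Continuous π) :
    Continuous (D₁.proj₁ π) :=
  (ProductQuotient.continuous_lift _ (D₁.holo.continuous.comp continuous_fst)).comp hπ

theorem BranchedCover.continuous_proj₂ [ChartedSpace ℂ C₂] (D₂ : BranchedCover g C₂)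
    [TopologicalSpace X] {π : X → ProductQuotient G C₁ C₂} (hπ : Continuous π) :
    Continuous (D₂.proj₂ π) :=
  (ProductQuotient.continuous_lift _ (D₂.holo.continuous.comp continuous_snd)).comp hπ

end Projections

variable [ChartedSpace ℂ C₁]

theorem BranchedCover.mem_freeLocus (D₁ : BranchedCover g C₁) {c : C₁ × C₂} (hc : c.1 ∈ D₁.U) :
    c ∈ freeLocus G C₁ C₂ := by
  change MulAction.stabilizer G c = ⊥
  rw [Subgroup.eq_bot_iff_forall]
  intro a ha
  exact D₁.smul_eq_self hc (congrArg Prod.fst ha)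

variable [TopologicalSpace C₂] [ChartedSpace ℂ C₂]

theorem IsHolomorphicToQuotient.mdifferentiableOn_lift {X : Type*} [TopologicalSpace X]
    [ChartedSpace (EuclideanSpace ℂ (Fin 2)) X] {π : X → ProductQuotient G C₁ C₂}
    (hπ : IsHolomorphicToQuotient G C₁ C₂ π) {S : Type*} [TopologicalSpace S] [ChartedSpace ℂ S]
    {F : C₁ × C₂ → S} (hF : ∀ (a : G) c, F (a • c) = F c)
    (hFd : ContMDiff (𝓘(ℂ).prod 𝓘(ℂ)) 𝓘(ℂ) ω F) {V : Set S} (hV : IsOpen V) {Y : S → ℂ}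
    (hY : ContMDiffOn 𝓘(ℂ) 𝓘(ℂ) ω Y V) :
    MDifferentiableOn 𝓘(ℂ, EuclideanSpace ℂ (Fin 2)) 𝓘(ℂ)
      (fun x => Y (ProductQuotient.lift F hF (π x)))
      ((fun x => ProductQuotient.lift F hF (π x)) ⁻¹' V) := by
  refine (hπ.2 (ProductQuotient.lift F hF ⁻¹' V) (fun y => Y (ProductQuotient.lift F hF y))
    (hV.preimage (ProductQuotient.continuous_lift hF hFd.continuous)) ?_).mdifferentiableOn
      (by simp)
  exact hY.comp hFd.contMDiffOn fun c hc => hc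

variable (D₁ : BranchedCover g C₁) (D₂ : BranchedCover g C₂)
  {X : Type*} [TopologicalSpace X] {π : X → ProductQuotient G C₁ C₂}

/-- The part of the resolution that lies over the product of the punctured spheres. -/
def unramifiedPart (π : X → ProductQuotient G C₁ C₂) : Set X :=
  {x | D₁.proj₁ π x ∉ range D₁.p ∧ D₂.proj₂ π x ∉ range D₂.p}

namespace IsResolution

variable [ChartedSpace (EuclideanSpace ℂ (Fin 2)) X] (hπ : IsResolution G C₁ C₂ π)

/-- The inverse of the resolution over the smooth locus, as a map from the product of the curves. -/
noncomputable def inv : C₁ × C₂ → X := hπ.iso.choose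

theorem contMDiffOn_inv : ContMDiffOn (𝓘(ℂ).prod 𝓘(ℂ)) 𝓘(ℂ, EuclideanSpace ℂ (Fin 2)) ω hπ.inv
    (freeLocus G C₁ C₂) :=
  hπ.iso.choose_spec.1

theorem apply_eq_iff {c : C₁ × C₂} (hc : c ∈ freeLocus G C₁ C₂) {x : X} :
    π x = ProductQuotient.mk G C₁ C₂ c ↔ x = hπ.inv c :=
  hπ.iso.choose_spec.2 c hc x

theorem apply_inv {c : C₁ × C₂} (hc : c ∈ freeLocus G C₁ C₂) :
    π (hπ.inv c) = ProductQuotient.mk G C₁ C₂ c :=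
  (hπ.apply_eq_iff hc).2 rfl

theorem proj₁_inv {c : C₁ × C₂} (hc : c ∈ freeLocus G C₁ C₂) :
    D₁.proj₁ π (hπ.inv c) = D₁.f c.1 := by
  rw [BranchedCover.proj₁, hπ.apply_inv hc]
  rfl

theorem proj₂_inv {c : C₁ × C₂} (hc : c ∈ freeLocus G C₁ C₂) :
    D₂.proj₂ π (hπ.inv c) = D₂.f c.2 := by
  rw [BranchedCover.proj₂, hπ.apply_inv hc]
  rfl

/-- The parametrization of the unramified part by the product of the unramified covers. -/
noncomputable def cover (c : D₁.U × D₂.U) : unramifiedPart D₁ D₂ π :=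
  ⟨hπ.inv (c.1, c.2), by
    have hc := D₁.mem_freeLocus (c := ((c.1 : C₁), (c.2 : C₂))) c.1.2
    refine ⟨?_, ?_⟩
    · rw [hπ.proj₁_inv D₁ hc]
      exact c.1.2
    · rw [hπ.proj₂_inv D₂ hc]
      exact c.2.2⟩

theorem exists_inv_eq {x : X} (hx : x ∈ unramifiedPart D₁ D₂ π) :
    ∃ c : D₁.U × D₂.U, hπ.cover D₁ D₂ c = x := by
  obtain ⟨c, hc⟩ : ∃ c, ProductQuotient.mk G C₁ C₂ c = π x := Quotient.mk''_surjective (π x)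
  have h1 : D₁.proj₁ π x = D₁.f c.1 := by rw [BranchedCover.proj₁, ← hc]; rfl
  have h2 : D₂.proj₂ π x = D₂.f c.2 := by rw [BranchedCover.proj₂, ← hc]; rfl
  have hc1 : c.1 ∈ D₁.U := by rw [D₁.mem_U, ← h1]; exact hx.1
  have hc2 : c.2 ∈ D₂.U := by rw [D₂.mem_U, ← h2]; exact hx.2
  exact ⟨(⟨c.1, hc1⟩, ⟨c.2, hc2⟩), ((hπ.apply_eq_iff (D₁.mem_freeLocus hc1)).1 hc.symm).symm⟩

theorem continuous_cover : Continuous (hπ.cover D₁ D₂) := by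
  refine Continuous.subtype_mk ?_ _
  exact hπ.contMDiffOn_inv.continuousOn.comp_continuous (by fun_prop)
    fun c => D₁.mem_freeLocus c.1.2

theorem isQuotientCoveringMap_cover [Finite G] [T2Space C₁] [T2Space C₂]
    (hact₁ : ∀ a : G, ContMDiff 𝓘(ℂ) 𝓘(ℂ) ω fun x : C₁ => a • x)
    (hact₂ : ∀ a : G, ContMDiff 𝓘(ℂ) 𝓘(ℂ) ω fun x : C₂ => a • x) :
    IsQuotientCoveringMap (hπ.cover D₁ D₂) G := by
  have : ContinuousConstSMul G C₁ := ⟨fun a => (hact₁ a).continuous⟩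
  have : ContinuousConstSMul G C₂ := ⟨fun a => (hact₂ a).continuous⟩
  have hfree : ∀ c : D₁.U × D₂.U, ((c.1 : C₁), (c.2 : C₂)) ∈ freeLocus G C₁ C₂ :=
    fun c => D₁.mem_freeLocus c.1.2
  refine isQuotientCoveringMap_of_isOpenMap (hπ.continuous_cover D₁ D₂) ?_ ?_ (fun a => ?_) ?_ ?_
  · intro O hO
    have hO' : IsOpen ((Prod.map Subtype.val Subtype.val : D₁.U × D₂.U → C₁ × C₂) '' O) :=
      (D₁.isOpen_U.isOpenMap_subtype_val.prodMap D₂.isOpen_U.isOpenMap_subtype_val) O hO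
    have hmk : IsOpen (ProductQuotient.mk G C₁ C₂ ''
        ((Prod.map Subtype.val Subtype.val : D₁.U × D₂.U → C₁ × C₂) '' O)) :=
      isOpenMap_quotient_mk'_mul _ hO'
    have heq : hπ.cover D₁ D₂ '' O = Subtype.val ⁻¹' (π ⁻¹' (ProductQuotient.mk G C₁ C₂ ''
        ((Prod.map Subtype.val Subtype.val : D₁.U × D₂.U → C₁ × C₂) '' O))) := by
      ext x
      constructor
      · rintro ⟨c, hc, rfl⟩
        exact ⟨_, ⟨c, hc, rfl⟩, (hπ.apply_inv (hfree c)).symm⟩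
      · rintro ⟨_, ⟨c, hc, rfl⟩, hx⟩
        exact ⟨c, hc, Subtype.ext ((hπ.apply_eq_iff (hfree c)).1 hx.symm).symm⟩
    rw [heq]
    exact (hmk.preimage hπ.proper.continuous).preimage continuous_subtype_val
  · intro x
    obtain ⟨c, hc⟩ := hπ.exists_inv_eq D₁ D₂ x.2
    exact ⟨c, Subtype.ext hc⟩
  · refine Continuous.prodMk (Continuous.subtype_mk ?_ _) (Continuous.subtype_mk ?_ _)
    · exact (hact₁ a).continuous.comp (continuous_subtype_val.comp continuous_fst)
    · exact (hact₂ a).continuous.comp (continuous_subtype_val.comp continuous_snd)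
  · intro c d
    rw [Subtype.ext_iff]
    change hπ.inv _ = hπ.inv _ ↔ _
    rw [← hπ.apply_eq_iff (hfree d), hπ.apply_inv (hfree c), ProductQuotient.mk_eq_mk_iff]
    refine exists_congr fun a => ?_
    simp only [Prod.ext_iff, Subtype.ext_iff]
    rfl
  · intro c a ha
    exact D₁.smul_eq_self c.1.2 (congrArg (fun x : D₁.U × D₂.U => (x.1 : C₁)) ha)

variable [CompactSpace C₁] [CompactSpace C₂]

theorem dense_unramifiedPart (hπ : IsResolution G C₁ C₂ π)
    (hact₁ : ∀ a : G, ContMDiff 𝓘(ℂ) 𝓘(ℂ) ω fun x : C₁ => a • x)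
    (hact₂ : ∀ a : G, ContMDiff 𝓘(ℂ) 𝓘(ℂ) ω fun x : C₂ => a • x) :
    Dense (unramifiedPart D₁ D₂ π) := by
  rw [dense_iff_inter_open]
  intro O hO hne
  obtain ⟨x, hxO, c, hc, hcx⟩ := hπ.dense.inter_open_nonempty O hO hne
  obtain rfl := (hπ.apply_eq_iff hc).1 hcx.symm
  obtain ⟨O', hO', hOO'⟩ := continuousOn_iff'.1 hπ.contMDiffOn_inv.continuousOn O hO
  obtain ⟨d, hdO', hd⟩ := ((D₁.dense_U hact₁).prod (D₂.dense_U hact₂)).inter_open_nonempty O' hO'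
    ⟨c, (hOO'.le ⟨hxO, hc⟩).1⟩
  have hdf : d ∈ freeLocus G C₁ C₂ := D₁.mem_freeLocus hd.1
  exact ⟨hπ.inv d, (hOO'.ge ⟨hdO', hdf⟩).1, (hπ.cover D₁ D₂ (⟨d.1, hd.1⟩, ⟨d.2, hd.2⟩)).2⟩

theorem hasNiceBasis_unramifiedPart [IsManifold 𝓘(ℂ, EuclideanSpace ℂ (Fin 2)) ω X]
    (hπ : IsResolution G C₁ C₂ π)
    (hact₁ : ∀ a : G, ContMDiff 𝓘(ℂ) 𝓘(ℂ) ω fun x : C₁ => a • x)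
    (hact₂ : ∀ a : G, ContMDiff 𝓘(ℂ) 𝓘(ℂ) ω fun x : C₂ => a • x) :
    HasNiceBasis (unramifiedPart D₁ D₂ π) := by
  refine hasNiceBasis_of_ne_zero (E := EuclideanSpace ℂ (Fin 2))
    (dense_unramifiedPart D₁ D₂ hπ hact₁ hact₂) fun x => ?_
  obtain ⟨V₁, Y₁, hV₁, hx₁, hY₁, hYV₁⟩ :=
    exists_local_equation_of_finite (finite_range D₁.p) (D₁.proj₁ π x)
  obtain ⟨V₂, Y₂, hV₂, hx₂, hY₂, hYV₂⟩ :=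
    exists_local_equation_of_finite (finite_range D₂.p) (D₂.proj₂ π x)
  have h1 := hπ.holomorphic.mdifferentiableOn_lift (fun a c => D₁.f_smul a c.1)
    (D₁.holo.comp contMDiff_fst) hV₁ hY₁
  have h2 := hπ.holomorphic.mdifferentiableOn_lift (fun a c => D₂.f_smul a c.2)
    (D₂.holo.comp contMDiff_snd) hV₂ hY₂
  refine ⟨D₁.proj₁ π ⁻¹' V₁ ∩ D₂.proj₂ π ⁻¹' V₂, fun y => Y₁ (D₁.proj₁ π y) * Y₂ (D₂.proj₂ π y),
    (hV₁.preimage (D₁.continuous_proj₁ hπ.proper.continuous)).inter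
      (hV₂.preimage (D₂.continuous_proj₂ hπ.proper.continuous)), ⟨hx₁, hx₂⟩,
    (h1.mono inter_subset_left).mul (h2.mono inter_subset_right), fun y hy => ?_⟩
  rw [mul_ne_zero_iff, ← hYV₁ _ hy.1, ← hYV₂ _ hy.2]
  rfl

theorem isPathConnected_unramifiedPart (hπ : IsResolution G C₁ C₂ π)
    [IsManifold 𝓘(ℂ) ω C₁] [IsManifold 𝓘(ℂ) ω C₂]
    [ConnectedSpace C₁] [ConnectedSpace C₂]
    (hact₁ : ∀ a : G, ContMDiff 𝓘(ℂ) 𝓘(ℂ) ω fun x : C₁ => a • x)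
    (hact₂ : ∀ a : G, ContMDiff 𝓘(ℂ) 𝓘(ℂ) ω fun x : C₂ => a • x) :
    IsPathConnected (unramifiedPart D₁ D₂ π) := by
  have h1 := isPathConnected_iff_pathConnectedSpace.1 (D₁.isPathConnected_U hact₁)
  have h2 := isPathConnected_iff_pathConnectedSpace.1 (D₂.isPathConnected_U hact₂)
  have h3 : range (fun c => (hπ.cover D₁ D₂ c : X)) = unramifiedPart D₁ D₂ π := by
    ext x
    exact ⟨fun ⟨c, hc⟩ => hc ▸ (hπ.cover D₁ D₂ c).2, fun hx => hπ.exists_inv_eq D₁ D₂ hx⟩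
  rw [← h3]
  have : PathConnectedSpace (D₁.U × D₂.U) := by
    have e1 : PathConnectedSpace D₁.U := h1
    have e2 : PathConnectedSpace D₂.U := h2
    infer_instance
  exact isPathConnected_range (continuous_subtype_val.comp (hπ.continuous_cover D₁ D₂))

end IsResolution

end Resolutions

/-! ### Simple connectedness of the resolution -/

section SimpleConnectedness

open Filter Set MulOpposite

theorem exists_pow_ne {S : Type*} {O : Set S} (hO : O.Infinite) {X : S → ℂ} (hX : InjOn X O) {n : ℕ}
    (hn : 0 < n) (c : ℂ) : ∃ z ∈ O, X z ^ n ≠ c := by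
  by_contra! h
  refine (hO.image hX) ((Polynomial.nthRoots n c).toFinset.finite_toSet.subset ?_)
  rintro _ ⟨z, hz, rfl⟩
  simpa [Polynomial.mem_nthRoots hn] using h z hz

variable {G : Type*} [Group G] {r : ℕ} {g : Fin r → G} {C₁ C₂ : Type*}
  [MulAction G C₁] [MulAction G C₂]
  [TopologicalSpace C₁] [ChartedSpace ℂ C₁] [TopologicalSpace C₂] [ChartedSpace ℂ C₂]
  {D₁ : BranchedCover g C₁} {D₂ : BranchedCover g C₂}
  {X : Type*} [TopologicalSpace X] [ChartedSpace (EuclideanSpace ℂ (Fin 2)) X]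
  {π : X → ProductQuotient G C₁ C₂}
  [CompactSpace C₁] [CompactSpace C₂]

/-- Two local coordinates on the sphere satisfy no monomial relation on an open set of the
resolution. -/
theorem IsResolution.exists_pow_ne_pow (hπ : IsResolution G C₁ C₂ π)
    (hact₁ : ∀ a : G, ContMDiff 𝓘(ℂ) 𝓘(ℂ) ω fun x : C₁ => a • x)
    (hact₂ : ∀ a : G, ContMDiff 𝓘(ℂ) 𝓘(ℂ) ω fun x : C₂ => a • x)
    {V₁ V₂ : Set (OnePoint ℂ)} {X₁ X₂ : OnePoint ℂ → ℂ} (hX₁ : InjOn X₁ V₁) (hX₂ : InjOn X₂ V₂)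
    {e f : ℕ} (hef : 0 < e ∨ 0 < f) {O : Set X} (hO : IsOpen O) (hne : O.Nonempty)
    (hOV : O ⊆ D₁.proj₁ π ⁻¹' V₁ ∩ D₂.proj₂ π ⁻¹' V₂) :
    ∃ q ∈ O, X₁ (D₁.proj₁ π q) ^ f ≠ X₂ (D₂.proj₂ π q) ^ e := by
  obtain ⟨x, hxO, hx⟩ := (hπ.dense_unramifiedPart D₁ D₂ hact₁ hact₂).inter_open_nonempty O hO hne
  obtain ⟨⟨c₁, c₂⟩, rfl⟩ := hπ.exists_inv_eq D₁ D₂ hx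
  have hcont : Continuous fun c => (hπ.cover D₁ D₂ c : X) :=
    continuous_subtype_val.comp (hπ.continuous_cover D₁ D₂)
  obtain ⟨O₁, O₂, hO₁, hO₂, hc₁, hc₂, hsub⟩ := isOpen_prod_iff.1 (hO.preimage hcont) c₁ c₂ hxO
  have hf₁ : ∀ c : D₁.U × D₂.U, D₁.proj₁ π (hπ.cover D₁ D₂ c) = D₁.f c.1 := fun c =>
    hπ.proj₁_inv D₁ (D₁.mem_freeLocus c.1.2)
  have hf₂ : ∀ c : D₁.U × D₂.U, D₂.proj₂ π (hπ.cover D₁ D₂ c) = D₂.f c.2 := fun c =>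
    hπ.proj₂_inv D₂ (D₁.mem_freeLocus c.1.2)
  rcases hef with he | hf
  · have hopen : IsOpen (D₂.f '' (Subtype.val '' O₂)) :=
      D₂.isOpenMap_f hact₂ _ (D₂.isOpen_U.isOpenMap_subtype_val O₂ hO₂)
    have hinf : (D₂.f '' (Subtype.val '' O₂)).Infinite :=
      infinite_of_mem_nhds (D₂.f c₂) (hopen.mem_nhds ⟨c₂, ⟨c₂, hc₂, rfl⟩, rfl⟩)
    obtain ⟨_, ⟨_, ⟨d, hd, rfl⟩, rfl⟩, hne⟩ := exists_pow_ne hinf (hX₂.mono (by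
      rintro _ ⟨_, ⟨d, hd, rfl⟩, rfl⟩
      rw [← hf₂ (c₁, d)]
      exact (hOV (hsub (mk_mem_prod hc₁ hd))).2)) he (X₁ (D₁.f c₁) ^ f)
    refine ⟨_, hsub (mk_mem_prod hc₁ hd), ?_⟩
    rw [hf₁, hf₂]
    exact hne.symm
  · have hopen : IsOpen (D₁.f '' (Subtype.val '' O₁)) :=
      D₁.isOpenMap_f hact₁ _ (D₁.isOpen_U.isOpenMap_subtype_val O₁ hO₁)
    have hinf : (D₁.f '' (Subtype.val '' O₁)).Infinite :=
      infinite_of_mem_nhds (D₁.f c₁) (hopen.mem_nhds ⟨c₁, ⟨c₁, hc₁, rfl⟩, rfl⟩)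
    obtain ⟨_, ⟨_, ⟨d, hd, rfl⟩, rfl⟩, hne⟩ := exists_pow_ne hinf (hX₁.mono (by
      rintro _ ⟨_, ⟨d, hd, rfl⟩, rfl⟩
      rw [← hf₁ (d, c₂)]
      exact (hOV (hsub (mk_mem_prod hd hc₂))).1)) hf (X₂ (D₂.f c₂) ^ e)
    refine ⟨_, hsub (mk_mem_prod hd hc₂), ?_⟩
    rw [hf₁, hf₂]
    exact hne

/-- The boundary of a pair of punctured discs with the same monodromy is null-homotopic in the
resolution. -/
theorem IsResolution.homotopic_refl_of_discLift [T2Space X]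
    [IsManifold 𝓘(ℂ, EuclideanSpace ℂ (Fin 2)) ω X] (hπ : IsResolution G C₁ C₂ π)
    (hact₁ : ∀ a : G, ContMDiff 𝓘(ℂ) 𝓘(ℂ) ω fun x : C₁ => a • x)
    (hact₂ : ∀ a : G, ContMDiff 𝓘(ℂ) 𝓘(ℂ) ω fun x : C₂ => a • x)
    {h₁ : IsQuotientCoveringMap D₁.fU G} {h₂ : IsQuotientCoveringMap D₂.fU G}
    (hσ : IsQuotientCoveringMap (hπ.cover D₁ D₂) G)
    {b₁ b₂} {a : G} {e f : ℕ} (T₁ : DiscLift D₁ h₁ b₁ a e) (T₂ : DiscLift D₂ h₂ b₂ a f)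
    (hef : 0 < e ∨ 0 < f)
    (γ : Path (hπ.cover D₁ D₂ (T₁.L 0, T₂.L 0) : X) (hπ.cover D₁ D₂ (T₁.L 0, T₂.L 0)))
    (hγ : ∀ t : unitInterval, γ t = hπ.cover D₁ D₂ (T₁.L (2 * Real.pi * Complex.I * (t : ℝ)),
      T₂.L (2 * Real.pi * Complex.I * (t : ℝ)))) : γ.Homotopic (Path.refl _) := by
  have hπc : Continuous π := hπ.proper.continuous
  have : CompactSpace X := by
    have : CompactSpace (ProductQuotient G C₁ C₂) := inferInstance
    exact ⟨by simpa using hπ.proper.isCompact_preimage isCompact_univ⟩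
  have hq₁ : Continuous (D₁.proj₁ π) := D₁.continuous_proj₁ hπc
  have hq₂ : Continuous (D₂.proj₂ π) := D₂.continuous_proj₂ hπc
  let x : ℂ → X := fun s => hπ.cover D₁ D₂ (T₁.L s, T₂.L s)
  have hx₁ : ∀ s, D₁.proj₁ π (x s) = D₁.f (T₁.L s) := fun s =>
    hπ.proj₁_inv D₁ (D₁.mem_freeLocus (T₁.L s).2)
  have hx₂ : ∀ s, D₂.proj₂ π (x s) = D₂.f (T₂.L s) := fun s =>
    hπ.proj₂_inv D₂ (D₁.mem_freeLocus (T₁.L s).2)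
  have hx : Continuous x := continuous_subtype_val.comp
    ((hπ.continuous_cover D₁ D₂).comp (T₁.L.continuous.prodMk T₂.L.continuous))
  have hhol : MDifferentiableOn 𝓘(ℂ) 𝓘(ℂ, EuclideanSpace ℂ (Fin 2)) x {s | s.re < 0} :=
    (hπ.contMDiffOn_inv.mdifferentiableOn (by simp)).comp (T₁.holo.prodMk T₂.holo)
      fun s _ => D₁.mem_freeLocus (T₁.L s).2
  have hper : ∀ s, x (s + 2 * Real.pi * Complex.I) = x s := fun s => by
    have : hπ.cover D₁ D₂ (a • (T₁.L s, T₂.L s)) = hπ.cover D₁ D₂ (T₁.L s, T₂.L s) :=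
      hσ.map_smul a
    simp only [x, T₁.period, T₂.period]
    exact congrArg Subtype.val this
  obtain ⟨n, hn, hinj⟩ : ∃ n : ℕ, 0 < n ∧ ∀ s s' : ℂ, s.re < 0 → s'.re < 0 → x s = x s' →
      Complex.exp (n * s) = Complex.exp (n * s') := by
    rcases hef with he | hf
    · exact ⟨e, he, fun s s' hs hs' h => T₁.inj s s' hs hs' (by rw [← hx₁, ← hx₁, h])⟩
    · exact ⟨f, hf, fun s s' hs hs' h => T₂.inj s s' hs hs' (by rw [← hx₂, ← hx₂, h])⟩
  have hF : IsCompact (D₁.proj₁ π ⁻¹' {T₁.q} ∩ D₂.proj₂ π ⁻¹' {T₂.q}) :=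
    ((isClosed_singleton.preimage hq₁).inter (isClosed_singleton.preimage hq₂)).isCompact
  refine homotopic_refl_of_holomorphic_curve hx hhol hper hn hinj hF ?_
    ((T₁.isOpen_V.preimage hq₁).inter (T₂.isOpen_V.preimage hq₂)) ?_
    (Φ := fun y => T₁.X (D₁.proj₁ π y) ^ f - T₂.X (D₂.proj₂ π y) ^ e) ?_ ?_
    (b := min T₁.b₀ T₂.b₀) (min_le_of_left_le T₁.b₀_nonpos) ?_ γ hγ
  · intro W hW hFW
    -- the image of the complement of `W` is a closed set that does not contain the limit point
    have hK : IsClosed ((fun y => (D₁.proj₁ π y, D₂.proj₂ π y)) '' Wᶜ) :=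
      (hW.isClosed_compl.isCompact.image (hq₁.prodMk hq₂)).isClosed
    obtain ⟨O₁, O₂, hO₁, hO₂, hm₁, hm₂, hsub⟩ := isOpen_prod_iff.1 hK.isOpen_compl T₁.q T₂.q (by
      rintro ⟨y, hyW, hy⟩
      exact hyW (hFW ⟨congrArg Prod.fst hy, congrArg Prod.snd hy⟩))
    obtain ⟨β₁, hβ₁⟩ := T₁.lim O₁ hO₁ hm₁
    obtain ⟨β₂, hβ₂⟩ := T₂.lim O₂ hO₂ hm₂
    refine ⟨min β₁ β₂, fun s hs => ?_⟩
    rw [lt_min_iff] at hs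
    by_contra hxW
    refine hsub (mk_mem_prod (hβ₁ s hs.1) (hβ₂ s hs.2)) ⟨x s, hxW, ?_⟩
    simp only [hx₁, hx₂]
  · rintro y ⟨hy₁, hy₂⟩
    rw [mem_preimage, mem_singleton_iff] at hy₁ hy₂
    refine ⟨?_, ?_⟩
    · rw [mem_preimage, hy₁]
      exact T₁.q_mem
    · rw [mem_preimage, hy₂]
      exact T₂.q_mem
  · have h1 := hπ.holomorphic.mdifferentiableOn_lift (fun a c => D₁.f_smul a c.1)
      (D₁.holo.comp contMDiff_fst) T₁.isOpen_V T₁.X_holo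
    have h2 := hπ.holomorphic.mdifferentiableOn_lift (fun a c => D₂.f_smul a c.2)
      (D₂.holo.comp contMDiff_snd) T₂.isOpen_V T₂.X_holo
    exact ((h1.mono inter_subset_left).pow f).sub ((h2.mono inter_subset_right).pow e)
  · intro O hO hne hOV
    obtain ⟨q, hq, hqne⟩ := hπ.exists_pow_ne_pow hact₁ hact₂ T₁.X_inj T₂.X_inj hef hO hne hOV
    exact ⟨q, hq, sub_ne_zero.2 hqne⟩
  · intro s hs _
    rw [lt_min_iff] at hs
    simp only [hx₁, hx₂]
    rw [T₁.X_eq s hs.1, T₂.X_eq s hs.2, ← Complex.exp_nat_mul, ← Complex.exp_nat_mul, sub_eq_zero]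
    congr 1
    ring

/-- Every resolution of the product-quotient surface is simply connected: the loops in the
unramified part that become trivial in the resolution form a normal subgroup that contains all pairs
of conjugates of powers of standard loops. -/
theorem IsResolution.simplyConnectedSpace [Finite G] (hgood : ExtendsGoodPresentation g)
    [IsManifold 𝓘(ℂ) ω C₁] [IsManifold 𝓘(ℂ) ω C₂] [T2Space C₁] [T2Space C₂]
    [ConnectedSpace C₁] [ConnectedSpace C₂]
    [T2Space X] [IsManifold 𝓘(ℂ, EuclideanSpace ℂ (Fin 2)) ω X]
    (D₁ : BranchedCover g C₁) (D₂ : BranchedCover g C₂) (hπ : IsResolution G C₁ C₂ π)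
    (hact₁ : ∀ a : G, ContMDiff 𝓘(ℂ) 𝓘(ℂ) ω fun x : C₁ => a • x)
    (hact₂ : ∀ a : G, ContMDiff 𝓘(ℂ) 𝓘(ℂ) ω fun x : C₂ => a • x) : SimplyConnectedSpace X := by
  have h₁ := D₁.isQuotientCoveringMap hact₁
  have h₂ := D₂.isQuotientCoveringMap hact₂
  have hσ := hπ.isQuotientCoveringMap_cover D₁ D₂ hact₁ hact₂
  have hπc : Continuous π := hπ.proper.continuous
  let Q₁ : C(unramifiedPart D₁ D₂ π, PuncturedSphere D₁.p) :=
    ⟨fun x => ⟨D₁.proj₁ π x, x.2.1⟩,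
      ((D₁.continuous_proj₁ hπc).comp continuous_subtype_val).subtype_mk _⟩
  let Q₂ : C(unramifiedPart D₁ D₂ π, PuncturedSphere D₂.p) :=
    ⟨fun x => ⟨D₂.proj₂ π x, x.2.2⟩,
      ((D₂.continuous_proj₂ hπc).comp continuous_subtype_val).subtype_mk _⟩
  have hQ₁ : ∀ c, Q₁ (hπ.cover D₁ D₂ c) = D₁.fU c.1 := fun c =>
    Subtype.ext (hπ.proj₁_inv D₁ (D₁.mem_freeLocus c.1.2))
  have hQ₂ : ∀ c, Q₂ (hπ.cover D₁ D₂ c) = D₂.fU c.2 := fun c =>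
    Subtype.ext (hπ.proj₂_inv D₂ (D₁.mem_freeLocus c.1.2))
  -- the loops that become trivial in the resolution
  let ι : C(unramifiedPart D₁ D₂ π, X) := ⟨Subtype.val, continuous_subtype_val⟩
  let N := (FundamentalGroup.map ι (hπ.cover D₁ D₂ (D₁.base, D₂.base))).ker
  have hN : N = ⊤ := by
    refine normalSubgroup_eq_top_of_extendsGoodPresentation hgood h₁ h₂ hσ Q₁ Q₂ hQ₁ hQ₂
      D₁.word D₂.word D₁.word_surjective D₂.word_surjective (D₁.monodromy_word h₁)
      (D₂.monodromy_word h₂) D₂.word_prod N ?_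
    intro u v i j e f heq
    by_cases hef : e = 0 ∧ f = 0
    · obtain ⟨rfl, rfl⟩ := hef
      refine ⟨1, one_mem N, ?_, ?_⟩
      · rw [pow_zero, mul_one, mul_inv_cancel, map_one, map_one, unop_one]
      · rw [pow_zero, mul_one, mul_inv_cancel, map_one, map_one, unop_one]
    obtain ⟨T₁⟩ := D₁.nonempty_discLift h₁ u i e
    obtain ⟨T₂⟩ := D₂.nonempty_discLift h₂ v j f
    rw [← heq] at T₂
    set a := FreeGroup.lift g (u * FreeGroup.of i ^ e * u⁻¹)
    -- the loop is covered by a path from the base point, the boundary of the pair of discs, and the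
    -- translate of the path back
    let A : Path (D₁.base, D₂.base) (T₁.L 0, T₂.L 0) := T₁.A.prod T₂.A
    let B : Path (T₁.L 0, T₂.L 0) (a • (T₁.L 0, T₂.L 0)) :=
      { toFun := fun t => (T₁.L (2 * Real.pi * Complex.I * (t : ℝ)),
          T₂.L (2 * Real.pi * Complex.I * (t : ℝ)))
        continuous_toFun := by fun_prop
        source' := by simp
        target' := by
          have p₁ := T₁.period 0
          have p₂ := T₂.period 0
          rw [zero_add] at p₁ p₂
          simp [p₁, p₂] }
    let Γ : Path (D₁.base, D₂.base) (a • (D₁.base, D₂.base)) :=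
      (A.trans B).trans (A.map (hσ.continuous_const_smul a)).symm
    refine ⟨hσ.loopOfPath Γ, ?_, ?_, ?_⟩
    · let A' : Path (hπ.cover D₁ D₂ (D₁.base, D₂.base) : X) (hπ.cover D₁ D₂ (T₁.L 0, T₂.L 0)) :=
        A.map (continuous_subtype_val.comp hσ.continuous)
      let B' : Path (hπ.cover D₁ D₂ (T₁.L 0, T₂.L 0) : X) (hπ.cover D₁ D₂ (T₁.L 0, T₂.L 0)) :=
        (B.map (continuous_subtype_val.comp hσ.continuous)).cast rfl
          (congrArg Subtype.val (hσ.map_smul a)).symm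
      have hB' : B'.Homotopic (Path.refl _) := hπ.homotopic_refl_of_discLift hact₁ hact₂ hσ T₁ T₂
        (by omega) B' fun t => rfl
      rw [MonoidHom.mem_ker]
      have hmk : FundamentalGroup.map ι (hπ.cover D₁ D₂ (D₁.base, D₂.base)) (hσ.loopOfPath Γ) =
          Path.Homotopic.Quotient.mk ((A'.trans B').trans A'.symm) := by
        change Path.Homotopic.Quotient.mk _ = Path.Homotopic.Quotient.mk _
        congr 1
        ext t
        change ((hπ.cover D₁ D₂ (Γ t) : unramifiedPart D₁ D₂ π) : X) = _
        simp only [Γ, Path.trans_apply, Path.symm_apply, Path.map_coe, Function.comp_apply]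
        split_ifs
        · rfl
        · rfl
        · rw [hσ.map_smul]
          rfl
      rw [hmk, FundamentalGroup.one_def]
      simp only [Path.Homotopic.Quotient.mk_trans, Path.Homotopic.Quotient.mk_symm,
        Path.Homotopic.Quotient.eq.2 hB', Path.Homotopic.Quotient.mk_refl,
        Path.Homotopic.Quotient.trans_refl, Path.Homotopic.Quotient.trans_symm]
      rfl
    · rw [mapOfEq_fst_loopOfPath h₁ hσ Q₁ hQ₁, ← T₁.loop (B.map continuous_fst) fun t => rfl]
      congr 1
      simp only [Γ, Path.map_trans, Path.map_symm]
      rfl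
    · rw [mapOfEq_snd_loopOfPath h₂ hσ Q₂ hQ₂, ← T₂.loop (B.map continuous_snd) fun t => rfl]
      congr 1
      simp only [Γ, Path.map_trans, Path.map_symm]
      rfl
  refine (hasNiceBasis_unramifiedPart D₁ D₂ hπ hact₁ hact₂).simplyConnectedSpace
    (isPathConnected_unramifiedPart D₁ D₂ hπ hact₁ hact₂)
    (hπ.cover D₁ D₂ (D₁.base, D₂.base)).2 fun γ hγ => ?_
  let γ' : Path (hπ.cover D₁ D₂ (D₁.base, D₂.base)) (hπ.cover D₁ D₂ (D₁.base, D₂.base)) :=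
    ⟨⟨fun t => ⟨γ t, hγ t⟩, by fun_prop⟩, Subtype.ext γ.source, Subtype.ext γ.target⟩
  have hγN : FundamentalGroup.fromPath (Path.Homotopic.Quotient.mk γ') ∈ N :=
    hN ▸ Subgroup.mem_top _
  exact Path.Homotopic.Quotient.eq.1 (MonoidHom.mem_ker.1 hγN)

end SimpleConnectedness

theorem mainTheorem8 {G : Type*} [Group G] [Finite G] {r : ℕ} (g : Fin r → G)
    (hg : IsSphericalGenerators g) (hgood : ExtendsGoodPresentation g) :
    NormallyGeneratedByTorsion (orbifoldGroup g hg) ∧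
    ∀ (C₁ C₂ X : Type*)
      [TopologicalSpace C₁] [ChartedSpace ℂ C₁] [IsManifold 𝓘(ℂ) ω C₁]
      [T2Space C₁] [CompactSpace C₁] [ConnectedSpace C₁]
      [TopologicalSpace C₂] [ChartedSpace ℂ C₂] [IsManifold 𝓘(ℂ) ω C₂]
      [T2Space C₂] [CompactSpace C₂] [ConnectedSpace C₂]
      [MulAction G C₁] [FaithfulSMul G C₁] [MulAction G C₂] [FaithfulSMul G C₂]
      [TopologicalSpace X] [ChartedSpace (EuclideanSpace ℂ (Fin 2)) X]
      [IsManifold 𝓘(ℂ, EuclideanSpace ℂ (Fin 2)) ω X] [T2Space X]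
      (π : X → ProductQuotient G C₁ C₂),
      (∀ a : G, ContMDiff 𝓘(ℂ) 𝓘(ℂ) ω (fun x : C₁ => a • x)) →
      (∀ a : G, ContMDiff 𝓘(ℂ) 𝓘(ℂ) ω (fun x : C₂ => a • x)) →
      HasMonodromy g C₁ → HasMonodromy g C₂ →
      IsMinimalResolution G C₁ C₂ π →
      SimplyConnectedSpace X := by
  refine ⟨normallyGeneratedByTorsion_orbifoldGroup g hg hgood, ?_⟩
  intro C₁ C₂ X _ _ _ _ _ _ _ _ _ _ _ _ _ _ _ _ _ _ _ _ π hact₁ hact₂ hm₁ hm₂ hπ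
  obtain ⟨D₁⟩ := hm₁.nonempty_branchedCover
  obtain ⟨D₂⟩ := hm₂.nonempty_branchedCover
  exact hπ.1.simplyConnectedSpace hgood D₁ D₂ hact₁ hact₂
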